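/- Work over $\mathbb{C}$. Let $N$ be a free abelian group of finite rank, $M=\mathrm{Hom}(N,\mathbb{Z})$, $T=\mathrm{Spec}\,\mathbb{C}[M]$, and let $Y$ be a normal projective variety. A polyhedral divisor on $(Y,N)$ with tailcone $\sigma$ is a finite formal sum $\mathcal{D}=\sum_Z \mathcal{D}_Z\otimes Z$, where $\sigma\subseteq N_{\mathbb{Q}}$ is a polyhedral cone containing no nonzero linear subspace, the $Z$ are effective Cartier divisors on $Y$, and each $\mathcal{D}_Z\subseteq N_{\mathbb{Q}}$ is either empty or a polyhedron with tailcone $\{a \mid a+\mathcal{D}_Z\subseteq \mathcal{D}_Z\}=\sigma$. Put $\mathrm{Loc}(\mathcal{D})=Y\setminus\bigcup_{\mathcal{D}_Z=\emptyset}Z$ and, for $u\in\sigma^\vee\subseteq M_{\mathbb{Q}}$, $\mathcal{D}(u)=\sum_{\mathcal{D}_Z\neq\emptyset}\min\langle\mathcal{D}_Z,u\rangle\, Z|_{\mathrm{Loc}(\mathcal{D})}$, a $\mathbb{Q}$-Cartier divisor on $\mathrm{Loc}(\mathcal{D})$. Call $\mathcal{D}$ a p-divisor if every $\mathcal{D}(u)$,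 $u\in\sigma^\vee$, is semiample (some positive integral multiple is Cartier and base point free) and every $\mathcal{D}(u)$ with $u$ in the interior of $\sigma^\vee$ is big (some positive integral multiple is Cartier and has a section whose nonvanishing locus is affine and nonempty). With $\Gamma(U,\mathcal{O}(E))=\{f\in\mathbb{C}(Y)\mid f=0 \text{ or } (\mathrm{div} f+E)|_U\ge 0\}$ set $$TV(\mathcal{D})=\mathrm{Spec}\bigoplus_{u\in\sigma^\vee\cap M}\Gamma\big(\mathrm{Loc}(\mathcal{D}),\mathcal{O}(\mathcal{D}(u))\big)\chi^u ,$$ an affine scheme over $\mathbb{C}$ on which $T$ acts through the $M$-grading. Let $\mathcal{D}$ be a p-divisor on $(Y,N)$ with tailcone $\sigma$ and $\mathcal{D}'$ a p-divisor on $(Y',N')$ with tailcone $\sigma'$, where $Y,Y'$ are normal projective varieties and $N,N'$ are free abelian groups of finite rank with tori $T,T'$. Define on $(Y\times Y',N\oplus N')$ the polyhedral divisor $$\mathcal{D}\times\mathcal{D}'=\sum_{Z}(\mathcal{D}_Z\times\sigma')\otimes(Z\times Y')+\sum_{Z'}(\sigma\times\mathcal{D}'_{Z'})\otimes(Y\times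 Z')$$ with tailcone $\sigma\times\sigma'$. Then all evaluations of $\mathcal{D}\times\mathcal{D}'$ at elements of $(\sigma\times\sigma')^\vee$ are semiample, those at interior elements are big (so $\mathcal{D}\times\mathcal{D}'$ is again a p-divisor), and there is a $T\times T'$-equivariant isomorphism of schemes over $\mathbb{C}$ $$TV(\mathcal{D}\times\mathcal{D}')\;\cong\; TV(\mathcal{D})\times TV(\mathcal{D}').$$ -/

import Mathlib

open AlgebraicGeometry CategoryTheory CategoryTheory.Limits
open scoped TensorProduct Pointwise

noncomputable section

namespace TVar

/-! ### Integrality of products over the complex numbers -/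

/-- The tensor product over `ℂ` of two domains, one of finite type, is a domain. -/
theorem isDomain_tensorProduct (A B : Type) [CommRing A] [CommRing B] [Algebra ℂ A] [Algebra ℂ B]
    [IsDomain A] [IsDomain B] [Algebra.FiniteType ℂ A] : IsDomain (A ⊗[ℂ] B) := by
  have : Nontrivial (A ⊗[ℂ] B) :=
    (Algebra.TensorProduct.includeLeft_injective (S := ℂ) (A := A) (B := B)
      (FaithfulSMul.algebraMap_injective ℂ B)).nontrivial
  have : NoZeroDivisors (A ⊗[ℂ] B) := by
    refine ⟨fun {x y} hxy => ?_⟩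
    let b := Algebra.TensorProduct.basis A (Module.Free.chooseBasis ℂ B)
    by_contra! hne
    obtain ⟨i, hi⟩ : ∃ i, b.repr x i ≠ 0 := by
      by_contra! h; exact hne.1 (b.repr.map_eq_zero_iff.mp (Finsupp.ext h))
    obtain ⟨j, hj⟩ : ∃ j, b.repr y j ≠ 0 := by
      by_contra! h; exact hne.2 (b.repr.map_eq_zero_iff.mp (Finsupp.ext h))
    have hJ : IsJacobsonRing A := isJacobsonRing_of_finiteType (A := ℂ)
    have hjac : (⊥ : Ideal A).jacobson = ⊥ :=
      hJ.out ((Ideal.isPrime_bot (α := A)).isRadical)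
    have hmem : b.repr x i * b.repr y j ∈ (⊥ : Ideal A).jacobson := by
      rw [Ideal.jacobson, Ideal.mem_sInf]
      rintro m ⟨-, hm⟩
      have := hm
      let : Field (A ⧸ m) := Ideal.Quotient.field m
      have hfin : Module.Finite ℂ (A ⧸ m) := finite_of_finite_type_of_isJacobsonRing ℂ (A ⧸ m)
      have hbij : Function.Bijective (algebraMap ℂ (A ⧸ m)) :=
        IsAlgClosed.algebraMap_bijective_of_isIntegral
      let e : ℂ ≃ₐ[ℂ] (A ⧸ m) := AlgEquiv.ofBijective (Algebra.ofId ℂ (A ⧸ m)) hbij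
      let φ : A →ₐ[ℂ] ℂ := (e.symm : (A ⧸ m) →ₐ[ℂ] ℂ).comp (Ideal.Quotient.mkₐ ℂ m)
      have hφ : ∀ a, φ a = 0 → a ∈ m := fun a ha => by
        have : Ideal.Quotient.mk m a = 0 := e.symm.map_eq_zero_iff.mp ha
        exact Ideal.Quotient.eq_zero_iff_mem.mp this
      let ψ : A ⊗[ℂ] B →ₐ[ℂ] B :=
        Algebra.TensorProduct.lift ((Algebra.ofId ℂ B).comp φ) (AlgHom.id ℂ B)
          (fun _ _ => Commute.all _ _)
      have key : ∀ z : A ⊗[ℂ] B, ∀ k, ψ z = 0 → b.repr z k ∈ m := by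
        intro z k hz
        have h1 : ∀ z : A ⊗[ℂ] B, (Module.Free.chooseBasis ℂ B).repr (ψ z) k = φ (b.repr z k) := by
          intro z
          induction z using TensorProduct.induction_on with
          | zero => simp
          | add z w hz hw => simp [map_add, hz, hw]
          | tmul a c =>
            have : ψ (a ⊗ₜ c) = φ a • c := by
              simp [ψ, Algebra.ofId_apply, Algebra.smul_def]
            rw [this]
            simp [b, Algebra.TensorProduct.basis_repr_tmul]
        apply hφ; rw [← h1, hz]; simp
      have hxy' : ψ x * ψ y = 0 := by rw [← map_mul, hxy, map_zero]
      rcases mul_eq_zero.mp hxy' with h | h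
      · exact m.mul_mem_right _ (key x i h)
      · exact m.mul_mem_left _ (key y j h)
    rw [hjac] at hmem
    exact (mul_ne_zero hi hj) (by simpa using hmem)
  exact NoZeroDivisors.to_isDomain _

/-- The base scheme `Spec ℂ`. -/
abbrev SpecC : Scheme.{0} := Spec (CommRingCat.of ℂ)

theorem isIntegral_pullback_Spec {R S : CommRingCat.{0}} [IsDomain R] [IsDomain S]
    (f : Spec R ⟶ SpecC) (g : Spec S ⟶ SpecC) [LocallyOfFiniteType f] :
    IsIntegral (pullback f g) := by
  obtain ⟨f, rfl⟩ := Spec.map_surjective f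
  obtain ⟨g, rfl⟩ := Spec.map_surjective g
  let : Algebra ℂ R := f.hom.toAlgebra
  let : Algebra ℂ S := g.hom.toAlgebra
  have : Algebra.FiniteType ℂ R := by
    exact (HasRingHomProperty.Spec_iff (P := @LocallyOfFiniteType)).mp ‹_›
  have := isDomain_tensorProduct R S
  have h2 : IsIntegral (Spec (CommRingCat.of (R ⊗[ℂ] S))) := inferInstance
  exact IsIntegral.of_isIso (pullbackSpecIso ℂ R S).inv

theorem isDomain_affineCover (X : Scheme.{0}) [IsIntegral X] (i : X.affineCover.I₀) :
    Nonempty (X.affineCover.X i) ∧ ∃ R : CommRingCat.{0}, IsDomain R ∧ X.affineCover.X i = Spec R := by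
  have hne : Nonempty (X.affineCover.X i) :=
    ⟨(X.local_affine i).choose_spec.choose_spec.some.hom.base
      ⟨i, (X.local_affine i).choose.2⟩⟩
  have := isIntegral_of_isOpenImmersion (X.affineCover.f i)
  exact ⟨hne, _, (affine_isIntegral_iff _).mp this, rfl⟩

/-- The fibre product over `ℂ` of integral schemes, one locally of finite type, is integral. -/
theorem isIntegral_pullback {X Y : Scheme.{0}} (f : X ⟶ SpecC) (g : Y ⟶ SpecC)
    [IsIntegral X] [IsIntegral Y] [LocallyOfFiniteType f] : IsIntegral (pullback f g) := by
  let 𝒰 := Scheme.Pullback.openCoverOfLeftRight X.affineCover Y.affineCover f g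
  have hpt : ∀ (x : X) (y : Y), ∃ z : (pullback f g : Scheme),
      pullback.fst f g z = x ∧ pullback.snd f g z = y := fun x y =>
    Scheme.Pullback.exists_preimage_pullback x y (Subsingleton.elim _ _)
  have hint : ∀ i, IsIntegral (𝒰.X i) := by
    intro i
    obtain ⟨-, R, hR, eR⟩ := isDomain_affineCover X i.1
    obtain ⟨-, S, hS, eS⟩ := isDomain_affineCover Y i.2
    have : LocallyOfFiniteType (X.affineCover.f i.1 ≫ f) := inferInstance
    change IsIntegral (pullback (X.affineCover.f i.1 ≫ f) (Y.affineCover.f i.2 ≫ g))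
    generalize X.affineCover.f i.1 ≫ f = f' at *
    generalize Y.affineCover.f i.2 ≫ g = g' at *
    revert f' g'
    rw [eR, eS]
    intro f' _ g'
    exact isIntegral_pullback_Spec f' g'
  have hred : IsReduced (pullback f g) :=
    have : ∀ i, IsReduced (𝒰.X i) := fun i => inferInstance
    IsReduced.of_openCover _ 𝒰
  have hne : Nonempty (pullback f g : Scheme) :=
    (hpt (Classical.arbitrary X) (Classical.arbitrary Y)).nonempty
  have hpre : PreirreducibleSpace (pullback f g : Scheme) := by
    refine PreirreducibleSpace.of_isOpenCover (U := fun i => (𝒰.f i).opensRange) ?_ ?_ ?_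
    · intro i j _ hdis
      have hinter : ∀ (Z : Scheme.{0}) [IsIntegral Z] (k l : Z.affineCover.I₀),
          ((Z.affineCover.f k).opensRange ∩ (Z.affineCover.f l).opensRange : Set Z).Nonempty := by
        intro Z _ k l
        obtain ⟨⟨p⟩, -⟩ := isDomain_affineCover Z k
        obtain ⟨⟨q⟩, -⟩ := isDomain_affineCover Z l
        exact nonempty_preirreducible_inter (Z.affineCover.f k).opensRange.2
          (Z.affineCover.f l).opensRange.2 ⟨_, p, rfl⟩ ⟨_, q, rfl⟩
      obtain ⟨x, hx1, hx2⟩ := hinter X i.1 j.1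
      obtain ⟨y, hy1, hy2⟩ := hinter Y i.2 j.2
      obtain ⟨z, rfl, rfl⟩ := hpt x y
      have hr : ∀ k, Set.range (𝒰.f k) = pullback.fst f g ⁻¹' Set.range (X.affineCover.f k.1) ∩
          pullback.snd f g ⁻¹' Set.range (Y.affineCover.f k.2) := fun k =>
        by
        exact Scheme.Pullback.range_map (X.affineCover.f k.1 ≫ f) (Y.affineCover.f k.2 ≫ g) f g
          (X.affineCover.f k.1) (Y.affineCover.f k.2) (𝟙 _) (Category.comp_id _) (Category.comp_id _)
      have h1 : z ∈ Set.range (𝒰.f i) := by rw [hr]; exact ⟨hx1, hy1⟩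
      have h2 : z ∈ Set.range (𝒰.f j) := by rw [hr]; exact ⟨hx2, hy2⟩
      exact (Set.disjoint_left.mp (TopologicalSpace.Opens.coe_disjoint.mpr hdis)) h1 h2
    · exact 𝒰.isOpenCover_opensRange
    · intro i
      have := hint i
      have h1 : IsPreirreducible (Set.range (𝒰.f i)) := by
        rw [← Set.image_univ]
        exact (PreirreducibleSpace.isPreirreducible_univ).image _ (𝒰.f i).continuous.continuousOn
      exact Subtype.preirreducibleSpace h1
  have : IrreducibleSpace (pullback f g : Scheme) := { hpre with toNonempty := hne }
  exact isIntegral_of_irreducibleSpace_of_isReduced _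

/-! ### Polyhedra and cones in rational vector spaces -/

/-- The rational vector space `N_ℚ = ℚ ⊗ N`. -/
abbrev NQ (N : Type) [AddCommGroup N] : Type := ℚ ⊗[ℤ] N
/-- The dual lattice `M = Hom(N, ℤ)`. -/
abbrev MZ (N : Type) [AddCommGroup N] : Type := Module.Dual ℤ N
/-- `M_ℚ`, as the dual of `N_ℚ`. -/
abbrev MQ (N : Type) [AddCommGroup N] : Type := Module.Dual ℚ (NQ N)

section Convex
variable {E : Type} [AddCommGroup E] [Module ℚ E]

/-- A nonempty polyhedron in a rational vector space: the Minkowski sum of a polytope (the convex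
hull of a nonempty finite set) and a finitely generated cone. -/
def IsPolyhedron (Δ : Set E) : Prop :=
  ∃ (V : Set E) (τ : PointedCone ℚ E), V.Finite ∧ V.Nonempty ∧ τ.FG ∧
    Δ = convexHull ℚ V + (τ : Set E)

/-- The tailcone `{a | a + Δ ⊆ Δ}`. -/
def tailCone (Δ : Set E) : Set E := {a | ∀ x ∈ Δ, a + x ∈ Δ}

/-- The minimum `min ⟨Δ, u⟩` (with value `0` if there is no minimum, e.g. `Δ = ∅`). -/
def minOn (Δ : Set E) (u : Module.Dual ℚ E) : ℚ :=
  open Classical in if h : ∃ m, IsLeast (u '' Δ) m then h.choose else 0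

/-- The dual cone `σ^∨ = {u | ⟨σ, u⟩ ≥ 0}`. -/
def dualCone (σ : PointedCone ℚ E) : PointedCone ℚ (Module.Dual ℚ E) :=
  PointedCone.dual (Module.Dual.eval ℚ E) (σ : Set E)

/-- The (algebraic) interior of a convex cone: from `u` one can move a little in every direction
without leaving the cone. For convex polyhedral sets this is the topological interior. -/
def core (C : PointedCone ℚ E) : Set E := {u | ∀ w, ∃ ε : ℚ, 0 < ε ∧ u + ε • w ∈ C}

theorem mem_dualCone {σ : PointedCone ℚ E} {u : Module.Dual ℚ E} :
    u ∈ dualCone σ ↔ ∀ v ∈ σ, 0 ≤ u v := Iff.rfl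

theorem minOn_eq {Δ : Set E} {u : Module.Dual ℚ E} {m : ℚ} (h : IsLeast (u '' Δ) m) :
    minOn Δ u = m := by
  have h' : ∃ m, IsLeast (u '' Δ) m := ⟨m, h⟩
  rw [minOn, dif_pos h']
  exact h'.choose_spec.unique h

theorem minOn_empty (u : Module.Dual ℚ E) : minOn (∅ : Set E) u = 0 := by
  rw [minOn, dif_neg]; rintro ⟨m, ⟨x, hx, -⟩, -⟩; exact hx

theorem IsPolyhedron.isLeast_minOn {Δ : Set E} (hΔ : IsPolyhedron Δ) {u : Module.Dual ℚ E}
    (hu : ∀ a ∈ tailCone Δ, 0 ≤ u a) : IsLeast (u '' Δ) (minOn Δ u) := by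
  obtain ⟨V, τ, hV, hne, -, rfl⟩ := hΔ
  have hτ : ∀ t ∈ τ, 0 ≤ u t := fun t ht => hu t (by
    rintro _ ⟨c, hc, s, hs, rfl⟩
    exact ⟨c, hc, t + s, τ.add_mem ht hs, by simp only []; abel⟩)
  obtain ⟨v, hv, hmin⟩ := hV.exists_minimalFor u V hne
  have hmin' : ∀ w ∈ V, u v ≤ u w := fun w hw => (le_total (u v) (u w)).elim id (hmin hw)
  have hL : IsLeast (u '' (convexHull ℚ V + (τ : Set E))) (u v) := by
    refine ⟨⟨v, ⟨v, subset_convexHull ℚ V hv, 0, τ.zero_mem, add_zero v⟩, rfl⟩, ?_⟩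
    rintro _ ⟨_, ⟨c, hc, t, ht, rfl⟩, rfl⟩
    have hc' : u v ≤ u c := by
      have : convexHull ℚ V ⊆ {x | u v ≤ u x} :=
        convexHull_min hmin' (convex_halfSpace_ge u.isLinear _)
      exact this hc
    simp only [map_add]
    linarith [hτ t ht]
  rwa [minOn_eq hL]

theorem minOn_add_le {Δ : Set E} (hΔ : IsPolyhedron Δ) {u u' : Module.Dual ℚ E}
    (hu : ∀ a ∈ tailCone Δ, 0 ≤ u a) (hu' : ∀ a ∈ tailCone Δ, 0 ≤ u' a) :
    minOn Δ u + minOn Δ u' ≤ minOn Δ (u + u') := by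
  obtain ⟨⟨x, hx, hx'⟩, -⟩ := hΔ.isLeast_minOn (u := u + u')
    (fun a ha => by simpa using add_nonneg (hu a ha) (hu' a ha))
  rw [← hx', LinearMap.add_apply]
  exact add_le_add ((hΔ.isLeast_minOn hu).2 ⟨x, hx, rfl⟩) ((hΔ.isLeast_minOn hu').2 ⟨x, hx, rfl⟩)

theorem minOn_zero {Δ : Set E} : minOn Δ 0 = 0 := by
  rcases Δ.eq_empty_or_nonempty with rfl | h
  · exact minOn_empty 0
  · apply minOn_eq
    obtain ⟨x, hx⟩ := h
    refine ⟨⟨x, hx, rfl⟩, ?_⟩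
    rintro _ ⟨y, -, rfl⟩
    exact le_rfl
end Convex

section Lattice
variable {N N' : Type} [AddCommGroup N] [AddCommGroup N']

/-- The canonical map `M → M_ℚ`, `u ↦ (q ⊗ n ↦ q * u n)`. -/
def toMQ : MZ N →ₗ[ℤ] MQ N := Module.Dual.baseChange ℚ

theorem toMQ_tmul (u : MZ N) (q : ℚ) (n : N) : toMQ u (q ⊗ₜ n) = u n • q := by
  simp [toMQ]

variable (N N') in
/-- The projection `(N × N')_ℚ → N_ℚ`. -/
def fstQ : NQ (N × N') →ₗ[ℚ] NQ N := (LinearMap.fst ℤ N N').baseChange ℚ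
variable (N N') in
/-- The projection `(N × N')_ℚ → N'_ℚ`. -/
def sndQ : NQ (N × N') →ₗ[ℚ] NQ N' := (LinearMap.snd ℤ N N').baseChange ℚ
variable (N N') in
/-- The inclusion `N_ℚ → (N × N')_ℚ`. -/
def inlQ : NQ N →ₗ[ℚ] NQ (N × N') := (LinearMap.inl ℤ N N').baseChange ℚ
variable (N N') in
/-- The inclusion `N'_ℚ → (N × N')_ℚ`. -/
def inrQ : NQ N' →ₗ[ℚ] NQ (N × N') := (LinearMap.inr ℤ N N').baseChange ℚ

/-- The product `S × S'` inside `(N × N')_ℚ = N_ℚ × N'_ℚ`. -/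
def prodSet (S : Set (NQ N)) (S' : Set (NQ N')) : Set (NQ (N × N')) :=
  {x | fstQ N N' x ∈ S ∧ sndQ N N' x ∈ S'}

/-- The product cone `σ × σ'` in `(N × N')_ℚ`. -/
def prodCone (σ : PointedCone ℚ (NQ N)) (σ' : PointedCone ℚ (NQ N')) :
    PointedCone ℚ (NQ (N × N')) where
  carrier := prodSet σ σ'
  zero_mem' := by simp [prodSet]
  add_mem' {x y} hx hy := by
    refine ⟨?_, ?_⟩
    · rw [map_add]; exact σ.add_mem hx.1 hy.1
    · rw [map_add]; exact σ'.add_mem hx.2 hy.2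
  smul_mem' c x hx := by
    refine ⟨?_, ?_⟩
    · change fstQ N N' ((c : ℚ) • x) ∈ _; rw [map_smul]; exact σ.smul_mem c.2 hx.1
    · change sndQ N N' ((c : ℚ) • x) ∈ _; rw [map_smul]; exact σ'.smul_mem c.2 hx.2

@[simp] theorem fstQ_inlQ (x : NQ N) : fstQ N N' (inlQ N N' x) = x := by
  have : fstQ N N' ∘ₗ inlQ N N' = LinearMap.id := by
    rw [fstQ, inlQ, ← LinearMap.baseChange_comp]; simp
  exact LinearMap.congr_fun this x
@[simp] theorem sndQ_inlQ (x : NQ N) : sndQ N N' (inlQ N N' x) = 0 := by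
  have : sndQ N N' ∘ₗ inlQ N N' = 0 := by
    rw [sndQ, inlQ, ← LinearMap.baseChange_comp]; simp
  exact LinearMap.congr_fun this x
@[simp] theorem sndQ_inrQ (x : NQ N') : sndQ N N' (inrQ N N' x) = x := by
  have : sndQ N N' ∘ₗ inrQ N N' = LinearMap.id := by
    rw [sndQ, inrQ, ← LinearMap.baseChange_comp]; simp
  exact LinearMap.congr_fun this x
@[simp] theorem fstQ_inrQ (x : NQ N') : fstQ N N' (inrQ N N' x) = 0 := by
  have : fstQ N N' ∘ₗ inrQ N N' = 0 := by
    rw [fstQ, inrQ, ← LinearMap.baseChange_comp]; simp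
  exact LinearMap.congr_fun this x
theorem inlQ_add_inrQ (x : NQ (N × N')) :
    inlQ N N' (fstQ N N' x) + inrQ N N' (sndQ N N' x) = x := by
  have : inlQ N N' ∘ₗ fstQ N N' + inrQ N N' ∘ₗ sndQ N N' = LinearMap.id := by
    rw [fstQ, inlQ, sndQ, inrQ, ← LinearMap.baseChange_comp, ← LinearMap.baseChange_comp,
      ← LinearMap.baseChange_add]
    have : LinearMap.inl ℤ N N' ∘ₗ LinearMap.fst ℤ N N' +
        LinearMap.inr ℤ N N' ∘ₗ LinearMap.snd ℤ N N' = LinearMap.id := by ext <;> simp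
    rw [this, LinearMap.baseChange_id]
  exact LinearMap.congr_fun this x
theorem prodQ_ext {x y : NQ (N × N')} (h : fstQ N N' x = fstQ N N' y)
    (h' : sndQ N N' x = sndQ N N' y) : x = y := by
  rw [← inlQ_add_inrQ x, ← inlQ_add_inrQ y, h, h']

theorem prodCone_eq (σ : PointedCone ℚ (NQ N)) (σ' : PointedCone ℚ (NQ N')) :
    prodCone σ σ' = σ.map (inlQ N N') ⊔ σ'.map (inrQ N N') := by
  apply le_antisymm
  · intro x hx
    rw [← inlQ_add_inrQ x]
    exact Submodule.add_mem_sup (Submodule.mem_map_of_mem hx.1) (Submodule.mem_map_of_mem hx.2)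
  · rw [sup_le_iff]
    constructor
    · rintro _ ⟨y, hy, rfl⟩
      change fstQ N N' (inlQ N N' y) ∈ σ ∧ sndQ N N' (inlQ N N' y) ∈ σ'
      simpa using hy
    · rintro _ ⟨y, hy, rfl⟩
      change fstQ N N' (inrQ N N' y) ∈ σ ∧ sndQ N N' (inrQ N N' y) ∈ σ'
      simpa using hy

theorem prodCone_fg {σ : PointedCone ℚ (NQ N)} {σ' : PointedCone ℚ (NQ N')}
    (h : σ.FG) (h' : σ'.FG) : (prodCone σ σ').FG := by
  rw [prodCone_eq]; exact (h.map _).sup (h'.map _)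

theorem isPolyhedron_prod {Δ : Set (NQ N)} {Δ' : Set (NQ N')} (h : IsPolyhedron Δ)
    (h' : IsPolyhedron Δ') : IsPolyhedron (prodSet Δ Δ') := by
  obtain ⟨V, τ, hV, hne, hfg, rfl⟩ := h
  obtain ⟨V', τ', hV', hne', hfg', rfl⟩ := h'
  refine ⟨inlQ N N' '' V + inrQ N N' '' V', prodCone τ τ', (hV.image _).add (hV'.image _),
    (hne.image _).add (hne'.image _), prodCone_fg hfg hfg', ?_⟩
  rw [convexHull_add, ← LinearMap.image_convexHull, ← LinearMap.image_convexHull]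
  ext x
  constructor
  · rintro ⟨⟨c, hc, t, ht, h1⟩, ⟨c', hc', t', ht', h2⟩⟩
    refine ⟨inlQ N N' c + inrQ N N' c', ⟨_, ⟨c, hc, rfl⟩, _, ⟨c', hc', rfl⟩, rfl⟩,
      inlQ N N' t + inrQ N N' t', ?_, ?_⟩
    · change fstQ N N' _ ∈ τ ∧ sndQ N N' _ ∈ τ'
      simpa using ⟨ht, ht'⟩
    · apply prodQ_ext <;> simp [← h1, ← h2]
  · rintro ⟨_, ⟨_, ⟨c, hc, rfl⟩, _, ⟨c', hc', rfl⟩, rfl⟩, t, ⟨ht, ht'⟩, rfl⟩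
    exact ⟨⟨c, hc, _, ht, by simp⟩, ⟨c', hc', _, ht', by simp⟩⟩

theorem tailCone_prod {Δ : Set (NQ N)} {Δ' : Set (NQ N')} (h : Δ.Nonempty) (h' : Δ'.Nonempty) :
    tailCone (prodSet Δ Δ') = prodSet (tailCone Δ) (tailCone Δ') := by
  ext a
  constructor
  · intro ha
    obtain ⟨x, hx⟩ := h
    obtain ⟨x', hx'⟩ := h'
    refine ⟨fun y hy => ?_, fun y hy => ?_⟩
    · simpa using (ha (inlQ N N' y + inrQ N N' x') (by simpa [prodSet] using ⟨hy, hx'⟩)).1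
    · simpa using (ha (inlQ N N' x + inrQ N N' y) (by simpa [prodSet] using ⟨hx, hy⟩)).2
  · rintro ⟨ha, ha'⟩ x ⟨hx, hx'⟩
    exact ⟨by rw [map_add]; exact ha _ hx, by rw [map_add]; exact ha' _ hx'⟩

theorem isPolyhedron_cone {E : Type} [AddCommGroup E] [Module ℚ E] {σ : PointedCone ℚ E}
    (h : σ.FG) : IsPolyhedron (σ : Set E) :=
  ⟨{0}, σ, Set.finite_singleton _, Set.singleton_nonempty _, h, by simp⟩

theorem tailCone_cone {E : Type} [AddCommGroup E] [Module ℚ E] (σ : PointedCone ℚ E) :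
    tailCone (σ : Set E) = σ := by
  ext a
  exact ⟨fun h => by simpa using h 0 σ.zero_mem, fun h x hx => σ.add_mem h hx⟩

theorem IsPolyhedron.nonempty {E : Type} [AddCommGroup E] [Module ℚ E] {Δ : Set E}
    (h : IsPolyhedron Δ) : Δ.Nonempty := by
  obtain ⟨V, τ, -, hne, -, rfl⟩ := h
  exact (convexHull_nonempty_iff.mpr hne).add ⟨0, τ.zero_mem⟩

end Lattice

/-! ### Varieties -/

instance (Y : Scheme.{0}) [Nonempty Y] : Nonempty (⊤ : Y.Opens) :=
  ⟨⟨Classical.arbitrary Y, trivial⟩⟩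

attribute [local instance] MvPolynomial.gradedAlgebra

/-- The function field of an integral scheme over `ℂ` is a `ℂ`-algebra. -/
instance functionFieldAlgebra (Y : Scheme.{0}) [Y.Over SpecC] [IsIntegral Y] :
    Algebra ℂ Y.functionField :=
  ((Scheme.ΓSpecIso (CommRingCat.of ℂ)).inv ≫ (Y ↘ SpecC).appTop ≫
    Y.germToFunctionField ⊤).hom.toAlgebra

/-- Projective space `ℙⁿ = Proj ℂ[x₀, …, xₙ]`. -/
def ProjSpace (n : ℕ) : Scheme.{0} :=
  Proj (MvPolynomial.homogeneousSubmodule (Fin (n + 1)) ℂ)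

/-- The structure morphism `ℙⁿ → Spec ℂ`. -/
def ProjSpace.toSpecC (n : ℕ) : ProjSpace n ⟶ SpecC :=
  Proj.toSpecZero (MvPolynomial.homogeneousSubmodule (Fin (n + 1)) ℂ) ≫
    Spec.map (CommRingCat.ofHom
      (algebraMap ℂ (MvPolynomial.homogeneousSubmodule (Fin (n + 1)) ℂ 0)))

/-- A variety over `ℂ`: an integral separated scheme of finite type over `ℂ`. -/
class IsVariety (Y : Scheme.{0}) [Y.Over SpecC] : Prop where
  integral : IsIntegral Y
  separated : IsSeparated (Y ↘ SpecC)
  locallyOfFiniteType : LocallyOfFiniteType (Y ↘ SpecC)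
  quasiCompact : QuasiCompact (Y ↘ SpecC)

/-- A normal projective variety over `ℂ`: all local rings are integrally closed, and there is a
closed immersion over `ℂ` into some `ℙⁿ`. -/
class IsNormalProjectiveVariety (Y : Scheme.{0}) [Y.Over SpecC] : Prop extends IsVariety Y where
  normal : ∀ y : Y, IsIntegrallyClosed (Y.presheaf.stalk y)
  projective : ∃ (n : ℕ) (i : Y ⟶ ProjSpace n), IsClosedImmersion i ∧
    i ≫ ProjSpace.toSpecC n = Y ↘ SpecC

attribute [instance] IsVariety.integral IsVariety.separated IsVariety.locallyOfFiniteType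
  IsVariety.quasiCompact

instance (Y : Scheme.{0}) [Y.Over SpecC] [IsVariety Y] : IsLocallyNoetherian Y :=
  LocallyOfFiniteType.isLocallyNoetherian (Y ↘ SpecC)

/-- The product `Y × Y'` over `ℂ`. -/
def prodC (Y Y' : Scheme.{0}) [Y.Over SpecC] [Y'.Over SpecC] : Scheme.{0} :=
  pullback (Y ↘ SpecC) (Y' ↘ SpecC)

namespace prodC
variable (Y Y' : Scheme.{0}) [Y.Over SpecC] [Y'.Over SpecC]
/-- The first projection. -/
def fst : prodC Y Y' ⟶ Y := pullback.fst _ _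
/-- The second projection. -/
def snd : prodC Y Y' ⟶ Y' := pullback.snd _ _
instance : (prodC Y Y').Over SpecC := ⟨fst Y Y' ≫ Y ↘ SpecC⟩

variable [IsVariety Y] [IsVariety Y']

instance : IsVariety (prodC Y Y') where
  integral := isIntegral_pullback _ _
  separated := inferInstanceAs (IsSeparated (pullback.fst (Y ↘ SpecC) (Y' ↘ SpecC) ≫ Y ↘ SpecC))
  locallyOfFiniteType :=
    inferInstanceAs (LocallyOfFiniteType (pullback.fst (Y ↘ SpecC) (Y' ↘ SpecC) ≫ Y ↘ SpecC))
  quasiCompact :=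
    inferInstanceAs (QuasiCompact (pullback.fst (Y ↘ SpecC) (Y' ↘ SpecC) ≫ Y ↘ SpecC))

instance : Surjective (fst Y Y') := by
  have : Surjective (Y' ↘ SpecC) :=
    ⟨fun s => ⟨Classical.arbitrary Y', Subsingleton.elim _ _⟩⟩
  exact inferInstanceAs (Surjective (pullback.fst (Y ↘ SpecC) (Y' ↘ SpecC)))

instance : Surjective (snd Y Y') := by
  have : Surjective (Y ↘ SpecC) :=
    ⟨fun s => ⟨Classical.arbitrary Y, Subsingleton.elim _ _⟩⟩
  exact inferInstanceAs (Surjective (pullback.snd (Y ↘ SpecC) (Y' ↘ SpecC)))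
end prodC

/-! ### Divisors -/

/-- An effective Cartier divisor on an integral scheme: an invertible ideal sheaf, given by its
stalks `ideal y ⊆ 𝒪_{Y,y}`, which near each point are generated by the germs of one nonzero
section. -/
structure EffCartierDivisor (Y : Scheme.{0}) [IsIntegral Y] where
  ideal : ∀ y : Y, Ideal (Y.presheaf.stalk y)
  locally_principal : ∀ y : Y, ∃ (U : Y.Opens) (_ : y ∈ U) (f : Γ(Y, U)), f ≠ 0 ∧
    ∀ (x : Y) (hx : x ∈ U), ideal x = Ideal.span {Y.presheaf.germ U x hx f}

theorem app_ne_zero {X Y : Scheme.{0}} (π : X ⟶ Y) [Surjective π] [IsIntegral Y] (U : Y.Opens)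
    (f : Γ(Y, U)) (hf : f ≠ 0) : π.app U f ≠ 0 := by
  intro h0
  apply hf
  apply eq_zero_of_basicOpen_eq_bot
  have h1 : π ⁻¹ᵁ (Y.basicOpen f) = ⊥ := by
    rw [Scheme.preimage_basicOpen, h0, Scheme.basicOpen_zero]
  ext y
  constructor
  · intro hy
    obtain ⟨x, rfl⟩ := π.surjective y
    have : x ∈ π ⁻¹ᵁ (Y.basicOpen f) := hy
    rw [h1] at this
    exact this.elim
  · intro hy; exact hy.elim

namespace EffCartierDivisor
variable {Y : Scheme.{0}} [IsIntegral Y]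

/-- The support of an effective Cartier divisor. -/
def support (Z : EffCartierDivisor Y) : Set Y := {y | Z.ideal y ≠ ⊤}

/-- The multiplicity of `Z` at (the generic point `y` of) a prime divisor: the length of
`𝒪_{Y,y} / I_{Z,y}`, which is the order of vanishing of a local equation of `Z`. -/
def mult (Z : EffCartierDivisor Y) (y : Y) : ℕ :=
  (Module.length (Y.presheaf.stalk y) (Y.presheaf.stalk y ⧸ Z.ideal y)).toNat

/-- The pull-back of an effective Cartier divisor under a surjective morphism of integral schemes:
local equations are pulled back. For a projection of a product this is `Z × Y'` or `Y × Z'`. -/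
def preimage {X : Scheme.{0}} [IsIntegral X] (π : X ⟶ Y) [Surjective π]
    (Z : EffCartierDivisor Y) : EffCartierDivisor X where
  ideal x := (Z.ideal (π x)).map (π.stalkMap x).hom
  locally_principal x := by
    obtain ⟨U, hU, f, hf, h⟩ := Z.locally_principal (π x)
    refine ⟨π ⁻¹ᵁ U, hU, π.app U f, app_ne_zero π U f hf, fun w hw => ?_⟩
    rw [h (π w) hw, Ideal.map_span, Set.image_singleton]
    congr 2
    exact Scheme.Hom.germ_stalkMap_apply π U w hw f

end EffCartierDivisor

section QDivisor
variable {Y : Scheme.{0}} [Y.Over SpecC] [IsIntegral Y] [IsLocallyNoetherian Y]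

/-- `y` is the generic point of a prime divisor. On a normal variety the second condition follows
from the first. -/
structure IsPrimeDivisorPoint (y : Y) : Prop where
  codim_one : Order.coheight y = 1
  dvr : IsDiscreteValuationRing (Y.presheaf.stalk y)

theorem ord_smul (c : ℂ) (hc : c ≠ 0) {f : Y.functionField} (hf : f ≠ 0) (y : Y) :
    Scheme.ord (c • f) y = Scheme.ord f y := by
  have hu : IsUnit (((Scheme.ΓSpecIso (CommRingCat.of ℂ)).inv ≫ (Y ↘ SpecC).appTop).hom c) :=
    (isUnit_iff_ne_zero.mpr hc).map _
  have h0 : c • f = Y.germToFunctionField ⊤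
      (((Scheme.ΓSpecIso (CommRingCat.of ℂ)).inv ≫ (Y ↘ SpecC).appTop).hom c) * f := by
    rw [Algebra.smul_def]; rfl
  have h1 := Scheme.ord_of_isUnit (X := Y) (U := ⊤) hu (x := y) trivial
  rw [h0, Scheme.ord_mul _ hf, h1, zero_add]
  exact ((hu.map (Y.germToFunctionField ⊤).hom)).ne_zero

variable {ι : Type} [Fintype ι]

/-- For the `ℚ`-Cartier divisor `E = ∑ qᵢ Zᵢ` and an open set `U`, the space
`Γ(U, 𝒪(E)) = {f | f = 0 or (div f + E)|_U ≥ 0}` inside the function field, i.e. the sections over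
`U` of the sheaf of the round-down of `E`. The coefficient of `E` at a prime divisor with generic
point `y` is `∑ qᵢ mult_y(Zᵢ)`. -/
def sections (Z : ι → EffCartierDivisor Y) (q : ι → ℚ) (U : Set Y) :
    Submodule ℂ Y.functionField where
  carrier := {f | f ≠ 0 → ∀ y ∈ U, IsPrimeDivisorPoint y →
    0 ≤ (Scheme.ord f y : ℚ) + ∑ i, q i * (Z i).mult y}
  zero_mem' h := absurd rfl h
  add_mem' {f g} hf hg hfg y hyU hy := by
    have := hy.dvr
    by_cases hf0 : f = 0
    · subst hf0; simp only [zero_add] at hfg ⊢; exact hg hfg y hyU hy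
    by_cases hg0 : g = 0
    · subst hg0; simp only [add_zero] at hfg ⊢; exact hf hfg y hyU hy
    have h1 := hf hf0 y hyU hy
    have h2 := hg hg0 y hyU hy
    rcases min_le_iff.mp (Scheme.ord_add (x := y) hfg) with h | h
    · have : (Scheme.ord f y : ℚ) ≤ Scheme.ord (f + g) y := by exact_mod_cast h
      linarith
    · have : (Scheme.ord g y : ℚ) ≤ Scheme.ord (f + g) y := by exact_mod_cast h
      linarith
  smul_mem' c f hf hcf y hyU hy := by
    have hc : c ≠ 0 := by rintro rfl; simp at hcf
    have hf0 : f ≠ 0 := by rintro rfl; simp at hcf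
    rw [ord_smul c hc hf0]; exact hf hf0 y hyU hy

theorem one_mem_sections (Z : ι → EffCartierDivisor Y) (U : Set Y) :
    (1 : Y.functionField) ∈ sections Z 0 U := by
  intro _ y _ _
  have := Scheme.ord_mul (x := y) (one_ne_zero (α := Y.functionField)) one_ne_zero
  rw [mul_one] at this
  have h : Scheme.ord (1 : Y.functionField) y = 0 := by omega
  simp [h]

theorem mul_mem_sections {Z : ι → EffCartierDivisor Y} {q q' q'' : ι → ℚ} {U : Set Y}
    {f g : Y.functionField} (hf : f ∈ sections Z q U) (hg : g ∈ sections Z q' U)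
    (h : ∀ i, q i + q' i ≤ q'' i) : f * g ∈ sections Z q'' U := by
  intro hfg y hyU hy
  have hf0 := left_ne_zero_of_mul hfg
  have hg0 := right_ne_zero_of_mul hfg
  have h1 := hf hf0 y hyU hy
  have h2 := hg hg0 y hyU hy
  rw [Scheme.ord_mul hf0 hg0]
  have h3 : ∑ i, q i * ((Z i).mult y : ℚ) + ∑ i, q' i * ((Z i).mult y : ℚ) ≤
      ∑ i, q'' i * ((Z i).mult y : ℚ) := by
    rw [← Finset.sum_add_distrib]
    refine Finset.sum_le_sum fun i _ => ?_
    rw [← add_mul]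
    exact mul_le_mul_of_nonneg_right (h i) (Nat.cast_nonneg _)
  push_cast
  linarith

/-- For an integral Cartier divisor `E = ∑ mᵢ Zᵢ`, the set of points of `U` at which `f`, as a
section of the invertible sheaf `𝒪(E)`, does not vanish: `f * ∏ zᵢ ^ mᵢ` is a unit of `𝒪_{Y,y}`,
where `zᵢ` is a local equation of `Zᵢ` at `y`. -/
def nonvanishing (Z : ι → EffCartierDivisor Y) (m : ι → ℤ) (U : Set Y) (f : Y.functionField) :
    Set Y :=
  {y | y ∈ U ∧ ∃ z : ι → Y.presheaf.stalk y, (∀ i, Ideal.span {z i} = (Z i).ideal y) ∧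
    ∃ w : (Y.presheaf.stalk y)ˣ, f * ∏ i, algebraMap _ Y.functionField (z i) ^ m i =
      algebraMap _ Y.functionField (w : Y.presheaf.stalk y)}

/-- `E = ∑ qᵢ Zᵢ` is semiample on `U`: for some `n > 0` the multiple `n E` is an integral Cartier
divisor and `𝒪(n E)` is generated by its sections over `U`, i.e. `n E` is base point free. -/
def IsSemiample (Z : ι → EffCartierDivisor Y) (q : ι → ℚ) (U : Set Y) : Prop :=
  ∃ (n : ℕ) (m : ι → ℤ), 0 < n ∧ (∀ i, (m i : ℚ) = n * q i) ∧
    ∀ y ∈ U, ∃ f ∈ sections Z (fun i => (m i : ℚ)) U, y ∈ nonvanishing Z m U f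

/-- `E = ∑ qᵢ Zᵢ` is big on `U`: for some `n > 0` the multiple `n E` is an integral Cartier divisor
and `𝒪(n E)` has a section over `U` whose nonvanishing locus is affine and not empty. -/
def IsBig (Z : ι → EffCartierDivisor Y) (q : ι → ℚ) (U : Set Y) : Prop :=
  ∃ (n : ℕ) (m : ι → ℤ), 0 < n ∧ (∀ i, (m i : ℚ) = n * q i) ∧
    ∃ f ∈ sections Z (fun i => (m i : ℚ)) U, ∃ V : Y.Opens, IsAffineOpen V ∧
      (V : Set Y) = nonvanishing Z m U f ∧ (V : Set Y).Nonempty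

end QDivisor

/-! ### Polyhedral divisors -/

/-- A polyhedral divisor `D = ∑ᵢ Δᵢ ⊗ Zᵢ` on `(Y, N)`: a pointed polyhedral cone `σ = tail` in `N_ℚ`,
and a finite formal sum of effective Cartier divisors `Zᵢ = divisor i` on `Y` whose coefficients
`Δᵢ = coeff i` are polyhedra with tailcone `σ` or empty. -/
structure PolyhedralDivisor (Y : Scheme.{0}) [IsIntegral Y] (N : Type) [AddCommGroup N] where
  tail : PointedCone ℚ (NQ N)
  tail_fg : tail.FG
  tail_salient : tail.toConvexCone.Salient
  ι : Type
  [fintype : Fintype ι]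
  divisor : ι → EffCartierDivisor Y
  coeff : ι → Set (NQ N)
  coeff_spec : ∀ i, coeff i = ∅ ∨ (IsPolyhedron (coeff i) ∧ tailCone (coeff i) = tail)

attribute [instance] PolyhedralDivisor.fintype

namespace PolyhedralDivisor

section
variable {Y : Scheme.{0}} [Y.Over SpecC] [IsIntegral Y] [IsLocallyNoetherian Y] {N : Type}
  [AddCommGroup N] (D : PolyhedralDivisor Y N)

/-- `Loc(D) = Y ∖ ⋃ {Zᵢ | Δᵢ = ∅}`. -/
def locus : Set Y := {y | ∀ i, D.coeff i = ∅ → y ∉ (D.divisor i).support}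

/-- The coefficients of the evaluation `D(u) = ∑_{Δᵢ ≠ ∅} min ⟨Δᵢ, u⟩ Zᵢ|_{Loc D}`. The empty
polyhedra get coefficient `0`; their divisors do not meet `Loc D`. -/
def eval (u : MQ N) : D.ι → ℚ := fun i => minOn (D.coeff i) u

/-- `D` is a p-divisor: all `D(u)`, `u ∈ σ^∨`, are semiample on `Loc D`, and they are big if `u` lies
in the interior of `σ^∨`. -/
def IsPDivisor : Prop :=
  (∀ u ∈ dualCone D.tail, IsSemiample D.divisor (D.eval u) D.locus) ∧
  (∀ u ∈ core (dualCone D.tail), IsBig D.divisor (D.eval u) D.locus)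

theorem eval_zero : D.eval 0 = 0 := by funext i; exact minOn_zero

theorem eval_add_le {u u' : MQ N} (hu : u ∈ dualCone D.tail) (hu' : u' ∈ dualCone D.tail)
    (i : D.ι) : D.eval u i + D.eval u' i ≤ D.eval (u + u') i := by
  rcases D.coeff_spec i with h | ⟨h, h'⟩
  · simp [eval, h, minOn_empty]
  · exact minOn_add_le h (fun a ha => hu (h' ▸ ha)) (fun a ha => hu' (h' ▸ ha))

/-- The degree `u` part `Γ(Loc D, 𝒪(D(u)))`, which is `0` for `u ∉ σ^∨`. -/
def component (u : MZ N) : Submodule ℂ Y.functionField :=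
  open Classical in
  if toMQ u ∈ dualCone D.tail then sections D.divisor (D.eval (toMQ u)) D.locus else ⊥

theorem one_mem_component : (1 : Y.functionField) ∈ D.component 0 := by
  rw [component, map_zero, if_pos (Submodule.zero_mem _), eval_zero]
  exact one_mem_sections _ _

theorem mul_mem_component {u u' : MZ N} {f g : Y.functionField} (hf : f ∈ D.component u)
    (hg : g ∈ D.component u') : f * g ∈ D.component (u + u') := by
  by_cases hu : toMQ u ∈ dualCone D.tail
  · by_cases hu' : toMQ u' ∈ dualCone D.tail
    · rw [component, if_pos hu] at hf
      rw [component, if_pos hu'] at hg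
      rw [component, map_add, if_pos (Submodule.add_mem _ hu hu')]
      exact mul_mem_sections hf hg (D.eval_add_le hu hu')
    · rw [component, if_neg hu', Submodule.mem_bot] at hg
      rw [hg, mul_zero]; exact Submodule.zero_mem _
  · rw [component, if_neg hu, Submodule.mem_bot] at hf
    rw [hf, zero_mul]; exact Submodule.zero_mem _

/-- The ring `Γ(Loc D, 𝒪(D)) = ⨁_{u ∈ σ^∨ ∩ M} Γ(Loc D, 𝒪(D(u))) χ^u` inside `ℂ(Y)[M]`. -/
def globalSections : Subalgebra ℂ (AddMonoidAlgebra Y.functionField (MZ N)) where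
  carrier := {a | ∀ u, a.coeff u ∈ D.component u}
  add_mem' {a b} ha hb u := by
    rw [AddMonoidAlgebra.coeff_add, Finsupp.add_apply]; exact Submodule.add_mem _ (ha u) (hb u)
  mul_mem' {a b} ha hb u := by
    classical
    rw [AddMonoidAlgebra.coeff_mul]
    refine Submodule.sum_mem _ fun v _ => Submodule.sum_mem _ fun w _ => ?_
    dsimp only
    split_ifs with h
    · rw [← h]; exact D.mul_mem_component (ha v) (hb w)
    · exact Submodule.zero_mem _
  algebraMap_mem' c u := by
    classical
    rw [AddMonoidAlgebra.coe_algebraMap, Function.comp_apply, AddMonoidAlgebra.coeff_single,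
      Finsupp.single_apply]
    split_ifs with h
    · rw [← h, Algebra.algebraMap_eq_smul_one]
      exact Submodule.smul_mem _ _ D.one_mem_component
    · exact Submodule.zero_mem _

/-- The inclusion `f ↦ f χ^u` of the degree `u` part. -/
def homogeneous (u : MZ N) : D.component u →ₗ[ℂ] D.globalSections where
  toFun f := ⟨AddMonoidAlgebra.single u (f : Y.functionField), fun v => by
    classical
    rw [AddMonoidAlgebra.coeff_single, Finsupp.single_apply]
    split_ifs with h
    · rw [← h]; exact f.2
    · exact Submodule.zero_mem _⟩
  map_add' f g := by ext1; simp
  map_smul' c f := by ext1; simp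

/-- The projection onto the degree `u` part. -/
def proj (u : MZ N) : D.globalSections →ₗ[ℂ] D.component u where
  toFun a := ⟨a.1.coeff u, a.2 u⟩
  map_add' a b := by ext1; simp
  map_smul' c a := by ext1; simp

theorem proj_homogeneous_self (u : MZ N) (f : D.component u) :
    D.proj u (D.homogeneous u f) = f := by
  ext1; simp [proj, homogeneous]

theorem proj_homogeneous_of_ne {u v : MZ N} (h : u ≠ v) (f : D.component u) :
    D.proj v (D.homogeneous u f) = 0 := by
  ext1; simp [proj, homogeneous, h]

theorem sum_homogeneous (a : D.globalSections) :
    ∑ u ∈ a.1.coeff.support, D.homogeneous u (D.proj u a) = a := by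
  ext1
  rw [AddSubmonoidClass.coe_finsetSum]
  exact AddMonoidAlgebra.sum_coeff_single a.1

/-- The map `∑ fᵤ χ^u ↦ ∑ χ^u ⊗ fᵤ χ^u`. -/
def coactionLinear : D.globalSections →ₗ[ℂ]
    (AddMonoidAlgebra ℂ (MZ N) ⊗[ℂ] D.globalSections) where
  toFun a := ∑ u ∈ a.1.coeff.support,
    AddMonoidAlgebra.single u (1 : ℂ) ⊗ₜ[ℂ] D.homogeneous u (D.proj u a)
  map_add' a b := by
    classical
    have key : ∀ (c : D.globalSections) (s : Finset (MZ N)), c.1.coeff.support ⊆ s →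
        ∑ u ∈ c.1.coeff.support,
          AddMonoidAlgebra.single u (1 : ℂ) ⊗ₜ[ℂ] D.homogeneous u (D.proj u c) =
        ∑ u ∈ s, AddMonoidAlgebra.single u (1 : ℂ) ⊗ₜ[ℂ] D.homogeneous u (D.proj u c) := by
      intro c s hs
      refine Finset.sum_subset hs fun u _ hu => ?_
      have : D.proj u c = 0 := Subtype.ext (Finsupp.notMem_support_iff.mp hu)
      rw [this, map_zero, TensorProduct.tmul_zero]
    have hab : (a + b).1.coeff.support ⊆ a.1.coeff.support ∪ b.1.coeff.support := by
      change (a.1 + b.1).coeff.support ⊆ _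
      rw [AddMonoidAlgebra.coeff_add]
      exact Finsupp.support_add
    rw [key (a + b) _ hab, key a _ Finset.subset_union_left, key b _ Finset.subset_union_right,
      ← Finset.sum_add_distrib]
    simp only [map_add, TensorProduct.tmul_add]
  map_smul' c a := by
    have hca : (c • a).1.coeff.support ⊆ a.1.coeff.support := by
      change (c • a.1).coeff.support ⊆ _
      rw [AddMonoidAlgebra.coeff_smul]
      exact Finsupp.support_smul
    rw [RingHom.id_apply, Finset.smul_sum]
    simp only [map_smul, TensorProduct.tmul_smul]
    refine Finset.sum_subset hca fun u _ hu => ?_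
    have h0 : D.proj u (c • a) = 0 := Subtype.ext (Finsupp.notMem_support_iff.mp hu)
    rw [← TensorProduct.tmul_smul, ← map_smul, ← map_smul, h0, map_zero, TensorProduct.tmul_zero]

theorem coactionLinear_homogeneous (u : MZ N) (f : D.component u) :
    D.coactionLinear (D.homogeneous u f) =
      AddMonoidAlgebra.single u (1 : ℂ) ⊗ₜ[ℂ] D.homogeneous u f := by
  classical
  have hs : (D.homogeneous u f).1.coeff.support ⊆ {u} := Finsupp.support_single_subset
  change ∑ v ∈ (D.homogeneous u f).1.coeff.support,
    AddMonoidAlgebra.single v (1 : ℂ) ⊗ₜ[ℂ] D.homogeneous v (D.proj v (D.homogeneous u f)) = _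
  rw [Finset.sum_subset hs, Finset.sum_singleton, proj_homogeneous_self]
  intro v _ hv
  have : D.proj v (D.homogeneous u f) = 0 := Subtype.ext (Finsupp.notMem_support_iff.mp hv)
  rw [this, map_zero, TensorProduct.tmul_zero]

/-- The coaction `f χ^u ↦ χ^u ⊗ f χ^u` of `ℂ[M]` on `Γ(Loc D, 𝒪(D))`. -/
def coaction : D.globalSections →ₐ[ℂ] (AddMonoidAlgebra ℂ (MZ N) ⊗[ℂ] D.globalSections) :=
  AlgHom.ofLinearMap D.coactionLinear
    (by
      have : (1 : D.globalSections) = D.homogeneous 0 ⟨1, D.one_mem_component⟩ := rfl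
      rw [this, coactionLinear_homogeneous]
      rfl)
    (by
      have hom : ∀ (u v : MZ N) (f : D.component u) (g : D.component v),
          D.coactionLinear (D.homogeneous u f * D.homogeneous v g) =
            D.coactionLinear (D.homogeneous u f) * D.coactionLinear (D.homogeneous v g) := by
        intro u v f g
        have h : D.homogeneous u f * D.homogeneous v g =
            D.homogeneous (u + v) ⟨f.1 * g.1, D.mul_mem_component f.2 g.2⟩ := by
          apply Subtype.ext
          exact AddMonoidAlgebra.single_mul_single u v f.1 g.1
        rw [h, coactionLinear_homogeneous, coactionLinear_homogeneous, coactionLinear_homogeneous,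
          Algebra.TensorProduct.tmul_mul_tmul, AddMonoidAlgebra.single_mul_single, one_mul, h]
      intro a b
      rw [← D.sum_homogeneous a, ← D.sum_homogeneous b]
      simp only [Finset.sum_mul_sum, map_sum, hom])

/-- The affine scheme `TV(D) = Spec Γ(Loc D, 𝒪(D))`. -/
abbrev TV : Scheme.{0} := Spec (CommRingCat.of D.globalSections)

/-- The structure morphism `TV(D) → Spec ℂ`. -/
abbrev tvToSpecC : TV D ⟶ SpecC :=
  Spec.map (CommRingCat.ofHom (algebraMap ℂ D.globalSections))

end
end PolyhedralDivisor

/-- The torus `T = Spec ℂ[M]` with lattice of one-parameter subgroups `N`. -/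
abbrev torus (N : Type) [AddCommGroup N] : Scheme.{0} :=
  Spec (CommRingCat.of (AddMonoidAlgebra ℂ (MZ N)))

/-- The structure morphism of the torus. -/
abbrev torusToSpecC (N : Type) [AddCommGroup N] : torus N ⟶ SpecC :=
  Spec.map (CommRingCat.ofHom (algebraMap ℂ (AddMonoidAlgebra ℂ (MZ N))))

/-- The homomorphism of tori given by a homomorphism of lattices. -/
def torusMap {N L : Type} [AddCommGroup N] [AddCommGroup L] (φ : N →ₗ[ℤ] L) :
    torus N ⟶ torus L :=
  Spec.map (CommRingCat.ofHom
    (AddMonoidAlgebra.mapDomainAlgHom ℂ ℂ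
      (φ.dualMap : MZ L →ₗ[ℤ] MZ N).toAddMonoidHom).toRingHom)

theorem torusMap_toSpecC {N L : Type} [AddCommGroup N] [AddCommGroup L] (φ : N →ₗ[ℤ] L) :
    torusMap φ ≫ torusToSpecC L = torusToSpecC N := by
  rw [torusMap, torusToSpecC, torusToSpecC]
  change Spec.map _ ≫ Spec.map _ = Spec.map _
  rw [← Spec.map_comp, ← CommRingCat.ofHom_comp, AlgHom.toRingHom_eq_coe, AlgHom.comp_algebraMap]

namespace PolyhedralDivisor
section
variable {Y : Scheme.{0}} [Y.Over SpecC] [IsIntegral Y] [IsLocallyNoetherian Y] {N : Type}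
  [AddCommGroup N] (D : PolyhedralDivisor Y N)

/-- The action `T × TV(D) → TV(D)` given by the grading. -/
def act : pullback (torusToSpecC N) (tvToSpecC D) ⟶ TV D :=
  (pullbackSpecIso ℂ (AddMonoidAlgebra ℂ (MZ N)) D.globalSections).hom ≫
    Spec.map (CommRingCat.ofHom D.coaction.toRingHom)

theorem act_toSpecC : D.act ≫ tvToSpecC D =
    pullback.fst (torusToSpecC N) (tvToSpecC D) ≫ torusToSpecC N := by
  have h : Spec.map (CommRingCat.ofHom D.coaction.toRingHom) ≫ tvToSpecC D =
      Spec.map (CommRingCat.ofHom (algebraMap ℂ (AddMonoidAlgebra ℂ (MZ N) ⊗[ℂ] D.globalSections)))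
      := by
    rw [tvToSpecC]
    change Spec.map _ ≫ Spec.map _ = Spec.map _
    rw [← Spec.map_comp, ← CommRingCat.ofHom_comp, AlgHom.toRingHom_eq_coe, AlgHom.comp_algebraMap]
  rw [act, Category.assoc, h]
  exact pullbackSpecIso_hom_base ℂ (AddMonoidAlgebra ℂ (MZ N)) D.globalSections
end

section
variable {Y Y' : Scheme.{0}} [Y.Over SpecC] [Y'.Over SpecC] [IsVariety Y] [IsVariety Y']
  {N N' : Type} [AddCommGroup N] [AddCommGroup N']
  (D : PolyhedralDivisor Y N) (D' : PolyhedralDivisor Y' N')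

/-- The product `D × D' = ∑ (Δᵢ × σ') ⊗ (Zᵢ × Y') + ∑ (σ × Δ'ⱼ) ⊗ (Y × Z'ⱼ)` on `Y × Y'`, with
tailcone `σ × σ'`. -/
def prod : PolyhedralDivisor (prodC Y Y') (N × N') where
  tail := prodCone D.tail D'.tail
  tail_fg := prodCone_fg D.tail_fg D'.tail_fg
  tail_salient := by
    intro x hx hx0 hnx
    apply hx0
    apply prodQ_ext
    · rw [map_zero]
      by_contra h
      exact D.tail_salient _ hx.1 h (by rw [← map_neg]; exact hnx.1)
    · rw [map_zero]
      by_contra h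
      exact D'.tail_salient _ hx.2 h (by rw [← map_neg]; exact hnx.2)
  ι := D.ι ⊕ D'.ι
  divisor := Sum.elim (fun i => (D.divisor i).preimage (prodC.fst Y Y'))
    (fun j => (D'.divisor j).preimage (prodC.snd Y Y'))
  coeff := Sum.elim (fun i => prodSet (D.coeff i) D'.tail) (fun j => prodSet D.tail (D'.coeff j))
  coeff_spec := by
    have hσ := isPolyhedron_cone D.tail_fg
    have hσ' := isPolyhedron_cone D'.tail_fg
    rintro (i | j)
    · rcases D.coeff_spec i with h | ⟨h, ht⟩
      · left; simp [h, prodSet]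
      · right
        refine ⟨isPolyhedron_prod h hσ', ?_⟩
        rw [Sum.elim_inl, tailCone_prod h.nonempty hσ'.nonempty, tailCone_cone, ht]
        rfl
    · rcases D'.coeff_spec j with h | ⟨h, ht⟩
      · left; simp [h, prodSet]
      · right
        refine ⟨isPolyhedron_prod hσ h, ?_⟩
        rw [Sum.elim_inr, tailCone_prod hσ.nonempty h.nonempty, tailCone_cone, ht]
        rfl

/-- `TV(D) × TV(D')` -/
abbrev prodTV : Scheme.{0} := pullback (tvToSpecC D) (tvToSpecC D')

/-- The structure morphism of `TV(D) × TV(D')`. -/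
abbrev prodTVToSpecC : prodTV D D' ⟶ SpecC := pullback.fst _ _ ≫ tvToSpecC D

/-- The action of `T × T'`, the torus of `N × N'`, on `TV(D) × TV(D')`: `T` acts on the first
factor and `T'` on the second. -/
def prodAct : pullback (torusToSpecC (N × N')) (prodTVToSpecC D D') ⟶ prodTV D D' :=
  pullback.lift
    (pullback.map _ _ _ _ (torusMap (LinearMap.fst ℤ N N')) (pullback.fst _ _) (𝟙 _)
      ((Category.comp_id _).trans (torusMap_toSpecC _).symm) (Category.comp_id _) ≫ D.act)
    (pullback.map _ _ _ _ (torusMap (LinearMap.snd ℤ N N')) (pullback.snd _ _) (𝟙 _)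
      ((Category.comp_id _).trans (torusMap_toSpecC _).symm)
      ((Category.comp_id _).trans pullback.condition) ≫ D'.act)
    (by
      simp only [Category.assoc, act_toSpecC, pullback.map, pullback.lift_fst_assoc,
        torusMap_toSpecC])
end
end PolyhedralDivisor

end TVar

end

/-!
Write `K = ℂ(Y)`, `L = ℂ(Y')` and `E = ℂ(Y × Y')`. The graded rings of `D`, `D'` and `D × D'` lie in
`K[M]`, `L[M']` and `E[M × M']`, so the isomorphism amounts to a Künneth formula for the graded
pieces: the multiplication map `K ⊗ L → E` identifies `Γ(Loc D, 𝒪(D(u))) ⊗ Γ(Loc D', 𝒪(D'(u')))` with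
`Γ(Loc D × Loc D', 𝒪((D × D')(u, u')))`. The evaluation `(D × D')(u, u')` is the sum of the pull-backs
of `D(u)` and `D'(u')` (`PolyhedralDivisor.eval_prod`), because each coefficient of `D × D'` is a
polyhedron times a cone on which the linear form is nonnegative.

Everything is done on the level of rational functions and their orders along prime divisors.

* Products of sections are sections. A power of a section of `𝒪(D(u))`, multiplied by local
  equations, is regular at every point, since a rational function on a normal variety without polar
  divisors is regular (`mem_range_of_forall_isDiscreteValuationRing`,
  `mem_range_stalk_of_forall_ord_nonneg`). Regularity is preserved by pull-back, whence
  `functionFieldMap_mem_sections`.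

* A section `F` on the product lies in `K ⊗ L`. It has no poles along prime divisors dominating both
  factors, and `K ⊗ L` is a localization of the coordinate ring of an affine chart whose points of
  codimension one are these divisors. It remains to see that `K ⊗ L` is integrally closed
  (`isIntegrallyClosed_tensorProduct`): `K` is étale over a purely transcendental extension `k₁` of
  `ℂ`, and `k₁ ⊗ L` is a localization of a polynomial ring over `L`.

* Writing `F = ∑ kⱼ ⊗ lⱼ` with linearly independent `kⱼ`, each `lⱼ` is a section on `Y'`
  (`mem_sections_of_sum_mem`). For a prime divisor `P'` of `Y'`, the order of `F` along `Y × P'` is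
  the minimum of the orders of the `lⱼ` along `P'`. This form of Gauss's lemma
  (`exists_point_over_isPrimeDivisorPoint`) holds because `A ⊗ B / A ⊗ 𝔮 = A ⊗ B / 𝔮` is a domain for a
  prime ideal `𝔮` of `B`, and the `kⱼ` stay independent over `B / 𝔮`. Applied to bases on both sides, it
  gives the Künneth formula `exists_functionFieldProductMap_eq`.

The maps of graded rings induced by the projections respect the coactions, so the isomorphism is
equivariant. Finally, if `f` and `f'` are sections of `𝒪(n D(u))` and `𝒪(n' D'(u'))`, the section
`f ^ n' f' ^ n` of `𝒪(n n' (D × D')(u, u'))` is nonzero exactly at the points both of whose projections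
lie in the nonvanishing loci of `f` and `f'` (`nonvanishing_product`), and a product of affine sets is
affine. Hence semiampleness and bigness pass to the product.
-/

noncomputable section

namespace TVar

/-! ### Regularity in codimension one -/

/-- In a Noetherian normal local domain whose maximal ideal carries a non-integral fraction `c / b`
into the ring, the maximal ideal is principal: otherwise `c / b` would map the maximal ideal to
itself and hence be integral. -/
theorem isDiscreteValuationRing_of_maximalIdeal_mul_dvd (R : Type*) [CommRing R] [IsDomain R]
    [IsLocalRing R] [IsNoetherianRing R] [IsIntegrallyClosed R] {b c : R} (hb : b ≠ 0)
    (hbc : ¬ b ∣ c) (hm : ∀ r ∈ IsLocalRing.maximalIdeal R, b ∣ r * c) :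
    IsDiscreteValuationRing R := by
  have hF : ¬ IsField R := by
    intro hF
    obtain ⟨b', hb'⟩ := hF.mul_inv_cancel hb
    exact hbc ⟨b' * c, by rw [← mul_assoc, hb', one_mul]⟩
  refine ((IsDiscreteValuationRing.TFAE R hF).out 4 0).mp ?_
  by_cases h : ∃ r ∈ IsLocalRing.maximalIdeal R, ∃ u, IsUnit u ∧ r * c = b * u
  · obtain ⟨r, hr, u, hu, hru⟩ := h
    refine ⟨⟨r, le_antisymm (fun s hs => ?_) ((Ideal.span_singleton_le_iff_mem _).mpr hr)⟩⟩
    obtain ⟨t, ht⟩ := hm s hs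
    obtain ⟨v, hv⟩ := hu.exists_right_inv
    refine Ideal.mem_span_singleton.mpr ⟨t * v, ?_⟩
    have hc : b * c ≠ 0 := mul_ne_zero hb (by rintro rfl; exact hbc (dvd_zero _))
    apply mul_left_cancel₀ hc
    calc b * c * s = b * (s * c) := by ring
      _ = b * (b * t) * (u * v) := by rw [ht, hv, mul_one]
      _ = (b * u) * b * (t * v) := by ring
      _ = b * c * (r * (t * v)) := by rw [← hru]; ring
  · exfalso
    push Not at h
    let K := FractionRing R
    have hb' : algebraMap R K b ≠ 0 := by simpa using hb
    let x : K := algebraMap R K c / algebraMap R K b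
    let M := Submodule.map (Algebra.linearMap R K) (IsLocalRing.maximalIdeal R)
    have hint : IsIntegral R x := by
      refine isIntegral_of_smul_mem_submodule M ?_ ?_ x ?_
      · have : IsLocalRing.maximalIdeal R ≠ ⊥ :=
          fun e => hF (IsLocalRing.isField_iff_maximalIdeal_eq.mpr e)
        obtain ⟨a, ha, ha0⟩ := Submodule.exists_mem_ne_zero_of_ne_bot this
        exact (Submodule.ne_bot_iff _).mpr ⟨_, ⟨a, ha, rfl⟩, by simpa using ha0⟩
      · exact (IsNoetherian.noetherian _).map _
      · rintro _ ⟨r, hr, rfl⟩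
        obtain ⟨t, ht⟩ := hm r hr
        refine ⟨t, ?_, ?_⟩
        · exact (IsLocalRing.mem_maximalIdeal _).mpr fun hu => h r hr t hu ht
        · simp only [Algebra.linearMap_apply, smul_eq_mul, x]
          rw [div_mul_eq_mul_div, eq_div_iff hb', ← map_mul, ← map_mul, mul_comm t, ← ht, mul_comm]
    obtain ⟨y, hy⟩ := IsIntegrallyClosed.algebraMap_eq_of_integral hint
    refine hbc ⟨y, IsFractionRing.injective R K ?_⟩
    rw [map_mul, hy, mul_div_cancel₀ _ hb']

/-- A fraction over a Noetherian normal domain that lies in every localization which is a discrete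
valuation ring lies in the domain. -/
theorem mem_range_of_forall_isDiscreteValuationRing {R F : Type*} [CommRing R] [IsDomain R]
    [IsNoetherianRing R] [IsIntegrallyClosed R] [Field F] [Algebra R F] [IsFractionRing R F] (x : F)
    (h : ∀ (P : Ideal R) [P.IsPrime], IsDiscreteValuationRing (Localization.AtPrime P) →
      ∃ a s : R, s ∉ P ∧ x * algebraMap R F s = algebraMap R F a) :
    x ∈ (algebraMap R F).range := by
  obtain ⟨a, b, hb, rfl⟩ := IsFractionRing.div_surjective (A := R) x
  have hb0 : b ≠ 0 := nonZeroDivisors.ne_zero hb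
  have hb' : algebraMap R F b ≠ 0 := by simpa using hb0
  by_contra hx
  have ha : Ideal.Quotient.mk (Ideal.span {b}) a ≠ 0 := by
    intro h0
    rw [Ideal.Quotient.eq_zero_iff_mem, Ideal.mem_span_singleton] at h0
    obtain ⟨t, rfl⟩ := h0
    exact hx ⟨t, by rw [map_mul, mul_div_cancel_left₀ _ hb']⟩
  -- a prime `P` associated to `R / (b)` that contains all denominators of `a / b`
  obtain ⟨P, hP, hle⟩ := exists_le_isAssociatedPrime_of_isNoetherianRing R _ ha
  have := hP.1
  obtain ⟨-, z, hz⟩ := isAssociatedPrime_iff.mp hP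
  obtain ⟨c, rfl⟩ := Ideal.Quotient.mk_surjective z
  have hmem : ∀ (d r : R), r ∈ (⊥ : Submodule R (R ⧸ Ideal.span {b})).colon
      {Ideal.Quotient.mk (Ideal.span {b}) d} ↔ b ∣ r * d := by
    intro d r
    rw [Submodule.mem_colon_singleton, Submodule.mem_bot, ← Ideal.mem_span_singleton,
      ← Ideal.Quotient.eq_zero_iff_mem, map_mul]
    rfl
  have hmemP (r : R) : r ∈ P ↔ b ∣ r * c := (SetLike.ext_iff.mp hz r).trans (hmem c r)
  let RP := Localization.AtPrime P
  have hinj : Function.Injective (algebraMap R RP) :=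
    IsLocalization.injective _ P.primeCompl_le_nonZeroDivisors
  have : IsNoetherianRing RP := IsLocalization.isNoetherianRing P.primeCompl _ inferInstance
  have : IsIntegrallyClosed RP :=
    isIntegrallyClosed_of_isLocalization RP P.primeCompl P.primeCompl_le_nonZeroDivisors
  have hdvr : IsDiscreteValuationRing RP := by
    refine isDiscreteValuationRing_of_maximalIdeal_mul_dvd RP (b := algebraMap R RP b)
      (c := algebraMap R RP c) (by simpa using (map_ne_zero_iff _ hinj).mpr hb0) ?_ ?_
    · rintro ⟨t, ht⟩
      obtain ⟨⟨u, s⟩, hu⟩ := IsLocalization.surj P.primeCompl t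
      apply s.2
      change s.1 ∈ P
      rw [hmemP]
      refine ⟨u, hinj ?_⟩
      rw [map_mul, map_mul, ht, ← hu]; ring
    · intro r hr
      obtain ⟨⟨u, s⟩, hu⟩ := IsLocalization.surj P.primeCompl r
      have huP : u ∈ P := by
        rw [← IsLocalization.AtPrime.to_map_mem_maximal_iff RP P u, ← hu]
        exact Ideal.mul_mem_right _ _ hr
      rw [hmemP] at huP
      obtain ⟨t, ht⟩ := huP
      obtain ⟨v, hv⟩ := (IsLocalization.map_units RP s).exists_right_inv
      refine ⟨algebraMap R RP t * v, ?_⟩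
      rw [← mul_assoc, ← map_mul, ← ht, map_mul, ← hu]
      simp only
      rw [show r * algebraMap R RP s * algebraMap R RP c * v =
        r * algebraMap R RP c * (algebraMap R RP s * v) by ring, hv, mul_one]
  obtain ⟨u, s, hs, hu⟩ := h P hdvr
  apply hs
  apply hle
  rw [hmem]
  refine ⟨u, IsFractionRing.injective R F ?_⟩
  rw [map_mul, map_mul, ← hu]
  field_simp

/-! ### Tensor products of function fields -/

/-- An integral smooth extension of a normal domain is normal: smooth base change commutes with
integral closure. -/
theorem isIntegrallyClosed_of_smooth_of_isIntegral (P S : Type*) [CommRing P] [IsDomain P]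
    [IsIntegrallyClosed P] [CommRing S] [IsDomain S] [Algebra P S] [FaithfulSMul P S]
    [Algebra.Smooth P S] [Algebra.IsIntegral P S] : IsIntegrallyClosed S := by
  let M := Algebra.algebraMapSubmonoid S (nonZeroDivisors P)
  have hloc : IsLocalization M (S ⊗[P] FractionRing P) :=
    IsLocalization.tensor (FractionRing P) (nonZeroDivisors P)
  have hloc' : IsLocalization M (FractionRing S) := inferInstance
  let e : S ⊗[P] FractionRing P ≃ₐ[S] FractionRing S := IsLocalization.algEquiv M _ _
  refine (isIntegrallyClosed_iff (FractionRing S)).mpr fun {x} hx => ?_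
  obtain ⟨y, hy⟩ := (TensorProduct.toIntegralClosure_bijective_of_smooth (R := P) (S := S)
    (B := FractionRing P)).2 ⟨e.symm x, hx.map e.symm⟩
  have hy' : Algebra.TensorProduct.map (.id S S) (integralClosure P (FractionRing P)).val y =
    e.symm x := congrArg Subtype.val hy
  suffices ∀ y, ∃ s : S, algebraMap S (S ⊗[P] FractionRing P) s =
      Algebra.TensorProduct.map (.id S S) (integralClosure P (FractionRing P)).val y by
    obtain ⟨s, hs⟩ := this y
    refine ⟨s, ?_⟩
    rw [← e.commutes, hs, hy', e.apply_symm_apply]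
  clear! x y
  intro y
  induction y with
  | zero => exact ⟨0, by simp⟩
  | add y z hy hz =>
    obtain ⟨a, ha⟩ := hy
    obtain ⟨b, hb⟩ := hz
    exact ⟨a + b, by rw [map_add, map_add, ha, hb]⟩
  | tmul s q =>
    obtain ⟨q, hq⟩ := q
    obtain ⟨r, rfl⟩ := IsIntegrallyClosed.algebraMap_eq_of_integral hq
    refine ⟨r • s, ?_⟩
    have h1 : algebraMap P (FractionRing P) r = r • 1 := Algebra.algebraMap_eq_smul_one r
    change (r • s) ⊗ₜ[P] (1 : FractionRing P) = s ⊗ₜ[P] algebraMap P (FractionRing P) r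
    rw [h1, TensorProduct.smul_tmul]

theorem isIntegrallyClosed_tensorProduct_of_etale (k P K : Type*) [Field k] [CommRing P] [IsDomain P]
    [IsIntegrallyClosed P] [Algebra k P] [Field K] [Algebra k K] [Algebra.Etale k K]
    [Module.Finite k K] [IsDomain (P ⊗[k] K)] : IsIntegrallyClosed (P ⊗[k] K) := by
  have : Algebra.Etale P (P ⊗[k] K) := Algebra.Etale.baseChange ..
  have : FaithfulSMul P (P ⊗[k] K) := (faithfulSMul_iff_algebraMap_injective _ _).mpr
    (Algebra.TensorProduct.includeLeft_injective (S := P) (A := P)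
      (FaithfulSMul.algebraMap_injective k K))
  exact isIntegrallyClosed_of_smooth_of_isIntegral P _

section TensorFractions
variable (k A B K L : Type*) [Field k] [CommRing A] [CommRing B] [Algebra k A] [Algebra k B]
  [Field K] [Field L] [Algebra k K] [Algebra k L] [Algebra A K] [Algebra B L] [IsScalarTower k A K] [IsScalarTower k B L]

/-- The map `A ⊗ B → K ⊗ L` of tensor products given by `A → K` and `B → L`. -/
def tensorMap : A ⊗[k] B →ₐ[k] K ⊗[k] L :=
  Algebra.TensorProduct.map (IsScalarTower.toAlgHom k A K) (IsScalarTower.toAlgHom k B L)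

@[simp] theorem tensorMap_tmul (a : A) (b : B) :
    tensorMap k A B K L (a ⊗ₜ b) = algebraMap A K a ⊗ₜ algebraMap B L b := rfl

variable [IsDomain A] [IsDomain B]

/-- The multiplicative set of the tensors `a ⊗ b` with `a` and `b` nonzero. -/
def nonzeroTensors : Submonoid (A ⊗[k] B) where
  carrier := {x | ∃ a b, a ≠ 0 ∧ b ≠ 0 ∧ x = a ⊗ₜ b}
  one_mem' := ⟨1, 1, one_ne_zero, one_ne_zero, rfl⟩
  mul_mem' := by
    rintro _ _ ⟨a, b, ha, hb, rfl⟩ ⟨c, d, hc, hd, rfl⟩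
    exact ⟨a * c, b * d, mul_ne_zero ha hc, mul_ne_zero hb hd,
      Algebra.TensorProduct.tmul_mul_tmul ..⟩

variable [IsFractionRing A K] [IsFractionRing B L]

omit [IsDomain A] in
theorem tensorMap_injective : Function.Injective (tensorMap k A B K L) :=
  TensorProduct.map_injective_of_flat_flat (IsScalarTower.toAlgHom k A K).toLinearMap
    (IsScalarTower.toAlgHom k B L).toLinearMap (IsFractionRing.injective A K)
    (IsFractionRing.injective B L)

theorem isUnit_tensorMap {x : A ⊗[k] B} (hx : x ∈ nonzeroTensors k A B) :
    IsUnit (tensorMap k A B K L x) := by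
  obtain ⟨a, b, ha, hb, rfl⟩ := hx
  have ha' : algebraMap A K a ≠ 0 := by simpa using ha
  have hb' : algebraMap B L b ≠ 0 := by simpa using hb
  refine IsUnit.of_mul_eq_one ((algebraMap A K a)⁻¹ ⊗ₜ (algebraMap B L b)⁻¹) ?_
  rw [tensorMap_tmul, Algebra.TensorProduct.tmul_mul_tmul, mul_inv_cancel₀ ha',
    mul_inv_cancel₀ hb']
  rfl

theorem exists_tensorMap_mul_eq (z : K ⊗[k] L) :
    ∃ s ∈ nonzeroTensors k A B, ∃ w, tensorMap k A B K L s * z = tensorMap k A B K L w := by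
  induction z with
  | zero => exact ⟨1, Submonoid.one_mem _, 0, by simp⟩
  | tmul x y =>
    obtain ⟨a, s, hs, rfl⟩ := IsFractionRing.div_surjective (A := A) x
    obtain ⟨b, t, ht, rfl⟩ := IsFractionRing.div_surjective (A := B) y
    have hs0 := nonZeroDivisors.ne_zero hs
    have ht0 := nonZeroDivisors.ne_zero ht
    have hs' : algebraMap A K s ≠ 0 := by simpa using hs0
    have ht' : algebraMap B L t ≠ 0 := by simpa using ht0
    refine ⟨s ⊗ₜ t, ⟨s, t, hs0, ht0, rfl⟩, a ⊗ₜ b, ?_⟩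
    rw [tensorMap_tmul, tensorMap_tmul, Algebra.TensorProduct.tmul_mul_tmul,
      mul_div_cancel₀ _ hs', mul_div_cancel₀ _ ht']
  | add x y hx hy =>
    obtain ⟨s, hs, w, hw⟩ := hx
    obtain ⟨t, ht, v, hv⟩ := hy
    refine ⟨s * t, Submonoid.mul_mem _ hs ht, t * w + s * v, ?_⟩
    simp only [map_mul, map_add, ← hw, ← hv]
    ring

theorem isLocalization_tensorMap :
    letI := (tensorMap k A B K L).toRingHom.toAlgebra
    IsLocalization (nonzeroTensors k A B) (K ⊗[k] L) := by
  let := (tensorMap k A B K L).toRingHom.toAlgebra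
  refine ⟨fun s => isUnit_tensorMap k A B K L s.2, fun z => ?_, fun {x y} h => ?_⟩
  · obtain ⟨s, hs, w, hw⟩ := exists_tensorMap_mul_eq k A B K L z
    exact ⟨(w, ⟨s, hs⟩), (mul_comm _ _).trans hw⟩
  · exact ⟨1, by rw [tensorMap_injective k A B K L h]⟩

theorem nonzeroTensors_le_nonZeroDivisors [IsDomain (A ⊗[k] B)] :
    nonzeroTensors k A B ≤ nonZeroDivisors (A ⊗[k] B) := by
  rintro x hx
  refine mem_nonZeroDivisors_of_ne_zero fun h0 => ?_
  have := isUnit_tensorMap k A B (FractionRing A) (FractionRing B) hx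
  rw [h0, map_zero] at this
  exact not_isUnit_zero this

theorem isDomain_fractions_tensorProduct [IsDomain (A ⊗[k] B)] : IsDomain (K ⊗[k] L) := by
  let := (tensorMap k A B K L).toRingHom.toAlgebra
  have := isLocalization_tensorMap k A B K L
  exact IsLocalization.isDomain_of_le_nonZeroDivisors _ (nonzeroTensors_le_nonZeroDivisors k A B)

theorem isIntegrallyClosed_fractions_tensorProduct [IsDomain (A ⊗[k] B)]
    [IsIntegrallyClosed (A ⊗[k] B)] : IsIntegrallyClosed (K ⊗[k] L) := by
  let := (tensorMap k A B K L).toRingHom.toAlgebra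
  have := isLocalization_tensorMap k A B K L
  exact isIntegrallyClosed_of_isLocalization _ (nonzeroTensors k A B)
    (nonzeroTensors_le_nonZeroDivisors k A B)

theorem isNoetherianRing_fractions_tensorProduct [IsNoetherianRing (A ⊗[k] B)] :
    IsNoetherianRing (K ⊗[k] L) := by
  let := (tensorMap k A B K L).toRingHom.toAlgebra
  have := isLocalization_tensorMap k A B K L
  exact IsLocalization.isNoetherianRing (nonzeroTensors k A B) _ inferInstance

end TensorFractions

/-- The tensor product of two field extensions of `ℂ`, one of them finitely generated, is normal: it
is étale over a localization of a polynomial ring over the other field. -/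
theorem isIntegrallyClosed_tensorProduct (A K L : Type) [CommRing A] [IsDomain A] [Algebra ℂ A]
    [Algebra.FiniteType ℂ A] [Field K] [Algebra ℂ K] [Algebra A K] [IsScalarTower ℂ A K]
    [IsFractionRing A K] [Field L] [Algebra ℂ L] [IsDomain (K ⊗[ℂ] L)] :
    IsIntegrallyClosed (K ⊗[ℂ] L) := by
  obtain ⟨s, g, hg, hfin⟩ := exists_finite_inj_algHom_of_fg ℂ A
  -- Noether normalization: `K` is finite over the rational function field `k1`
  let R0 := MvPolynomial (Fin s) ℂ
  let : Algebra R0 A := g.toRingHom.toAlgebra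
  let : Algebra R0 K := ((algebraMap A K).comp g.toRingHom).toAlgebra
  have : IsScalarTower R0 A K := IsScalarTower.of_algebraMap_eq fun _ => rfl
  have : IsScalarTower ℂ R0 K := IsScalarTower.of_algebraMap_eq fun c => by
    rw [IsScalarTower.algebraMap_apply R0 A K, IsScalarTower.algebraMap_apply ℂ A K]
    exact congrArg _ (g.commutes c).symm
  have : Module.Finite R0 A := hfin
  have : FaithfulSMul R0 K := (faithfulSMul_iff_algebraMap_injective _ _).mpr
    ((IsFractionRing.injective A K).comp hg)
  let k1 := FractionRing R0
  let : Algebra k1 K := FractionRing.liftAlgebra R0 K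
  have : IsScalarTower R0 k1 K := inferInstance
  have : IsScalarTower ℂ k1 K := IsScalarTower.to₁₃₄ ℂ R0 k1 K
  have : Algebra.IsAlgebraic R0 K := by
    have : Algebra.IsAlgebraic A K := IsLocalization.isAlgebraic K (nonZeroDivisors A)
    have : Algebra.IsAlgebraic R0 A := inferInstance
    exact Algebra.IsAlgebraic.trans R0 A K
  have : Algebra.IsAlgebraic k1 K := (IsFractionRing.comap_isAlgebraic_iff (A := R0)).mp this
  have : CharZero k1 := algebraRat.charZero k1
  have : Algebra.IsSeparable k1 K := inferInstance
  have : Algebra.EssFiniteType A K := .of_isLocalization _ (nonZeroDivisors A)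
  have : Algebra.EssFiniteType ℂ K := Algebra.EssFiniteType.comp ℂ A K
  have : Algebra.EssFiniteType k1 K := Algebra.EssFiniteType.of_comp ℂ k1 K
  have : Algebra.FormallyEtale k1 K := Algebra.FormallyEtale.of_isSeparable k1 K
  have : Module.Finite k1 K := Algebra.FormallyUnramified.finite_of_free k1 K
  have : Algebra.FinitePresentation k1 K := Algebra.FinitePresentation.of_finiteType.mp inferInstance
  have : Algebra.Etale k1 K := {}
  -- `k1 ⊗ L` is a localization of a polynomial ring over `L`
  have hpoly : IsIntegrallyClosed (L ⊗[ℂ] R0) :=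
    have : IsIntegrallyClosed (MvPolynomial (Fin s) L) :=
      UniqueFactorizationMonoid.instIsIntegrallyClosed
    .of_equiv (MvPolynomial.algebraTensorAlgEquiv (σ := Fin s) ℂ L).symm.toRingEquiv
  have : IsDomain (L ⊗[ℂ] R0) :=
    (MvPolynomial.algebraTensorAlgEquiv (σ := Fin s) ℂ L).toMulEquiv.isDomain _
  have : IsDomain (L ⊗[ℂ] k1) := isDomain_fractions_tensorProduct ℂ L R0 L k1
  have : IsIntegrallyClosed (L ⊗[ℂ] k1) :=
    isIntegrallyClosed_fractions_tensorProduct ℂ L R0 L k1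
  let e1 := Algebra.TensorProduct.comm ℂ k1 L
  have : IsDomain (k1 ⊗[ℂ] L) := e1.toMulEquiv.isDomain _
  have : IsIntegrallyClosed (k1 ⊗[ℂ] L) := .of_equiv e1.symm.toRingEquiv
  -- `K ⊗ L = K ⊗[k1] (k1 ⊗ L)` is étale over `k1 ⊗ L`
  let P := k1 ⊗[ℂ] L
  let e2 : K ⊗[k1] P ≃ₐ[k1] K ⊗[ℂ] L := Algebra.TensorProduct.cancelBaseChange ℂ k1 k1 K L
  let e3 : P ⊗[k1] K ≃ₐ[k1] K ⊗[ℂ] L := (Algebra.TensorProduct.comm k1 P K).trans e2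
  have : IsDomain (P ⊗[k1] K) := e3.toMulEquiv.isDomain _
  have : IsIntegrallyClosed (P ⊗[k1] K) := isIntegrallyClosed_tensorProduct_of_etale k1 P K
  exact IsIntegrallyClosed.of_equiv (R := P ⊗[k1] K) (S := K ⊗[ℂ] L)
    { e3.toRingEquiv with }

/-! ### Fractions on a product of affine varieties -/

section ProductRing
variable {A B C K L E : Type} [CommRing A] [CommRing B] [CommRing C] [Field K] [Field L] [Field E]
  [Algebra ℂ A] [Algebra ℂ B] [Algebra ℂ C] [Algebra ℂ K] [Algebra ℂ L] [Algebra ℂ E]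
  [Algebra A K] [IsScalarTower ℂ A K] [IsFractionRing A K]
  [Algebra B L] [IsScalarTower ℂ B L] [IsFractionRing B L]
  [Algebra C E] [IsFractionRing C E] (e : A ⊗[ℂ] B ≃ₐ[ℂ] C)
  (φ : K →ₐ[ℂ] E) (φ' : L →ₐ[ℂ] E)
  (hφ : ∀ a, φ (algebraMap A K a) = algebraMap C E (e (a ⊗ₜ 1)))
  (hφ' : ∀ b, φ' (algebraMap B L b) = algebraMap C E (e (1 ⊗ₜ b)))

include hφ hφ' in
omit [IsFractionRing A K] [IsFractionRing B L] [IsFractionRing C E] in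
theorem productMap_tensorMap (w : A ⊗[ℂ] B) :
    Algebra.TensorProduct.productMap φ φ' (tensorMap ℂ A B K L w) = algebraMap C E (e w) := by
  induction w with
  | zero => simp
  | add x y hx hy => simp only [map_add, hx, hy]
  | tmul a b =>
    rw [tensorMap_tmul, Algebra.TensorProduct.productMap_apply_tmul, hφ, hφ', ← map_mul, ← map_mul,
      Algebra.TensorProduct.tmul_mul_tmul, mul_one, one_mul]

variable [IsDomain A] [IsDomain B]

include hφ hφ' in
theorem productMap_injective : Function.Injective (Algebra.TensorProduct.productMap φ φ') := by
  rw [injective_iff_map_eq_zero]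
  intro z hz
  obtain ⟨s, hs, w, hw⟩ := exists_tensorMap_mul_eq ℂ A B K L z
  have h1 : algebraMap C E (e w) = 0 := by
    rw [← productMap_tensorMap e φ φ' hφ hφ', ← hw, map_mul, hz, mul_zero]
  have h2 : w = 0 := by
    rwa [map_eq_zero_iff _ (IsFractionRing.injective C E), map_eq_zero_iff _ e.injective] at h1
  rw [h2, map_zero] at hw
  exact (isUnit_tensorMap ℂ A B K L hs).mul_right_eq_zero.mp hw

include hφ hφ' in
/-- Let `C = A ⊗ B` have fraction field `E`. An element of `E` that is regular at all points of
codimension one of `Spec C` lying over both generic points belongs to `Frac A ⊗ Frac B`, since the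
latter is a Noetherian normal ring. -/
theorem mem_range_productMap [IsDomain C] [Algebra.FiniteType ℂ A] [Algebra.FiniteType ℂ B] (x : E)
    (h : ∀ (Q : Ideal C) [Q.IsPrime], (∀ a : A, a ≠ 0 → e (a ⊗ₜ 1) ∉ Q) →
      (∀ b : B, b ≠ 0 → e (1 ⊗ₜ b) ∉ Q) → IsDiscreteValuationRing (Localization.AtPrime Q) →
      ∃ c s : C, s ∉ Q ∧ x * algebraMap C E s = algebraMap C E c) :
    x ∈ (Algebra.TensorProduct.productMap φ φ').range := by
  have hdom := isDomain_tensorProduct A B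
  have := isDomain_fractions_tensorProduct ℂ A B K L
  have := isIntegrallyClosed_tensorProduct A K L
  have : Algebra.FiniteType ℂ (A ⊗[ℂ] B) := Algebra.FiniteType.trans (S := A) ‹_› inferInstance
  have : IsNoetherianRing (A ⊗[ℂ] B) := Algebra.FiniteType.isNoetherianRing ℂ _
  have := isNoetherianRing_fractions_tensorProduct ℂ A B K L
  let g : C →+* K ⊗[ℂ] L := (tensorMap ℂ A B K L).toRingHom.comp e.symm.toRingEquiv.toRingHom
  have hg : ∀ w, g (e w) = tensorMap ℂ A B K L w := fun w =>
    congrArg (tensorMap ℂ A B K L) (e.symm_apply_apply w)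
  let : Algebra C (K ⊗[ℂ] L) := g.toAlgebra
  let : Algebra (K ⊗[ℂ] L) E := (Algebra.TensorProduct.productMap φ φ').toRingHom.toAlgebra
  have : IsScalarTower C (K ⊗[ℂ] L) E := IsScalarTower.of_algebraMap_eq fun c => by
    obtain ⟨w, rfl⟩ := e.surjective c
    exact ((congrArg _ (hg w)).trans (productMap_tensorMap e φ φ' hφ hφ' w)).symm
  have hloc : IsLocalization ((nonzeroTensors ℂ A B).map e.toRingEquiv) (K ⊗[ℂ] L) := by
    let := (tensorMap ℂ A B K L).toRingHom.toAlgebra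
    have := isLocalization_tensorMap ℂ A B K L
    exact IsLocalization.isLocalization_of_base_ringEquiv _ _ e.toRingEquiv
  have hle : (nonzeroTensors ℂ A B).map e.toRingEquiv ≤ nonZeroDivisors C := by
    rintro _ ⟨w, hw, rfl⟩
    refine mem_nonZeroDivisors_of_ne_zero ?_
    exact (map_ne_zero_iff _ e.injective).mpr
      (nonZeroDivisors.ne_zero (nonzeroTensors_le_nonZeroDivisors ℂ A B hw))
  have : IsFractionRing (K ⊗[ℂ] L) E :=
    IsFractionRing.isFractionRing_of_isDomain_of_isLocalization
      ((nonzeroTensors ℂ A B).map e.toRingEquiv) _ _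
  refine mem_range_of_forall_isDiscreteValuationRing (R := K ⊗[ℂ] L) x fun P _ hP => ?_
  have hu : ∀ s ∈ nonzeroTensors ℂ A B, tensorMap ℂ A B K L s ∉ P := fun s hs hsP =>
    Ideal.IsPrime.ne_top ‹_› (P.eq_top_of_isUnit_mem hsP (isUnit_tensorMap ℂ A B K L hs))
  have hPloc : IsLocalization.AtPrime (Localization.AtPrime P)
      (P.comap (algebraMap C (K ⊗[ℂ] L))) :=
    IsLocalization.isLocalization_isLocalization_atPrime_isLocalization
      ((nonzeroTensors ℂ A B).map e.toRingEquiv) _ P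
  obtain ⟨c, s, hs, hc⟩ := h (P.comap (algebraMap C (K ⊗[ℂ] L)))
    (fun a ha haP => hu (a ⊗ₜ 1) ⟨a, 1, ha, one_ne_zero, rfl⟩ (by rw [← hg]; exact haP))
    (fun b hb hbP => hu (1 ⊗ₜ b) ⟨1, b, one_ne_zero, hb, rfl⟩ (by rw [← hg]; exact hbP))
    (IsDiscreteValuationRing.RingEquivClass.isDiscreteValuationRing (IsLocalization.algEquiv
      (P.comap (algebraMap C (K ⊗[ℂ] L))).primeCompl (Localization.AtPrime P)
      (Localization.AtPrime (P.comap (algebraMap C (K ⊗[ℂ] L))))))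
  refine ⟨algebraMap C _ c, algebraMap C _ s, hs, ?_⟩
  rw [← IsScalarTower.algebraMap_apply, ← IsScalarTower.algebraMap_apply, hc]

end ProductRing

section GenericFibre
variable {A B C : Type} [CommRing A] [CommRing B] [CommRing C] [Algebra ℂ A] [Algebra ℂ B]
  [Algebra ℂ C] (e : A ⊗[ℂ] B ≃ₐ[ℂ] C) (q : Ideal B)

/-- The ideal of `Spec A × V(q)` in `A ⊗ B`. -/
def productIdeal : Ideal C := q.map (e.toRingEquiv.toRingHom.comp
  (Algebra.TensorProduct.includeRight : B →ₐ[ℂ] A ⊗[ℂ] B).toRingHom)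

/-- The ideal is the kernel of `A ⊗ B → A ⊗ B / q`. -/
theorem mem_productIdeal (w : A ⊗[ℂ] B) : e w ∈ productIdeal e q ↔
    Algebra.TensorProduct.map (AlgHom.id ℂ A) (Ideal.Quotient.mkₐ ℂ q) w = 0 := by
  have h := Algebra.TensorProduct.lTensor_ker (A := A) (Ideal.Quotient.mkₐ ℂ q)
    (Ideal.Quotient.mkₐ_surjective ℂ q)
  have hq : RingHom.ker (Ideal.Quotient.mkₐ ℂ q) = q := Ideal.mk_ker
  rw [hq] at h
  rw [← RingHom.mem_ker, h, productIdeal, ← Ideal.map_map]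
  refine (Ideal.mem_map_of_equiv e.toRingEquiv _).trans ⟨?_, fun hw => ⟨w, hw, rfl⟩⟩
  rintro ⟨v, hv, hvw⟩
  rwa [← e.injective hvw]

theorem productIdeal_isPrime [IsDomain A] [Algebra.FiniteType ℂ A] [q.IsPrime] :
    (productIdeal e q).IsPrime := by
  have := isDomain_tensorProduct A (B ⧸ q)
  have h : productIdeal e q = RingHom.ker ((Algebra.TensorProduct.map (AlgHom.id ℂ A)
      (Ideal.Quotient.mkₐ ℂ q)).toRingHom.comp e.symm.toRingEquiv.toRingHom) := by
    ext c
    obtain ⟨w, rfl⟩ := e.surjective c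
    rw [mem_productIdeal, RingHom.mem_ker]
    simp
  rw [h]
  exact RingHom.ker_isPrime _

/-- Linearly independent elements of `A` remain independent over the domain `B / q`. -/
theorem sum_tmul_notMem_productIdeal {ι : Type*} (s : Finset ι) (a : ι → A) (b : ι → B)
    (ha : LinearIndependent ℂ a) (i : ι) (hi : i ∈ s) (hb : b i ∉ q) :
    e (∑ j ∈ s, a j ⊗ₜ b j) ∉ productIdeal e q := by
  rw [mem_productIdeal, map_sum]
  intro h
  have h1 : ∑ j ∈ s, Ideal.Quotient.mk q (b j) • (1 ⊗ₜ a j : (B ⧸ q) ⊗[ℂ] A) = 0 := by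
    rw [← map_zero (Algebra.TensorProduct.comm ℂ A (B ⧸ q)), ← h, map_sum]
    refine Finset.sum_congr rfl fun j _ => ?_
    rw [TensorProduct.smul_tmul', smul_eq_mul, mul_one]
    rfl
  have h2 := Module.Flat.linearIndependent_one_tmul (S := B ⧸ q) ha
  exact hb (Ideal.Quotient.eq_zero_iff_mem.mp (linearIndependent_iff'.mp h2 s _ h1 i hi))

end GenericFibre

/-! ### Rational functions and orders of vanishing -/

section FunctionField
variable {X Y : Scheme.{0}} [IsIntegral X] [IsIntegral Y] (p : X ⟶ Y) [Surjective p]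

theorem map_genericPoint : p (genericPoint X) = genericPoint Y := by
  have h : IsGenericPoint (p (genericPoint X)) (closure (p '' ⊤)) :=
    (genericPoint_spec X).image p.continuous
  rw [Set.top_eq_univ, Set.image_univ, p.surjective.range_eq, closure_univ] at h
  exact h.eq (genericPoint_spec Y)

/-- The pull-back of rational functions along a surjective morphism of integral schemes. -/
def functionFieldMap : Y.functionField →+* X.functionField :=
  (Y.presheaf.stalkSpecializes (specializes_of_eq (map_genericPoint p)) ≫
    p.stalkMap (genericPoint X)).hom

theorem functionFieldMap_algebraMap (x : X) (r : Y.presheaf.stalk (p x)) :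
    functionFieldMap p (algebraMap (Y.presheaf.stalk (p x)) Y.functionField r) =
      algebraMap (X.presheaf.stalk x) X.functionField (p.stalkMap x r) := by
  have h : Y.presheaf.stalkSpecializes ((genericPoint_spec Y).specializes trivial) ≫
      Y.presheaf.stalkSpecializes (specializes_of_eq (map_genericPoint p)) ≫
        p.stalkMap (genericPoint X) =
      p.stalkMap x ≫ X.presheaf.stalkSpecializes ((genericPoint_spec X).specializes trivial) := by
    rw [TopCat.Presheaf.stalkSpecializes_comp_assoc, ← Scheme.Hom.stalkSpecializes_stalkMap]
  exact congr($(h).hom r)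

theorem functionFieldMap_germ (U : Y.Opens) [Nonempty U] [Nonempty ↑(p ⁻¹ᵁ U)] (f : Γ(Y, U)) :
    functionFieldMap p (Y.germToFunctionField U f) =
      X.germToFunctionField (p ⁻¹ᵁ U) (p.app U f) := by
  obtain ⟨x, hx⟩ := ‹Nonempty ↑(p ⁻¹ᵁ U)›
  have hx' : p x ∈ U := hx
  rw [← Y.algebraMap_germ_eq_germToFunctionField hx', functionFieldMap_algebraMap]
  exact (congrArg _ (Scheme.Hom.germ_stalkMap_apply p U x hx' f)).trans
    (X.algebraMap_germ_eq_germToFunctionField hx _)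

theorem functionFieldMap_algebraMap_complex [X.Over SpecC] [Y.Over SpecC]
    (hp : p ≫ Y ↘ SpecC = X ↘ SpecC) (c : ℂ) :
    functionFieldMap p (algebraMap ℂ Y.functionField c) = algebraMap ℂ X.functionField c := by
  change functionFieldMap p (Y.germToFunctionField ⊤ ((Y ↘ SpecC).appTop _)) =
    X.germToFunctionField ⊤ ((X ↘ SpecC).appTop _)
  have : Nonempty ↑(p ⁻¹ᵁ (⊤ : Y.Opens)) := ⟨⟨Classical.arbitrary X, trivial⟩⟩
  rw [functionFieldMap_germ, ← hp, Scheme.Hom.comp_appTop]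
  rfl

/-- The pull-back of rational functions along a morphism over `ℂ`, as a map of `ℂ`-algebras. -/
def functionFieldAlgHom [X.Over SpecC] [Y.Over SpecC] (hp : p ≫ Y ↘ SpecC = X ↘ SpecC) :
    Y.functionField →ₐ[ℂ] X.functionField :=
  { functionFieldMap p with commutes' := functionFieldMap_algebraMap_complex p hp }

end FunctionField

section Order
variable {Y : Scheme.{0}} [IsIntegral Y] [IsLocallyNoetherian Y] {y : Y}

omit [IsLocallyNoetherian Y] in
theorem IsPrimeDivisorPoint.of_isDiscreteValuationRing
    (h : IsDiscreteValuationRing (Y.presheaf.stalk y)) : IsPrimeDivisorPoint y := by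
  refine ⟨?_, h⟩
  have h1 := ringKrullDim_stalk_eq_coheight y
  rw [IsPrincipalIdealRing.ringKrullDim_eq_one _ (IsDiscreteValuationRing.not_isField _)] at h1
  exact_mod_cast h1.symm

theorem ord_algebraMap (hy : IsPrimeDivisorPoint y) {r : Y.presheaf.stalk y} (hr : r ≠ 0) :
    Scheme.ord (algebraMap _ Y.functionField r) y =
      (Module.length (Y.presheaf.stalk y) (Y.presheaf.stalk y ⧸ Ideal.span {r})).toNat := by
  have hr' : algebraMap _ Y.functionField r ≠ 0 := by simpa using hr
  have hk : Ring.KrullDimLE 1 (Y.presheaf.stalk y) := krullDimLE_of_coheight_le hy.codim_one.le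
  rw [Scheme.ord_eq_iff hy.codim_one hr']
  refine (Ring.ordFrac_eq_ord (Y.presheaf.stalk y) hr).trans ?_
  refine Ring.ordMonoidWithZeroHom_eq_coe _ (mem_nonZeroDivisors_of_ne_zero hr) ?_
  exact (ENat.natCast_toNat (Ring.ord_ne_top (mem_nonZeroDivisors_of_ne_zero hr))).symm

theorem ord_algebraMap_nonneg (hy : IsPrimeDivisorPoint y) {r : Y.presheaf.stalk y} (hr : r ≠ 0) :
    0 ≤ Scheme.ord (algebraMap _ Y.functionField r) y := by
  rw [ord_algebraMap hy hr]; positivity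

theorem ord_one : Scheme.ord (1 : Y.functionField) y = 0 := by
  have := Scheme.ord_mul (x := y) (one_ne_zero (α := Y.functionField)) one_ne_zero
  rw [mul_one] at this
  omega

theorem ord_inv {f : Y.functionField} (hf : f ≠ 0) : Scheme.ord f⁻¹ y = - Scheme.ord f y := by
  have := Scheme.ord_mul (x := y) hf (inv_ne_zero hf)
  rw [mul_inv_cancel₀ hf, ord_one] at this
  omega

theorem ord_pow {f : Y.functionField} (hf : f ≠ 0) (n : ℕ) :
    Scheme.ord (f ^ n) y = n * Scheme.ord f y := by
  induction n with
  | zero => simp [ord_one]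
  | succ n ih => rw [pow_succ, Scheme.ord_mul (pow_ne_zero _ hf) hf, ih]; push_cast; ring

theorem ord_zpow {f : Y.functionField} (hf : f ≠ 0) (n : ℤ) :
    Scheme.ord (f ^ n) y = n * Scheme.ord f y := by
  cases n with
  | ofNat n => simpa using ord_pow hf n
  | negSucc n =>
    rw [zpow_negSucc, ord_inv (pow_ne_zero _ hf), ord_pow hf, Int.negSucc_eq]; push_cast; ring

theorem ord_prod {ι : Type*} (s : Finset ι) (f : ι → Y.functionField) (hf : ∀ i ∈ s, f i ≠ 0) :
    Scheme.ord (∏ i ∈ s, f i) y = ∑ i ∈ s, Scheme.ord (f i) y := by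
  classical
  induction s using Finset.induction_on with
  | empty => simp [ord_one]
  | insert i s hi ih =>
    rw [Finset.prod_insert hi, Finset.sum_insert hi, Scheme.ord_mul (hf i (by simp))
      (Finset.prod_ne_zero_iff.mpr fun j hj => hf j (by simp [hj])),
      ih fun j hj => hf j (by simp [hj])]

theorem ord_unit (hy : IsPrimeDivisorPoint y) (u : (Y.presheaf.stalk y)ˣ) :
    Scheme.ord (algebraMap _ Y.functionField (u : Y.presheaf.stalk y)) y = 0 := by
  have h1 := ord_algebraMap_nonneg hy u.ne_zero
  have h2 := ord_algebraMap_nonneg hy u⁻¹.ne_zero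
  rw [show algebraMap _ Y.functionField ((u⁻¹ : (Y.presheaf.stalk y)ˣ) : Y.presheaf.stalk y) =
    (algebraMap _ Y.functionField (u : Y.presheaf.stalk y))⁻¹ from by
      exact eq_inv_of_mul_eq_one_left (by rw [← map_mul]; simp), ord_inv (by simp)] at h2
  omega

/-- A rational function of nonnegative order at a prime divisor is regular there. -/
theorem ord_nonneg_iff (hy : IsPrimeDivisorPoint y) {f : Y.functionField} (hf : f ≠ 0) :
    0 ≤ Scheme.ord f y ↔ ∃ r, algebraMap (Y.presheaf.stalk y) Y.functionField r = f := by
  have := hy.dvr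
  constructor
  · intro h
    rcases ValuationRing.isInteger_or_isInteger (Y.presheaf.stalk y) f with hr | ⟨r, hr⟩
    · exact hr
    · have hr0 : r ≠ 0 := by rintro rfl; exact inv_ne_zero hf (by simpa using hr.symm)
      by_cases hu : IsUnit r
      · refine ⟨((hu.unit⁻¹ : (Y.presheaf.stalk y)ˣ) : Y.presheaf.stalk y), ?_⟩
        rw [← inv_inv f, ← hr]
        exact eq_inv_of_mul_eq_one_left (by rw [← map_mul]; simp)
      · exfalso
        have h1 : Scheme.ord f⁻¹ y ≤ 0 := by rw [ord_inv hf]; omega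
        rw [← hr, ord_algebraMap hy hr0] at h1
        have hk : Ring.KrullDimLE 1 (Y.presheaf.stalk y) :=
          krullDimLE_of_coheight_le hy.codim_one.le
        have h2 : (Module.length (Y.presheaf.stalk y)
          (Y.presheaf.stalk y ⧸ Ideal.span {r})).toNat = 0 := by omega
        rw [ENat.toNat_eq_zero] at h2
        rcases h2 with h2 | h2
        · rw [Module.length_eq_zero_iff, Submodule.Quotient.subsingleton_iff] at h2
          exact hu (Ideal.span_singleton_eq_top.mp h2)
        · exact Ring.ord_ne_top (mem_nonZeroDivisors_of_ne_zero hr0) h2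
  · rintro ⟨r, rfl⟩
    exact ord_algebraMap_nonneg hy (by rintro rfl; simp at hf)

end Order

/-! ### Points of affine open sets -/

section Points
variable {X : Scheme.{0}} {W : X.Opens} (hW : IsAffineOpen W)

include hW in
/-- The local ring at the point of an affine open set `W` given by a prime ideal `Q` of `Γ(X, W)` is
the localization at `Q`, and this point specializes to all points of `W` where `Q` vanishes. -/
theorem exists_point_of_isPrime (Q : Ideal Γ(X, W)) [Q.IsPrime] :
    ∃ (x : X) (hx : x ∈ W), (∀ s, IsUnit (X.presheaf.germ W x hx s) ↔ s ∉ Q) ∧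
      (∀ r : X.presheaf.stalk x, ∃ c s, s ∉ Q ∧
        r * X.presheaf.germ W x hx s = X.presheaf.germ W x hx c) ∧
      (∀ [IsDomain Γ(X, W)], IsDiscreteValuationRing (Localization.AtPrime Q) →
        ∃ _ : IsDomain (X.presheaf.stalk x), IsDiscreteValuationRing (X.presheaf.stalk x)) ∧
      IsLocalRing.maximalIdeal (X.presheaf.stalk x) = Q.map (X.presheaf.germ W x hx).hom ∧
      ∀ (y : X) (hy : y ∈ W), (∀ s ∈ Q, ¬ IsUnit (X.presheaf.germ W y hy s)) → x ⤳ y := by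
  let P : PrimeSpectrum Γ(X, W) := ⟨Q, inferInstance⟩
  have hx : hW.fromSpec P ∈ W := hW.opensRange_fromSpec.le ⟨P, rfl⟩
  let := TopCat.Presheaf.algebra_section_stalk X.presheaf ⟨hW.fromSpec P, hx⟩
  have hloc : IsLocalization.AtPrime (X.presheaf.stalk (hW.fromSpec P)) Q :=
    hW.isLocalization_stalk' P hx
  refine ⟨hW.fromSpec P, hx, fun s => ?_, fun r => ?_, fun {_} h => ?_, ?_, fun y hy h => ?_⟩
  · exact IsLocalization.AtPrime.isUnit_to_map_iff (X.presheaf.stalk (hW.fromSpec P)) Q s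
  · obtain ⟨⟨c, s⟩, h⟩ := IsLocalization.surj Q.primeCompl r
    exact ⟨c, s, s.2, h⟩
  · let e := IsLocalization.algEquiv Q.primeCompl (Localization.AtPrime Q)
        (X.presheaf.stalk (hW.fromSpec P))
    have : IsDomain (X.presheaf.stalk (hW.fromSpec P)) := e.symm.toMulEquiv.isDomain _
    exact ⟨this, IsDiscreteValuationRing.RingEquivClass.isDiscreteValuationRing e⟩
  · exact (IsLocalization.AtPrime.map_eq_maximalIdeal Q _).symm
  · have hspec : P ⤳ hW.primeIdealOf ⟨y, hy⟩ := by
      rw [← PrimeSpectrum.le_iff_specializes]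
      intro s hs
      let := TopCat.Presheaf.algebra_section_stalk X.presheaf ⟨y, hy⟩
      have := hW.isLocalization_stalk ⟨y, hy⟩
      by_contra hs'
      exact h s hs ((IsLocalization.AtPrime.isUnit_to_map_iff (X.presheaf.stalk y)
        (hW.primeIdealOf ⟨y, hy⟩).asIdeal s).mpr hs')
    have h2 := hspec.map hW.fromSpec.continuous
    rwa [show hW.fromSpec (hW.primeIdealOf ⟨y, hy⟩) = y from hW.fromSpec_primeIdealOf ⟨y, hy⟩] at h2

include hW in
theorem eq_genericPoint_of_isUnit_germ [IsIntegral X]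
    {x : X} (hx : x ∈ W) (h : ∀ s, s ≠ 0 → IsUnit (X.presheaf.germ W x hx s)) :
    x = genericPoint X := by
  have : Nonempty W := ⟨⟨x, hx⟩⟩
  let := TopCat.Presheaf.algebra_section_stalk X.presheaf ⟨x, hx⟩
  have := hW.isLocalization_stalk ⟨x, hx⟩
  have h0 : (hW.primeIdealOf ⟨x, hx⟩).asIdeal = ⊥ := by
    rw [eq_bot_iff]
    intro s hs
    by_contra hs'
    exact (IsLocalization.AtPrime.isUnit_to_map_iff (X.presheaf.stalk x)
        (hW.primeIdealOf ⟨x, hx⟩).asIdeal s).mp (h s hs') hs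
  have hη : genericPoint X ∈ W :=
    ((genericPoint_spec X).mem_open_set_iff W.isOpen).mpr ⟨x, trivial, hx⟩
  have hspec : hW.primeIdealOf ⟨x, hx⟩ ⤳ hW.primeIdealOf ⟨_, hη⟩ := by
    rw [← PrimeSpectrum.le_iff_specializes]
    change (hW.primeIdealOf ⟨x, hx⟩).asIdeal ≤ (hW.primeIdealOf ⟨_, hη⟩).asIdeal
    rw [h0]; exact bot_le
  have h2 := hspec.map hW.fromSpec.continuous
  rw [show hW.fromSpec (hW.primeIdealOf ⟨x, hx⟩) = x from hW.fromSpec_primeIdealOf ⟨x, hx⟩,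
    show hW.fromSpec (hW.primeIdealOf ⟨_, hη⟩) = genericPoint X from
      hW.fromSpec_primeIdealOf ⟨_, hη⟩] at h2
  exact (h2.antisymm ((genericPoint_spec X).specializes trivial)).eq

end Points

/-! ### Local equations of divisors -/

section Divisors
variable {Y : Scheme.{0}} [IsIntegral Y]

namespace EffCartierDivisor
variable (Z : EffCartierDivisor Y)

theorem exists_span_eq (y : Y) : ∃ z, z ≠ 0 ∧ Ideal.span {z} = Z.ideal y := by
  obtain ⟨U, hU, f, hf, h⟩ := Z.locally_principal y
  refine ⟨Y.presheaf.germ U y hU f, ?_, (h y hU).symm⟩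
  have : Nonempty U := ⟨⟨y, hU⟩⟩
  rw [Ne, map_eq_zero_iff _ (germ_injective_of_isIntegral Y y hU)]
  exact hf

theorem ideal_ne_bot (y : Y) : Z.ideal y ≠ ⊥ := by
  obtain ⟨z, hz, h⟩ := Z.exists_span_eq y
  rw [← h, Ne, Ideal.span_singleton_eq_bot]
  exact hz

theorem ne_zero_of_span_eq {y : Y} {z : Y.presheaf.stalk y} (h : Ideal.span {z} = Z.ideal y) :
    z ≠ 0 := by
  rintro rfl
  exact Z.ideal_ne_bot y (by rw [← h]; simp)

/-- A local equation at `y` is a local equation at every generization of `y`. -/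
theorem span_stalkSpecializes {y' y : Y} (hs : y' ⤳ y) {z : Y.presheaf.stalk y}
    (h : Ideal.span {z} = Z.ideal y) :
    Ideal.span {Y.presheaf.stalkSpecializes hs z} = Z.ideal y' := by
  obtain ⟨U, hU, f, hf, hUf⟩ := Z.locally_principal y
  have hU' : y' ∈ U := hs.mem_open U.isOpen hU
  have h1 : (Ideal.span {z}).map (Y.presheaf.stalkSpecializes hs).hom = Z.ideal y' := by
    rw [h, hUf y hU, hUf y' hU', Ideal.map_span, Set.image_singleton]
    congr 2
    exact TopCat.Presheaf.germ_stalkSpecializes_apply Y.presheaf hU hs f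
  rw [← h1, Ideal.map_span, Set.image_singleton]

theorem mem_support_of_specializes {y' y : Y} (hs : y' ⤳ y) (h : y' ∈ Z.support) :
    y ∈ Z.support := by
  intro hy
  apply h
  obtain ⟨z, -, hz⟩ := Z.exists_span_eq y
  rw [← Z.span_stalkSpecializes hs hz, Ideal.span_singleton_eq_top]
  rw [hy, Ideal.span_singleton_eq_top] at hz
  exact hz.map (Y.presheaf.stalkSpecializes hs).hom

theorem genericPoint_notMem_support : genericPoint Y ∉ Z.support := by
  intro h
  apply h
  obtain ⟨z, hz0, hz⟩ := Z.exists_span_eq (genericPoint Y)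
  rw [← hz, Ideal.span_singleton_eq_top]
  exact (isUnit_iff_ne_zero (a := (z : Y.functionField))).mpr hz0

theorem span_preimage {X : Scheme.{0}} [IsIntegral X] (p : X ⟶ Y) [Surjective p] {x : X}
    {z : Y.presheaf.stalk (p x)} (h : Ideal.span {z} = Z.ideal (p x)) :
    Ideal.span {p.stalkMap x z} = (Z.preimage p).ideal x := by
  change _ = (Z.ideal (p x)).map (p.stalkMap x).hom
  rw [← h, Ideal.map_span, Set.image_singleton]

theorem mem_support_preimage {X : Scheme.{0}} [IsIntegral X] (p : X ⟶ Y) [Surjective p] {x : X} :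
    x ∈ (Z.preimage p).support ↔ p x ∈ Z.support := by
  refine not_congr ?_
  obtain ⟨z, -, hz⟩ := Z.exists_span_eq (p x)
  rw [← Z.span_preimage p hz, ← hz, Ideal.span_singleton_eq_top, Ideal.span_singleton_eq_top]
  exact isUnit_map_iff (p.stalkMap x).hom z

theorem ord_span [IsLocallyNoetherian Y] {y : Y} (hy : IsPrimeDivisorPoint y)
    {z : Y.presheaf.stalk y} (h : Ideal.span {z} = Z.ideal y) :
    Scheme.ord (algebraMap _ Y.functionField z) y = Z.mult y := by
  rw [ord_algebraMap hy (Z.ne_zero_of_span_eq h), mult, h]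

theorem mult_eq_zero [IsLocallyNoetherian Y] {y : Y} (h : y ∉ Z.support) : Z.mult y = 0 := by
  have h' : Z.ideal y = ⊤ := not_not.mp h
  have : Subsingleton (Y.presheaf.stalk y ⧸ Z.ideal y) := by
    rw [h']; exact Ideal.Quotient.subsingleton_iff.mpr rfl
  rw [mult, Module.length_eq_zero]; rfl

end EffCartierDivisor

theorem algebraMap_stalkSpecializes {y' y : Y} (hs : y' ⤳ y) (r : Y.presheaf.stalk y) :
    algebraMap (Y.presheaf.stalk y') Y.functionField (Y.presheaf.stalkSpecializes hs r) =
      algebraMap (Y.presheaf.stalk y) Y.functionField r := by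
  have h : Y.presheaf.stalkSpecializes hs ≫
      Y.presheaf.stalkSpecializes ((genericPoint_spec Y).specializes trivial) =
      Y.presheaf.stalkSpecializes ((genericPoint_spec Y).specializes trivial) := by
    rw [TopCat.Presheaf.stalkSpecializes_comp]
  exact congr($(h).hom r)

variable {ι : Type} [Fintype ι]

theorem ord_pow_mul_prod [IsLocallyNoetherian Y] (Z : ι → EffCartierDivisor Y) {y : Y}
    (hy : IsPrimeDivisorPoint y) {z : ι → Y.presheaf.stalk y}
    (hz : ∀ i, Ideal.span {z i} = (Z i).ideal y) {f : Y.functionField} (hf : f ≠ 0) (n : ℕ)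
    (m : ι → ℤ) :
    Scheme.ord (f ^ n * ∏ i, algebraMap _ Y.functionField (z i) ^ m i) y =
      n * Scheme.ord f y + ∑ i, m i * (Z i).mult y := by
  have h0 : ∀ i, algebraMap _ Y.functionField (z i) ≠ 0 := fun i => by
    simpa using (Z i).ne_zero_of_span_eq (hz i)
  rw [Scheme.ord_mul (pow_ne_zero _ hf) (Finset.prod_ne_zero_iff.mpr fun i _ =>
    zpow_ne_zero _ (h0 i)), ord_pow hf, ord_prod _ _ fun i _ => zpow_ne_zero _ (h0 i)]
  congr 1
  refine Finset.sum_congr rfl fun i _ => ?_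
  rw [ord_zpow (h0 i), (Z i).ord_span hy (hz i)]

end Divisors

/-! ### Regularity of sections -/

section Regularity
variable {Y : Scheme.{0}} [IsIntegral Y]

theorem algebraMap_germ {W : Y.Opens} [Nonempty W] {y : Y} (hy : y ∈ W) (s : Γ(Y, W)) :
    algebraMap (Y.presheaf.stalk y) Y.functionField (Y.presheaf.germ W y hy s) =
      Y.germToFunctionField W s :=
  Y.algebraMap_germ_eq_germToFunctionField hy s

variable [IsLocallyNoetherian Y] {y : Y}

/-- At a normal point, a rational function is regular if it has nonnegative order along all prime
divisors through the point. -/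
theorem mem_range_stalk_of_forall_ord_nonneg [IsIntegrallyClosed (Y.presheaf.stalk y)]
    {f : Y.functionField}
    (h : f ≠ 0 → ∀ y', y' ⤳ y → IsPrimeDivisorPoint y' → 0 ≤ Scheme.ord f y') :
    f ∈ (algebraMap (Y.presheaf.stalk y) Y.functionField).range := by
  by_cases hf : f = 0
  · rw [hf]; exact zero_mem _
  refine mem_range_of_forall_isDiscreteValuationRing f fun P _ hP => ?_
  obtain ⟨_, ⟨W, hW, rfl⟩, hy, -⟩ := Y.isBasis_affineOpens.exists_subset_of_mem_open
    (Set.mem_univ y) isOpen_univ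
  have hy : y ∈ W := hy
  have : Nonempty W := ⟨⟨y, hy⟩⟩
  let := TopCat.Presheaf.algebra_section_stalk Y.presheaf ⟨y, hy⟩
  have hloc := hW.isLocalization_stalk ⟨y, hy⟩
  let Q : Ideal Γ(Y, W) := P.comap (algebraMap Γ(Y, W) (Y.presheaf.stalk y))
  have hQ : IsLocalization.AtPrime (Localization.AtPrime P) Q :=
    IsLocalization.isLocalization_isLocalization_atPrime_isLocalization
      (hW.primeIdealOf ⟨y, hy⟩).asIdeal.primeCompl (Localization.AtPrime P) P
  obtain ⟨y', hy', hunit, hfrac, hdvr, -, hspec⟩ := exists_point_of_isPrime hW Q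
  have hs : y' ⤳ y := hspec y hy fun s hs hu =>
    Ideal.IsPrime.ne_top ‹P.IsPrime› (Ideal.eq_top_of_isUnit_mem _ hs hu)
  have hdv : IsDiscreteValuationRing (Localization.AtPrime Q) :=
    IsDiscreteValuationRing.RingEquivClass.isDiscreteValuationRing
      (IsLocalization.algEquiv Q.primeCompl (Localization.AtPrime P) (Localization.AtPrime Q))
  obtain ⟨_, hdv'⟩ := hdvr hdv
  have hpd : IsPrimeDivisorPoint y' := .of_isDiscreteValuationRing hdv'
  obtain ⟨r, rfl⟩ := (ord_nonneg_iff hpd hf).mp (h hf y' hs hpd)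
  obtain ⟨c, s, hs, hcs⟩ := hfrac r
  refine ⟨Y.presheaf.germ W y hy c, Y.presheaf.germ W y hy s, hs, ?_⟩
  rw [algebraMap_germ, algebraMap_germ, ← algebraMap_germ hy' c, ← hcs, map_mul,
    algebraMap_germ]

variable [Y.Over SpecC] {ι : Type} [Fintype ι] {Z : ι → EffCartierDivisor Y} {q : ι → ℚ} {U : Set Y}
  {f : Y.functionField} {n : ℕ} {m : ι → ℤ} {z : ι → Y.presheaf.stalk y}

theorem ord_pow_mul_prod_nonneg (hf : f ∈ sections Z q U) (hf0 : f ≠ 0)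
    (hm : ∀ i, (m i : ℚ) = n * q i) (hy : IsPrimeDivisorPoint y) (hyU : y ∈ U)
    (hz : ∀ i, Ideal.span {z i} = (Z i).ideal y) :
    0 ≤ Scheme.ord (f ^ n * ∏ i, algebraMap _ Y.functionField (z i) ^ m i) y := by
  have h := hf hf0 y hyU hy
  have h2 : (0 : ℚ) ≤ n * (Scheme.ord f y + ∑ i, q i * (Z i).mult y) := by positivity
  rw [ord_pow_mul_prod Z hy hz hf0, ← Int.cast_nonneg_iff (R := ℚ)]
  push_cast
  simpa only [hm, mul_add, Finset.mul_sum, mul_assoc] using h2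

/-- If `n E` is integral and `f` is a section of `𝒪(E)`, then `f ^ n` is a regular section of the
invertible sheaf `𝒪(n E)` at all normal points. -/
theorem pow_mul_prod_mem_range [IsIntegrallyClosed (Y.presheaf.stalk y)]
    (hf : f ∈ sections Z q U) (hn : n ≠ 0) (hm : ∀ i, (m i : ℚ) = n * q i)
    (hU : ∀ y', y' ⤳ y → y' ∈ U) (hz : ∀ i, Ideal.span {z i} = (Z i).ideal y) :
    f ^ n * ∏ i, algebraMap _ Y.functionField (z i) ^ m i ∈
      (algebraMap (Y.presheaf.stalk y) Y.functionField).range := by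
  by_cases hf0 : f = 0
  · rw [hf0, zero_pow hn, zero_mul]; exact zero_mem _
  refine mem_range_stalk_of_forall_ord_nonneg fun _ y' hs hy' => ?_
  have h := ord_pow_mul_prod_nonneg hf hf0 hm hy' (hU y' hs)
    fun i => (Z i).span_stalkSpecializes hs (hz i)
  simpa only [algebraMap_stalkSpecializes] using h

/-- A common denominator of the coefficients of a `ℚ`-divisor. -/
theorem exists_mul_eq_intCast (q : ι → ℚ) : ∃ (n : ℕ) (m : ι → ℤ), n ≠ 0 ∧
    ∀ i, (m i : ℚ) = n * q i := by
  classical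
  refine ⟨∏ i, (q i).den, fun i => (∏ j ∈ Finset.univ.erase i, (q j).den : ℕ) * (q i).num,
    Finset.prod_ne_zero_iff.mpr fun i _ => (q i).den_nz, fun i => ?_⟩
  rw [← Finset.mul_prod_erase _ _ (Finset.mem_univ i)]
  push_cast
  have := Rat.mul_den_eq_num (q i)
  rw [← this]; ring

end Regularity

section Pullback
variable {X Y : Scheme.{0}} [IsIntegral X] [IsIntegral Y] [IsLocallyNoetherian X]
  [IsLocallyNoetherian Y] [X.Over SpecC] [Y.Over SpecC] (p : X ⟶ Y) [Surjective p]
  {ι : Type} [Fintype ι] {Z : ι → EffCartierDivisor Y}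

omit [IsLocallyNoetherian X] [IsLocallyNoetherian Y] [X.Over SpecC] [Y.Over SpecC] in
theorem map_pow_mul_prod {x : X} (z : ι → Y.presheaf.stalk (p x)) (f : Y.functionField) (n : ℕ)
    (m : ι → ℤ) :
    functionFieldMap p (f ^ n * ∏ i, algebraMap _ Y.functionField (z i) ^ m i) =
      functionFieldMap p f ^ n *
        ∏ i, algebraMap _ X.functionField (p.stalkMap x (z i)) ^ m i := by
  simp only [map_mul, map_pow, map_prod, map_zpow₀, functionFieldMap_algebraMap]

/-- Sections of `𝒪(E)` pull back to sections of the pull-back of `E`. -/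
theorem functionFieldMap_mem_sections (hY : ∀ y : Y, IsIntegrallyClosed (Y.presheaf.stalk y))
    {q : ι → ℚ} {U : Set Y} (hU : ∀ y y', y' ⤳ y → y ∈ U → y' ∈ U)
    {f : Y.functionField} (hf : f ∈ sections Z q U) :
    functionFieldMap p f ∈ sections (fun i => (Z i).preimage p) q (p ⁻¹' U) := by
  intro hf0 x hxU hx
  obtain ⟨n, m, hn, hm⟩ := exists_mul_eq_intCast q
  choose z _ hz using fun i => (Z i).exists_span_eq (p x)
  have := hY (p x)
  obtain ⟨r, hr⟩ := pow_mul_prod_mem_range hf hn hm (fun y' hs => hU _ y' hs hxU) hz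
  have h1 := ord_pow_mul_prod (fun i => (Z i).preimage p) hx
    (fun i => (Z i).span_preimage p (hz i)) hf0 n m
  rw [← map_pow_mul_prod, ← hr, functionFieldMap_algebraMap] at h1
  have h2 : 0 ≤ Scheme.ord (algebraMap _ X.functionField (p.stalkMap x r)) x := by
    by_cases h0 : p.stalkMap x r = 0
    · have : functionFieldMap p f ^ n * ∏ i,
          algebraMap _ X.functionField (p.stalkMap x (z i)) ^ m i = 0 := by
        rw [← map_pow_mul_prod, ← hr, functionFieldMap_algebraMap, h0, map_zero]
      refine absurd this (mul_ne_zero (pow_ne_zero _ hf0) (Finset.prod_ne_zero_iff.mpr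
        fun i _ => zpow_ne_zero _ ?_))
      simpa using ((Z i).preimage p).ne_zero_of_span_eq ((Z i).span_preimage p (hz i))
    · exact ord_algebraMap_nonneg hx h0
  rw [h1, ← Int.cast_nonneg_iff (R := ℚ)] at h2
  push_cast at h2
  simp only [hm, mul_assoc, ← Finset.mul_sum, ← mul_add] at h2
  exact nonneg_of_mul_nonneg_right h2 (by positivity)

end Pullback

/-! ### Affine charts of a product -/

section Charts

theorem le_preimage_top {X Y : Scheme.{0}} (f : X ⟶ Y) (U : X.Opens) : U ≤ f ⁻¹ᵁ ⊤ := le_top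

/-- The sections over an open set of a scheme over `ℂ` form a `ℂ`-algebra. -/
instance sectionAlgebra (Y : Scheme.{0}) [Y.Over SpecC] (U : Y.Opens) : Algebra ℂ Γ(Y, U) :=
  ((Scheme.ΓSpecIso (CommRingCat.of ℂ)).inv ≫ (Y ↘ SpecC).appLE ⊤ U (le_preimage_top _ U)).hom.toAlgebra

instance (Y : Scheme.{0}) [Y.Over SpecC] [IsIntegral Y] (U : Y.Opens) [Nonempty U] :
    IsScalarTower ℂ Γ(Y, U) Y.functionField := by
  refine IsScalarTower.of_algebraMap_eq fun c => ?_
  change Y.germToFunctionField ⊤ ((Y ↘ SpecC).appTop _) =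
    Y.germToFunctionField U ((Y ↘ SpecC).appLE ⊤ U (le_preimage_top _ U) _)
  have h : (Y ↘ SpecC).appLE ⊤ U (le_preimage_top _ U) ≫ Y.germToFunctionField U =
      (Y ↘ SpecC).appTop ≫ Y.germToFunctionField ⊤ := by
    exact congrArg ((Y ↘ SpecC).app ⊤ ≫ ·) (Y.presheaf.germ_res _ _ _)
  exact congr($(h.symm).hom _)

theorem sectionAlgebra_finiteType {Y : Scheme.{0}} [Y.Over SpecC] [LocallyOfFiniteType (Y ↘ SpecC)]
    {U : Y.Opens} (hU : IsAffineOpen U) : Algebra.FiniteType ℂ Γ(Y, U) := by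
  have h1 := (Y ↘ SpecC).finiteType_appLE (isAffineOpen_top SpecC) hU (le_preimage_top _ U)
  have h2 : ((Scheme.ΓSpecIso (CommRingCat.of ℂ)).inv ≫
      (Y ↘ SpecC).appLE ⊤ U (le_preimage_top _ U)).hom.FiniteType := by
    rw [CommRingCat.hom_comp]
    exact h1.comp (RingHom.FiniteType.of_surjective _
      (Scheme.ΓSpecIso (CommRingCat.of ℂ)).symm.commRingCatIsoToRingEquiv.surjective)
  exact h2

variable {X Y Y' : Scheme.{0}} [X.Over SpecC] [Y.Over SpecC] [Y'.Over SpecC] {p : X ⟶ Y}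
  {q : X ⟶ Y'} (H : IsPullback p q (Y ↘ SpecC) (Y' ↘ SpecC)) (hp : p ≫ Y ↘ SpecC = X ↘ SpecC)
  {U : Y.Opens} {V : Y'.Opens} {W : X.Opens} (hW : W = p ⁻¹ᵁ U ⊓ q ⁻¹ᵁ V)
  (hU : IsAffineOpen U) (hV : IsAffineOpen V)

include H hW hU hV in
omit [X.Over SpecC] in
theorem isAffineOpen_of_isPullback : IsAffineOpen W := by
  have : IsAffine _ := hU
  have : IsAffine _ := hV
  have : IsAffine ((⊤ : SpecC.Opens) : Scheme) := isAffineOpen_top SpecC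
  exact .of_isIso (Scheme.Hom.isPullback_resLE H (US := ⊤) (le_preimage_top _ V) (le_preimage_top _ U) hW).isoPullback.hom

include H hp hU hV in
theorem exists_tensorProduct_equiv : ∃ e : Γ(Y, U) ⊗[ℂ] Γ(Y', V) ≃ₐ[ℂ] Γ(X, W),
    (∀ a, e (a ⊗ₜ 1) = p.appLE U W (hW.le.trans inf_le_left) a) ∧
    ∀ b, e (1 ⊗ₜ b) = q.appLE V W (hW.le.trans inf_le_right) b := by
  have h1 := (isIso_pushoutSection_iff H (US := ⊤) (le_preimage_top _ V) (le_preimage_top _ U) hW).mp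
    (isIso_pushoutSection_of_isAffineOpen H (US := ⊤) (le_preimage_top _ V) (le_preimage_top _ U) hW (isAffineOpen_top SpecC)
      hV hU)
  have h2 : IsPushout (CommRingCat.ofHom (algebraMap ℂ Γ(Y, U)))
      (CommRingCat.ofHom (algebraMap ℂ Γ(Y', V))) (p.appLE U W (hW.le.trans inf_le_left))
      (q.appLE V W (hW.le.trans inf_le_right)) :=
    h1.of_iso (Scheme.ΓSpecIso (CommRingCat.of ℂ)) (Iso.refl _) (Iso.refl _) (Iso.refl _)
      ((Category.comp_id _).trans ((Iso.hom_inv_id_assoc (Scheme.ΓSpecIso (CommRingCat.of ℂ))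
        ((Y ↘ SpecC).appLE ⊤ U (le_preimage_top _ U))).symm))
      ((Category.comp_id _).trans ((Iso.hom_inv_id_assoc (Scheme.ΓSpecIso (CommRingCat.of ℂ))
        ((Y' ↘ SpecC).appLE ⊤ V (le_preimage_top _ V))).symm)) (by simp) (by simp)
  let i := (CommRingCat.isPushout_tensorProduct ℂ Γ(Y, U) Γ(Y', V)).isoIsPushout _ _ h2
  have hinl : ∀ a, i.hom (a ⊗ₜ 1) = p.appLE U W (hW.le.trans inf_le_left) a := fun a =>
    congr($((CommRingCat.isPushout_tensorProduct ℂ Γ(Y, U) Γ(Y', V)).inl_isoIsPushout_hom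
      _ _ h2).hom a)
  have hinr : ∀ b, i.hom (1 ⊗ₜ b) = q.appLE V W (hW.le.trans inf_le_right) b := fun b =>
    congr($((CommRingCat.isPushout_tensorProduct ℂ Γ(Y, U) Γ(Y', V)).inr_isoIsPushout_hom
      _ _ h2).hom b)
  refine ⟨AlgEquiv.ofRingEquiv (f := i.commRingCatIsoToRingEquiv) fun c => ?_, hinl, hinr⟩
  refine (hinl (algebraMap ℂ Γ(Y, U) c)).trans ?_
  have h3 : (Y ↘ SpecC).appLE ⊤ U (le_preimage_top _ U) ≫ p.appLE U W (hW.le.trans inf_le_left) =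
      (X ↘ SpecC).appLE ⊤ W (le_preimage_top _ W) := by
    rw [Scheme.Hom.appLE_comp_appLE]
    congr 1
  exact congr($h3 ((Scheme.ΓSpecIso (CommRingCat.of ℂ)).inv c))

omit [X.Over SpecC] [Y.Over SpecC] in
theorem functionFieldMap_algebraMap_section [IsIntegral X] [IsIntegral Y] [Surjective p]
    [Nonempty U] [Nonempty W] (h : W ≤ p ⁻¹ᵁ U) (a : Γ(Y, U)) :
    functionFieldMap p (algebraMap Γ(Y, U) Y.functionField a) =
      algebraMap Γ(X, W) X.functionField (p.appLE U W h a) := by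
  obtain ⟨w, hw⟩ := ‹Nonempty W›
  have : Nonempty ↑(p ⁻¹ᵁ U) := ⟨⟨w, h hw⟩⟩
  refine (functionFieldMap_germ p U a).trans ?_
  have h : X.germToFunctionField (p ⁻¹ᵁ U) =
      X.presheaf.map (homOfLE h).op ≫ X.germToFunctionField W :=
    (X.presheaf.germ_res _ _ _).symm
  rw [h]
  rfl

end Charts

/-! ### Rational functions on a product -/

section Product

theorem isDiscreteValuationRing_of_maximalIdeal_eq_span {R : Type*} [CommRing R] [IsDomain R]
    [IsLocalRing R] [IsNoetherianRing R] {t : R} (ht : t ≠ 0)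
    (h : IsLocalRing.maximalIdeal R = Ideal.span {t}) : IsDiscreteValuationRing R := by
  have hf : ¬ IsField R := by
    intro hf
    rw [IsLocalRing.isField_iff_maximalIdeal_eq.mp hf] at h
    exact ht (Ideal.span_singleton_eq_bot.mp h.symm)
  have hpr : (IsLocalRing.maximalIdeal R).IsPrincipal := ⟨t, h⟩
  exact ((IsDiscreteValuationRing.TFAE R hf).out 0 4).mpr hpr

theorem stalkMap_germ_appLE {X Y : Scheme.{0}} (p : X ⟶ Y) {U : Y.Opens} {W : X.Opens}
    (h : W ≤ p ⁻¹ᵁ U) {x : X} (hx : x ∈ W) (a : Γ(Y, U)) :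
    p.stalkMap x (Y.presheaf.germ U (p x) (h hx) a) = X.presheaf.germ W x hx (p.appLE U W h a) := by
  refine (Scheme.Hom.germ_stalkMap_apply p U x (h hx) a).trans ?_
  have h2 : X.presheaf.germ (p ⁻¹ᵁ U) x (h hx) =
      X.presheaf.map (homOfLE h).op ≫ X.presheaf.germ W x hx :=
    (X.presheaf.germ_res _ _ _).symm
  rw [h2]
  rfl

/-- A point of an affine open set is determined by its prime ideal. -/
theorem eq_of_isUnit_germ_iff {Y : Scheme.{0}} {V : Y.Opens} (hV : IsAffineOpen V) {y y' : Y}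
    (hy : y ∈ V) (hy' : y' ∈ V)
    (h : ∀ s, IsUnit (Y.presheaf.germ V y hy s) ↔ IsUnit (Y.presheaf.germ V y' hy' s)) :
    y = y' := by
  have h1 : ∀ (z : Y) (hz : z ∈ V) s,
      IsUnit (Y.presheaf.germ V z hz s) ↔ s ∉ (hV.primeIdealOf ⟨z, hz⟩).asIdeal := by
    intro z hz s
    let := TopCat.Presheaf.algebra_section_stalk Y.presheaf ⟨z, hz⟩
    have := hV.isLocalization_stalk ⟨z, hz⟩
    exact IsLocalization.AtPrime.isUnit_to_map_iff (Y.presheaf.stalk z)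
        (hV.primeIdealOf ⟨z, hz⟩).asIdeal s
  have h2 : hV.primeIdealOf ⟨y, hy⟩ = hV.primeIdealOf ⟨y', hy'⟩ := by
    ext s
    have := h s
    rw [h1, h1] at this
    exact not_iff_not.mp this
  have h3 := congrArg hV.fromSpec h2
  exact (hV.fromSpec_primeIdealOf ⟨y, hy⟩).symm.trans
    (h3.trans (hV.fromSpec_primeIdealOf ⟨y', hy'⟩))

variable {X Y Y' : Scheme.{0}} [X.Over SpecC] [Y.Over SpecC] [Y'.Over SpecC] [IsVariety X]
  [IsVariety Y] [IsVariety Y'] {p : X ⟶ Y} {q : X ⟶ Y'} [Surjective p] [Surjective q]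
  (hp : p ≫ Y ↘ SpecC = X ↘ SpecC) (hq : q ≫ Y' ↘ SpecC = X ↘ SpecC)

variable (p q) in
/-- The map `ℂ(Y) ⊗ ℂ(Y') → ℂ(X)` sending `f ⊗ f'` to the product of the pull-backs of `f` and `f'`
along the projections `p : X → Y` and `q : X → Y'`. -/
def functionFieldProductMap : Y.functionField ⊗[ℂ] Y'.functionField →ₐ[ℂ] X.functionField :=
  Algebra.TensorProduct.productMap (functionFieldAlgHom p hp) (functionFieldAlgHom q hq)

theorem functionFieldProductMap_tmul (f : Y.functionField) (f' : Y'.functionField) :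
    functionFieldProductMap p q hp hq (f ⊗ₜ f') = functionFieldMap p f * functionFieldMap q f' :=
  Algebra.TensorProduct.productMap_apply_tmul ..

/-- The product of affine neighbourhoods of `y` and `y'` is affine, with the tensor product as its
coordinate ring. It is not empty because it contains the generic point. -/
theorem exists_chart (H : IsPullback p q (Y ↘ SpecC) (Y' ↘ SpecC)) (hp : p ≫ Y ↘ SpecC = X ↘ SpecC)
    (y : Y) (y' : Y') :
    ∃ (U : Y.Opens) (V : Y'.Opens) (W : X.Opens) (_ : IsAffineOpen U) (_ : IsAffineOpen V)
      (_ : IsAffineOpen W) (_ : y ∈ U) (_ : y' ∈ V) (_ : Nonempty U) (_ : Nonempty V)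
      (_ : Nonempty W) (hWU : W ≤ p ⁻¹ᵁ U) (hWV : W ≤ q ⁻¹ᵁ V)
      (e : Γ(Y, U) ⊗[ℂ] Γ(Y', V) ≃ₐ[ℂ] Γ(X, W)),
      (∀ a, e (a ⊗ₜ 1) = p.appLE U W hWU a) ∧ (∀ b, e (1 ⊗ₜ b) = q.appLE V W hWV b) := by
  obtain ⟨U, hU, hyU, -⟩ := exists_isAffineOpen_mem_and_subset (U := ⊤) (x := y) trivial
  obtain ⟨V, hV, hyV, -⟩ := exists_isAffineOpen_mem_and_subset (U := ⊤) (x := y') trivial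
  obtain ⟨e, he, he'⟩ := exists_tensorProduct_equiv H hp rfl hU hV
  have hU' : genericPoint Y ∈ U :=
    ((genericPoint_spec Y).mem_open_set_iff U.isOpen).mpr ⟨y, trivial, hyU⟩
  have hV' : genericPoint Y' ∈ V :=
    ((genericPoint_spec Y').mem_open_set_iff V.isOpen).mpr ⟨y', trivial, hyV⟩
  have hW' : genericPoint X ∈ p ⁻¹ᵁ U ⊓ q ⁻¹ᵁ V :=
    ⟨show p _ ∈ U from (map_genericPoint p).symm ▸ hU',
      show q _ ∈ V from (map_genericPoint q).symm ▸ hV'⟩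
  exact ⟨U, V, _, hU, hV, isAffineOpen_of_isPullback H rfl hU hV, hyU, hyV, ⟨⟨y, hyU⟩⟩,
    ⟨⟨y', hyV⟩⟩, ⟨⟨_, hW'⟩⟩, inf_le_left, inf_le_right, e, he, he'⟩

variable (H : IsPullback p q (Y ↘ SpecC) (Y' ↘ SpecC))
include H

theorem functionFieldProductMap_injective :
    Function.Injective (functionFieldProductMap p q hp hq) := by
  obtain ⟨U, V, W, hU, hV, hW, -, -, _, _, _, hWU, hWV, e, he, he'⟩ :=
    exists_chart H hp (genericPoint Y) (genericPoint Y')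
  have := functionField_isFractionRing_of_isAffineOpen Y U hU
  have := functionField_isFractionRing_of_isAffineOpen Y' V hV
  have := functionField_isFractionRing_of_isAffineOpen X W hW
  exact productMap_injective e (functionFieldAlgHom p hp) (functionFieldAlgHom q hq)
    (fun a => (functionFieldMap_algebraMap_section hWU a).trans (congrArg _ (he a).symm))
    (fun b => (functionFieldMap_algebraMap_section hWV b).trans (congrArg _ (he' b).symm))

/-- A rational function on `Y × Y'` without poles along the prime divisors that dominate both
factors lies in `ℂ(Y) ⊗ ℂ(Y')`. -/
theorem mem_range_functionFieldProductMap {F : X.functionField}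
    (h : F ≠ 0 → ∀ x, IsPrimeDivisorPoint x → p x = genericPoint Y → q x = genericPoint Y' →
      0 ≤ Scheme.ord F x) :
    F ∈ (functionFieldProductMap p q hp hq).range := by
  by_cases hF : F = 0
  · rw [hF]; exact zero_mem _
  obtain ⟨U, V, W, hU, hV, hW, -, -, _, _, _, hWU, hWV, e, he, he'⟩ :=
    exists_chart H hp (genericPoint Y) (genericPoint Y')
  have := functionField_isFractionRing_of_isAffineOpen Y U hU
  have := functionField_isFractionRing_of_isAffineOpen Y' V hV
  have := functionField_isFractionRing_of_isAffineOpen X W hW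
  have := sectionAlgebra_finiteType hU
  have := sectionAlgebra_finiteType hV
  refine mem_range_productMap e (functionFieldAlgHom p hp) (functionFieldAlgHom q hq)
    (fun a => (functionFieldMap_algebraMap_section hWU a).trans (congrArg _ (he a).symm))
    (fun b => (functionFieldMap_algebraMap_section hWV b).trans (congrArg _ (he' b).symm)) F
    fun Q _ ha hb hQ => ?_
  obtain ⟨x, hx, hunit, hfrac, hdvr, -⟩ := exists_point_of_isPrime hW Q
  obtain ⟨_, hdv⟩ := hdvr hQ
  have hpd : IsPrimeDivisorPoint x := .of_isDiscreteValuationRing hdv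
  have hpx : p x = genericPoint Y := eq_genericPoint_of_isUnit_germ hU (hWU hx) fun s hs => by
    rw [← isUnit_map_iff (p.stalkMap x).hom]
    have := (hunit _).mpr (ha s hs)
    rw [he, ← stalkMap_germ_appLE] at this
    exact this
  have hqx : q x = genericPoint Y' := eq_genericPoint_of_isUnit_germ hV (hWV hx) fun s hs => by
    rw [← isUnit_map_iff (q.stalkMap x).hom]
    have := (hunit _).mpr (hb s hs)
    rw [he', ← stalkMap_germ_appLE] at this
    exact this
  obtain ⟨r, rfl⟩ := (ord_nonneg_iff hpd hF).mp (h hF x hpd hpx hqx)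
  obtain ⟨c, s, hs, hcs⟩ := hfrac r
  refine ⟨c, s, hs, ?_⟩
  have h1 := algebraMap_germ hx c
  have h2 := algebraMap_germ hx s
  rw [← hcs, map_mul, h2] at h1
  exact h1

include hp in
/-- Gauss's lemma on a product. The generic point `x` of `Y × {y'}`, for a prime divisor `y'` of
`Y'`, is a prime divisor, and a combination of linearly independent rational functions on `Y` with
coefficients regular at `y'` is a unit at `x` as soon as one coefficient is a unit at `y'`. -/
theorem exists_point_over_isPrimeDivisorPoint {y' : Y'} (hy' : IsPrimeDivisorPoint y') :
    ∃ x, p x = genericPoint Y ∧ q x = y' ∧ IsPrimeDivisorPoint x ∧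
      ∀ (ι : Type) [Fintype ι] (k : ι → Y.functionField) (c : ι → Y'.presheaf.stalk (q x)),
        LinearIndependent ℂ k → (∃ i, IsUnit (c i)) → ∃ u : (X.presheaf.stalk x)ˣ,
          algebraMap (X.presheaf.stalk x) X.functionField u = ∑ i, functionFieldMap p (k i) *
            functionFieldMap q (algebraMap _ Y'.functionField (c i)) := by
  obtain ⟨U, V, W, hU, hV, hW, -, hyV, _, _, _, hWU, hWV, e, he, he'⟩ :=
    exists_chart H hp (genericPoint Y) y'
  have := functionField_isFractionRing_of_isAffineOpen Y U hU
  have := sectionAlgebra_finiteType hU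
  let := TopCat.Presheaf.algebra_section_stalk Y'.presheaf ⟨y', hyV⟩
  have hloc := hV.isLocalization_stalk ⟨y', hyV⟩
  let P := (hV.primeIdealOf ⟨y', hyV⟩).asIdeal
  have hP : ∀ s, IsUnit (Y'.presheaf.germ V y' hyV s) ↔ s ∉ P := fun s =>
    IsLocalization.AtPrime.isUnit_to_map_iff (Y'.presheaf.stalk y') P s
  have hmax : P.map (Y'.presheaf.germ V y' hyV).hom =
      IsLocalRing.maximalIdeal (Y'.presheaf.stalk y') :=
    IsLocalization.AtPrime.map_eq_maximalIdeal P _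
  have := productIdeal_isPrime e P
  -- the generic point of `U × {y'}`
  obtain ⟨x, hx, hunit, -, -, hmaxx, -⟩ := exists_point_of_isPrime hW (productIdeal e P)
  have hsingle : ∀ (a : Γ(Y, U)) (b : Γ(Y', V)), a ≠ 0 → b ∉ P →
      e (a ⊗ₜ b) ∉ productIdeal e P := fun a b ha hb => by
    simpa using sum_tmul_notMem_productIdeal e P {()} (fun _ => a) (fun _ => b)
      (LinearIndependent.of_subsingleton () ha) () (by simp) hb
  have hpx : p x = genericPoint Y := eq_genericPoint_of_isUnit_germ hU (hWU hx) fun s hs => by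
    rw [← isUnit_map_iff (p.stalkMap x).hom]
    have := (hunit _).mpr (hsingle s 1 hs ((Ideal.ne_top_iff_one _).mp (Ideal.IsPrime.ne_top')))
    rw [he, ← stalkMap_germ_appLE] at this
    exact this
  have hqx : q x = y' := eq_of_isUnit_germ_iff hV (hWV hx) hyV fun s => by
    rw [← isUnit_map_iff (q.stalkMap x).hom, hP]
    have h1 := hunit (e (1 ⊗ₜ s))
    rw [he', ← stalkMap_germ_appLE] at h1
    refine h1.trans ⟨fun h2 hs => h2 ?_, fun h2 => ?_⟩
    · rw [← he']
      exact Ideal.mem_map_of_mem _ hs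
    · rw [← he']
      exact hsingle 1 s one_ne_zero h2
  subst hqx
  have hinj : Function.Injective (q.stalkMap x) := fun a b hab => by
    have := congrArg (algebraMap (X.presheaf.stalk x) X.functionField) hab
    rw [← functionFieldMap_algebraMap, ← functionFieldMap_algebraMap] at this
    exact IsFractionRing.injective _ Y'.functionField ((functionFieldMap q).injective this)
  have := hy'.dvr
  -- a uniformizer at `y'` is a uniformizer at `x`
  have hdvr : IsDiscreteValuationRing (X.presheaf.stalk x) := by
    obtain ⟨t, ht⟩ := IsDiscreteValuationRing.exists_irreducible (Y'.presheaf.stalk (q x))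
    refine isDiscreteValuationRing_of_maximalIdeal_eq_span (t := q.stalkMap x t)
      (fun h => ht.ne_zero (hinj (h.trans (map_zero (q.stalkMap x).hom).symm))) ?_
    have h1 : (IsLocalRing.maximalIdeal (Y'.presheaf.stalk (q x))).map (q.stalkMap x).hom =
        Ideal.span {q.stalkMap x t} := by
      rw [(IsDiscreteValuationRing.irreducible_iff_uniformizer t).mp ht, Ideal.map_span,
        Set.image_singleton]
    rw [hmaxx, ← h1, ← hmax, productIdeal, Ideal.map_map, Ideal.map_map]
    congr 1
    ext b
    exact (congrArg _ (he' b)).trans (stalkMap_germ_appLE q hWV hx b).symm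
  refine ⟨x, hpx, rfl, .of_isDiscreteValuationRing hdvr, fun ι _ k c hk ⟨i, hi⟩ => ?_⟩
  -- clear the denominators of the `k i` and the `c i`
  obtain ⟨d, hd⟩ := IsLocalization.exist_integer_multiples_of_finite
    (nonZeroDivisors Γ(Y, U)) k
  choose a ha using hd
  obtain ⟨t, ht⟩ := IsLocalization.exist_integer_multiples_of_finite P.primeCompl c
  choose b hb using ht
  have hd0 : (d : Γ(Y, U)) ≠ 0 := nonZeroDivisors.ne_zero d.2
  have hdK : algebraMap Γ(Y, U) Y.functionField d ≠ 0 := by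
    rwa [Ne, map_eq_zero_iff _ (IsFractionRing.injective Γ(Y, U) Y.functionField)]
  have ha' : LinearIndependent ℂ a := by
    have h1 : LinearIndependent ℂ (fun i => algebraMap Γ(Y, U) Y.functionField d * k i) :=
      hk.map' (LinearMap.mulLeft ℂ _) (LinearMap.ker_eq_bot.mpr
        (mul_right_injective₀ hdK))
    refine LinearIndependent.of_comp (IsScalarTower.toAlgHom ℂ Γ(Y, U) Y.functionField).toLinearMap
      ?_
    convert h1 using 1
    funext j
    exact (ha j).trans (Algebra.smul_def _ _)
  have hbi : b i ∉ P := by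
    rw [← hP]
    have h1 : Y'.presheaf.germ V (q x) hyV (b i) = Y'.presheaf.germ V (q x) hyV t * c i :=
      (hb i).trans (Algebra.smul_def _ _)
    rw [h1]
    exact ((hP _).mpr t.2).mul hi
  have hu := (hunit _).mpr
    (sum_tmul_notMem_productIdeal e P Finset.univ a b ha' i (Finset.mem_univ _) hbi)
  have hv := (hunit _).mpr (hsingle d t hd0 t.2)
  have key : ∀ (a : Γ(Y, U)) (b : Γ(Y', V)),
      algebraMap (X.presheaf.stalk x) X.functionField (X.presheaf.germ W x hx (e (a ⊗ₜ b))) =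
        functionFieldMap p (algebraMap Γ(Y, U) Y.functionField a) *
        functionFieldMap q (algebraMap (Y'.presheaf.stalk (q x)) Y'.functionField
          (Y'.presheaf.germ V (q x) hyV b)) := by
    intro a b
    rw [functionFieldMap_algebraMap, functionFieldMap_algebraMap_section hWU,
      stalkMap_germ_appLE q hWV hx, ← he', ← he, algebraMap_germ, algebraMap_germ]
    refine Eq.trans ?_ (map_mul (algebraMap Γ(X, W) X.functionField) _ _)
    rw [← map_mul, Algebra.TensorProduct.tmul_mul_tmul, mul_one, one_mul]
    rfl
  refine ⟨hu.unit * hv.unit⁻¹, ?_⟩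
  have hv0 : algebraMap (X.presheaf.stalk x) X.functionField (hv.unit : X.presheaf.stalk x) ≠ 0 := by
    rw [Ne, map_eq_zero_iff _ (IsFractionRing.injective _ _)]
    exact hv.unit.ne_zero
  rw [← mul_left_inj' hv0, ← map_mul, Units.val_mul, mul_assoc, Units.inv_mul, mul_one,
    IsUnit.unit_spec, IsUnit.unit_spec, map_sum, map_sum, map_sum, key, Finset.sum_mul]
  refine Finset.sum_congr rfl fun j _ => ?_
  rw [key, ha j]
  have h1 : Y'.presheaf.germ V (q x) hyV (b j) = Y'.presheaf.germ V (q x) hyV t * c j :=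
    (hb j).trans (Algebra.smul_def _ _)
  rw [h1, Algebra.smul_def, map_mul, map_mul, map_mul]
  ring

end Product

/-! ### Sections on a product -/

section LinearAlgebra
variable {V W : Type} [AddCommGroup V] [Module ℂ V] [AddCommGroup W] [Module ℂ W]

theorem exists_linearIndependent_left (w : V ⊗[ℂ] W) : ∃ (κ : Type) (_ : Fintype κ) (v : κ → V)
    (x : κ → W), LinearIndependent ℂ v ∧ w = ∑ j, v j ⊗ₜ x j := by
  let b := Module.Basis.ofVectorSpace ℂ V
  obtain ⟨c, hc⟩ := TensorProduct.eq_repr_basis_left b w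
  refine ⟨c.support, inferInstance, fun j => b j, fun j => c j,
    b.linearIndependent.comp _ Subtype.val_injective, ?_⟩
  rw [← hc, Finsupp.sum, ← Finset.sum_coe_sort]

theorem exists_linearIndependent_right (w : V ⊗[ℂ] W) : ∃ (κ : Type) (_ : Fintype κ) (v : κ → V)
    (x : κ → W), LinearIndependent ℂ x ∧ w = ∑ j, v j ⊗ₜ x j := by
  obtain ⟨κ, _, x, v, hx, hw⟩ := exists_linearIndependent_left (TensorProduct.comm ℂ V W w)
  refine ⟨κ, inferInstance, v, x, hx, (TensorProduct.comm ℂ V W).injective ?_⟩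
  rw [hw, map_sum]
  rfl

end LinearAlgebra

section Sections

/-- Poles do not disappear under pull-back, because the maps of stalks are local. -/
theorem ord_nonneg_of_ord_functionFieldMap_nonneg {X Y : Scheme.{0}} [IsIntegral X] [IsIntegral Y]
    [IsLocallyNoetherian X] [IsLocallyNoetherian Y] (p : X ⟶ Y) [Surjective p] {x : X}
    (hx : IsPrimeDivisorPoint x) (hpx : IsPrimeDivisorPoint (p x)) {f : Y.functionField}
    (hf : f ≠ 0) (h : 0 ≤ Scheme.ord (functionFieldMap p f) x) : 0 ≤ Scheme.ord f (p x) := by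
  have hf' : functionFieldMap p f ≠ 0 := (map_ne_zero _).mpr hf
  rw [ord_nonneg_iff hpx hf]
  have := hpx.dvr
  rcases ValuationRing.isInteger_or_isInteger (Y.presheaf.stalk (p x)) f with hr | ⟨r, hr⟩
  · exact hr
  obtain ⟨s, hs⟩ := (ord_nonneg_iff hx hf').mp h
  have hu : IsUnit r := by
    rw [← isUnit_map_iff (p.stalkMap x).hom]
    refine IsUnit.of_mul_eq_one s (IsFractionRing.injective (X.presheaf.stalk x) X.functionField ?_)
    have h1 := functionFieldMap_algebraMap p x r
    rw [map_mul, hs, map_one]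
    refine (congrArg (· * _) h1.symm).trans ?_
    rw [hr, map_inv₀, inv_mul_cancel₀ hf']
  refine ⟨((hu.unit⁻¹ : (Y.presheaf.stalk (p x))ˣ) : Y.presheaf.stalk (p x)), ?_⟩
  rw [← inv_inv f, ← hr]
  exact eq_inv_of_mul_eq_one_left (by rw [← map_mul]; simp)

variable {X Y Y' : Scheme.{0}} [X.Over SpecC] [Y.Over SpecC] [Y'.Over SpecC] [IsVariety X]
  [IsVariety Y] [IsVariety Y'] {p : X ⟶ Y} {q : X ⟶ Y'} [Surjective p] [Surjective q]
  (H : IsPullback p q (Y ↘ SpecC) (Y' ↘ SpecC))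
  (hp : p ≫ Y ↘ SpecC = X ↘ SpecC) (hq : q ≫ Y' ↘ SpecC = X ↘ SpecC)
  {ι ι' : Type} [Fintype ι] [Fintype ι'] {Z : ι → EffCartierDivisor Y}
  {Z' : ι' → EffCartierDivisor Y'} {a : ι → ℚ} {b : ι' → ℚ} {U : Set Y} {U' : Set Y'}

variable (p q) in
/-- The divisors `Zᵢ × Y'` and `Y × Z'ⱼ` on the product. -/
abbrev productDivisors (Z : ι → EffCartierDivisor Y) (Z' : ι' → EffCartierDivisor Y') :
    ι ⊕ ι' → EffCartierDivisor X :=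
  Sum.elim (fun i => (Z i).preimage p) (fun j => (Z' j).preimage q)

theorem mem_sections_sumElim {Z : ι → EffCartierDivisor X}
    {Z' : ι' → EffCartierDivisor X} {S : Set X} {f : X.functionField} :
    f ∈ sections (Sum.elim Z Z') (Sum.elim a b) S ↔ f ≠ 0 → ∀ x ∈ S, IsPrimeDivisorPoint x →
      0 ≤ (Scheme.ord f x : ℚ) + (∑ i, a i * (Z i).mult x + ∑ j, b j * (Z' j).mult x) := by
  change (f ≠ 0 → ∀ x ∈ S, IsPrimeDivisorPoint x → _) ↔ _
  simp only [Fintype.sum_sum_type, Sum.elim_inl, Sum.elim_inr]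

theorem sections_sumElim_swap {Z : ι → EffCartierDivisor X} {Z' : ι' → EffCartierDivisor X}
    {S : Set X} : sections (Sum.elim Z Z') (Sum.elim a b) S =
      sections (Sum.elim Z' Z) (Sum.elim b a) S := by
  ext f
  rw [mem_sections_sumElim, mem_sections_sumElim]
  simp only [add_comm (∑ i, a i * _)]

theorem EffCartierDivisor.mult_preimage_eq_zero (Z : EffCartierDivisor Y) {x : X}
    (h : p x = genericPoint Y) : (Z.preimage p).mult x = 0 := by
  apply EffCartierDivisor.mult_eq_zero
  rw [EffCartierDivisor.mem_support_preimage, h]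
  exact EffCartierDivisor.genericPoint_notMem_support Z

include H hp in
/-- If a combination of linearly independent rational functions on `Y` with coefficients in
`ℂ(Y')` is a section on the product, its coefficients are sections on `Y'`. -/
theorem mem_sections_of_sum_mem {κ : Type} [Fintype κ] {k : κ → Y.functionField}
    {l : κ → Y'.functionField} (hk : LinearIndependent ℂ k) (hU : genericPoint Y ∈ U)
    (h : ∑ j, functionFieldMap p (k j) * functionFieldMap q (l j) ∈
      sections (productDivisors p q Z Z') (Sum.elim a b) (p ⁻¹' U ∩ q ⁻¹' U')) (j : κ) :
    l j ∈ sections Z' b U' := by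
  classical
  intro hj y' hyU' hy'
  obtain ⟨x, hpx, rfl, hx, hgauss⟩ := exists_point_over_isPrimeDivisorPoint (p := p) hp H hy'
  -- the coefficient with the smallest order at `y'`
  obtain ⟨i, hi, hmin⟩ := Finset.exists_min_image (Finset.univ.filter fun i => l i ≠ 0)
    (fun i => Scheme.ord (l i) (q x)) ⟨j, by simpa using hj⟩
  simp only [Finset.mem_filter, Finset.mem_univ, true_and] at hi hmin
  have hc : ∀ j, ∃ c, algebraMap (Y'.presheaf.stalk (q x)) Y'.functionField c = l j / l i := by
    intro j
    by_cases h0 : l j = 0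
    · exact ⟨0, by rw [h0, zero_div, map_zero]⟩
    · rw [← ord_nonneg_iff hy' (div_ne_zero h0 hi), div_eq_mul_inv, Scheme.ord_mul h0
        (inv_ne_zero hi), ord_inv hi]
      linarith [hmin j h0]
  choose c hc using hc
  obtain ⟨u, hu⟩ := hgauss κ k c hk ⟨i, by
    have h1 : c i = 1 := IsFractionRing.injective (Y'.presheaf.stalk (q x)) Y'.functionField
      (by rw [hc, map_one]; exact div_self hi)
    rw [h1]; exact isUnit_one⟩
  -- up to a unit at `x`, the sum equals the pull-back of `l i`
  have hF : ∑ j, functionFieldMap p (k j) * functionFieldMap q (l j) =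
      functionFieldMap q (l i) * algebraMap (X.presheaf.stalk x) X.functionField u := by
    rw [hu, Finset.mul_sum]
    refine Finset.sum_congr rfl fun j _ => ?_
    have h0 : functionFieldMap q (l i) ≠ 0 := (map_ne_zero _).mpr hi
    rw [hc, map_div₀, mul_left_comm, mul_div_cancel₀ _ h0]
  have hli : functionFieldMap q (l i) ≠ 0 := (map_ne_zero _).mpr hi
  have hu0 : algebraMap (X.presheaf.stalk x) X.functionField u ≠ 0 := by
    rw [Ne, map_eq_zero_iff _ (IsFractionRing.injective _ _)]
    exact u.ne_zero
  rw [hF, mem_sections_sumElim] at h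
  have h1 := h (mul_ne_zero hli hu0) x ⟨show p x ∈ U from hpx ▸ hU, hyU'⟩ hx
  rw [Scheme.ord_mul hli hu0, ord_unit hx, add_zero] at h1
  simp only [EffCartierDivisor.mult_preimage_eq_zero _ hpx, Nat.cast_zero, mul_zero,
    Finset.sum_const_zero, zero_add] at h1
  obtain ⟨n, m, hn, hm⟩ := exists_mul_eq_intCast b
  choose z hz0 hz using fun i => (Z' i).exists_span_eq (q x)
  have h2 := ord_pow_mul_prod (fun i => (Z' i).preimage q) hx
    (fun i => (Z' i).span_preimage q (hz i)) hli n m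
  rw [← map_pow_mul_prod] at h2
  have hn' : (0 : ℚ) < n := by positivity
  -- `h1` clears denominators to the statement that `l i ^ n * ∏ zᵢ ^ mᵢ` has no pole along `x`
  have h3 : 0 ≤ Scheme.ord (functionFieldMap q
      (l i ^ n * ∏ i, algebraMap _ Y'.functionField (z i) ^ m i)) x := by
    rw [h2, ← Int.cast_nonneg_iff (R := ℚ)]
    push_cast
    simp only [hm, mul_assoc, ← Finset.mul_sum, ← mul_add]
    positivity
  have h4 := ord_nonneg_of_ord_functionFieldMap_nonneg q hx hy' (mul_ne_zero (pow_ne_zero _ hi)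
    (Finset.prod_ne_zero_iff.mpr fun i _ => zpow_ne_zero _ (by simpa using hz0 i))) h3
  rw [ord_pow_mul_prod Z' hy' hz hi, ← Int.cast_nonneg_iff (R := ℚ)] at h4
  push_cast at h4
  simp only [hm, mul_assoc, ← Finset.mul_sum, ← mul_add] at h4
  have h5 : (Scheme.ord (l i) (q x) : ℚ) ≤ Scheme.ord (l j) (q x) := by exact_mod_cast hmin j hj
  linarith [nonneg_of_mul_nonneg_right h4 hn']

include H in
/-- A Künneth formula: sections on the product are sums of products of sections on the factors. -/
theorem exists_functionFieldProductMap_eq (hU : genericPoint Y ∈ U) (hU' : genericPoint Y' ∈ U')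
    {F : X.functionField}
    (hF : F ∈ sections (productDivisors p q Z Z') (Sum.elim a b) (p ⁻¹' U ∩ q ⁻¹' U')) :
    ∃ w : sections Z a U ⊗[ℂ] sections Z' b U', functionFieldProductMap p q hp hq
      (TensorProduct.map (sections Z a U).subtype (sections Z' b U').subtype w) = F := by
  obtain ⟨G, rfl⟩ : F ∈ (functionFieldProductMap p q hp hq).range := by
    refine mem_range_functionFieldProductMap hp hq H fun hF0 x hx hpx hqx => ?_
    have h1 := mem_sections_sumElim.mp hF hF0 x
      ⟨show p x ∈ U from hpx ▸ hU, show q x ∈ U' from hqx ▸ hU'⟩ hx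
    simpa only [EffCartierDivisor.mult_preimage_eq_zero _ hpx,
      EffCartierDivisor.mult_preimage_eq_zero _ hqx, Nat.cast_zero, mul_zero,
      Finset.sum_const_zero, add_zero, Int.cast_nonneg_iff] using h1
  change functionFieldProductMap p q hp hq G ∈ _ at hF
  -- the coefficients with respect to a basis of `ℂ(Y)` are sections on `Y'`
  obtain ⟨G', rfl⟩ : ∃ G' : Y.functionField ⊗[ℂ] sections Z' b U',
      TensorProduct.map LinearMap.id (sections Z' b U').subtype G' = G := by
    obtain ⟨κ, _, k, l, hk, rfl⟩ := exists_linearIndependent_left G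
    rw [map_sum] at hF
    simp only [functionFieldProductMap_tmul] at hF
    have hl := mem_sections_of_sum_mem H hp hk hU hF
    exact ⟨∑ j, k j ⊗ₜ ⟨l j, hl j⟩, by simp [map_sum]⟩
  -- the coefficients with respect to a basis of the sections on `Y'` are sections on `Y`
  obtain ⟨κ, _, k, l, hl, rfl⟩ := exists_linearIndependent_right G'
  simp only [map_sum, TensorProduct.map_tmul, functionFieldProductMap_tmul, LinearMap.id_apply,
    Submodule.subtype_apply, mul_comm (functionFieldMap p _)] at hF
  rw [sections_sumElim_swap, Set.inter_comm] at hF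
  have hk := mem_sections_of_sum_mem H.flip hq
    (hl.map' _ (Submodule.ker_subtype _)) hU' hF
  exact ⟨∑ j, ⟨k j, hk j⟩ ⊗ₜ l j, by simp [map_sum]⟩

end Sections

/-! ### Evaluations of a product of polyhedral divisors -/

section Cones
variable {N N' : Type} [AddCommGroup N] [AddCommGroup N'] {σ : PointedCone ℚ (NQ N)}
  {σ' : PointedCone ℚ (NQ N')} {w : MQ (N × N')}

theorem mem_dualCone_prodCone : w ∈ dualCone (prodCone σ σ') ↔
    w ∘ₗ inlQ N N' ∈ dualCone σ ∧ w ∘ₗ inrQ N N' ∈ dualCone σ' := by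
  simp only [mem_dualCone]
  constructor
  · intro h
    refine ⟨fun v hv => h _ ⟨?_, ?_⟩, fun v hv => h _ ⟨?_, ?_⟩⟩
    · simpa using hv
    · simp
    · simp
    · simpa using hv
  · rintro ⟨h, h'⟩ v ⟨hv, hv'⟩
    rw [← inlQ_add_inrQ v, map_add]
    exact add_nonneg (h _ hv) (h' _ hv')

theorem comp_inlQ_mem_core (hw : w ∈ core (dualCone (prodCone σ σ'))) :
    w ∘ₗ inlQ N N' ∈ core (dualCone σ) := by
  intro v
  obtain ⟨ε, hε, h⟩ := hw (v ∘ₗ fstQ N N')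
  refine ⟨ε, hε, ?_⟩
  convert (mem_dualCone_prodCone.mp h).1 using 1
  ext x
  simp

theorem comp_inrQ_mem_core (hw : w ∈ core (dualCone (prodCone σ σ'))) :
    w ∘ₗ inrQ N N' ∈ core (dualCone σ') := by
  intro v
  obtain ⟨ε, hε, h⟩ := hw (v ∘ₗ sndQ N N')
  refine ⟨ε, hε, ?_⟩
  convert (mem_dualCone_prodCone.mp h).2 using 1
  ext x
  simp

theorem core_subset {E : Type} [AddCommGroup E] [Module ℚ E] (C : PointedCone ℚ (Module.Dual ℚ E))
    {u : Module.Dual ℚ E} (h : u ∈ core C) : u ∈ C := by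
  obtain ⟨ε, -, h⟩ := h 0
  simpa using h

/-- Linear forms on a product are minimized in each factor separately. -/
theorem minOn_prodSet {Δ : Set (NQ N)} {Δ' : Set (NQ N')} {m m' : ℚ}
    (h : IsLeast ((w ∘ₗ inlQ N N') '' Δ) m) (h' : IsLeast ((w ∘ₗ inrQ N N') '' Δ') m') :
    minOn (prodSet Δ Δ') w = m + m' := by
  apply minOn_eq
  obtain ⟨⟨x, hx, rfl⟩, hm⟩ := h
  obtain ⟨⟨x', hx', rfl⟩, hm'⟩ := h'
  refine ⟨⟨inlQ N N' x + inrQ N N' x', by simpa [prodSet] using ⟨hx, hx'⟩, by simp⟩, ?_⟩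
  rintro _ ⟨v, hv, rfl⟩
  rw [← inlQ_add_inrQ v, map_add]
  exact add_le_add (hm ⟨_, hv.1, rfl⟩) (hm' ⟨_, hv.2, rfl⟩)

theorem isLeast_image_cone {E : Type} [AddCommGroup E] [Module ℚ E] {σ : PointedCone ℚ E}
    {u : Module.Dual ℚ E} (hu : u ∈ dualCone σ) : IsLeast (u '' (σ : Set E)) 0 := by
  refine ⟨⟨0, σ.zero_mem, map_zero u⟩, ?_⟩
  rintro _ ⟨v, hv, rfl⟩
  exact hu hv

variable (N N') in
theorem toMQ_comp_inlQ (w : MZ (N × N')) :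
    toMQ w ∘ₗ inlQ N N' = toMQ (w ∘ₗ LinearMap.inl ℤ N N') := by
  ext n
  simp [toMQ_tmul, inlQ]

variable (N N') in
theorem toMQ_comp_inrQ (w : MZ (N × N')) :
    toMQ w ∘ₗ inrQ N N' = toMQ (w ∘ₗ LinearMap.inr ℤ N N') := by
  ext n
  simp [toMQ_tmul, inrQ]

end Cones

namespace PolyhedralDivisor
variable {Y Y' : Scheme.{0}} [Y.Over SpecC] [Y'.Over SpecC]
  {N N' : Type} [AddCommGroup N] [AddCommGroup N']

omit [Y.Over SpecC] in
theorem genericPoint_mem_locus [IsIntegral Y] (D : PolyhedralDivisor Y N) :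
    genericPoint Y ∈ D.locus :=
  fun i _ => (D.divisor i).genericPoint_notMem_support

omit [Y.Over SpecC] in
theorem mem_locus_of_specializes [IsIntegral Y] (D : PolyhedralDivisor Y N) (y y' : Y)
    (hs : y' ⤳ y) (hy : y ∈ D.locus) : y' ∈ D.locus :=
  fun i hi h => hy i hi ((D.divisor i).mem_support_of_specializes hs h)

variable [IsVariety Y] [IsVariety Y'] (D : PolyhedralDivisor Y N) (D' : PolyhedralDivisor Y' N')

theorem prodSet_eq_empty {S : Set (NQ N)} {S' : Set (NQ N')} :
    prodSet S S' = ∅ ↔ S = ∅ ∨ S' = ∅ := by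
  constructor
  · intro h
    by_contra! hne
    obtain ⟨⟨x, hx⟩, ⟨x', hx'⟩⟩ := hne
    exact Set.eq_empty_iff_forall_notMem.mp h (inlQ N N' x + inrQ N N' x')
      (by simpa [prodSet] using ⟨hx, hx'⟩)
  · rintro (rfl | rfl) <;> simp [prodSet]

theorem locus_prod :
    (D.prod D').locus = prodC.fst Y Y' ⁻¹' D.locus ∩ prodC.snd Y Y' ⁻¹' D'.locus := by
  have hne : ∀ {N : Type} [AddCommGroup N] (σ : PointedCone ℚ (NQ N)), (σ : Set (NQ N)) ≠ ∅ :=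
    fun σ => Set.Nonempty.ne_empty ⟨0, σ.zero_mem⟩
  ext x
  simp only [locus, prod, Set.mem_ofPred_eq, Sum.forall, Sum.elim_inl, Sum.elim_inr,
    prodSet_eq_empty, hne, or_false, false_or, EffCartierDivisor.mem_support_preimage,
    Set.mem_inter_iff, Set.mem_preimage]

theorem eval_prod {w : MQ (N × N')} (hw : w ∈ dualCone (prodCone D.tail D'.tail)) :
    (D.prod D').eval w =
      Sum.elim (D.eval (w ∘ₗ inlQ N N')) (D'.eval (w ∘ₗ inrQ N N')) := by
  obtain ⟨h, h'⟩ := mem_dualCone_prodCone.mp hw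
  funext i
  rcases i with i | j
  · change minOn (prodSet (D.coeff i) D'.tail) w = minOn (D.coeff i) (w ∘ₗ inlQ N N')
    rcases D.coeff_spec i with hi | ⟨hi, ht⟩
    · rw [prodSet_eq_empty.mpr (Or.inl hi), hi, minOn_empty, minOn_empty]
    · rw [minOn_prodSet (hi.isLeast_minOn fun a ha => h (ht ▸ ha)) (isLeast_image_cone h'),
        add_zero]
  · change minOn (prodSet D.tail (D'.coeff j)) w = minOn (D'.coeff j) (w ∘ₗ inrQ N N')
    rcases D'.coeff_spec j with hi | ⟨hi, ht⟩
    · rw [prodSet_eq_empty.mpr (Or.inr hi), hi, minOn_empty, minOn_empty]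
    · rw [minOn_prodSet (isLeast_image_cone h) (hi.isLeast_minOn fun a ha => h' (ht ▸ ha)),
        zero_add]

end PolyhedralDivisor

/-! ### Graded pieces of a product -/

theorem prodC.snd_comp_over (Y Y' : Scheme.{0}) [Y.Over SpecC] [Y'.Over SpecC] :
    prodC.snd Y Y' ≫ Y' ↘ SpecC = prodC Y Y' ↘ SpecC :=
  pullback.condition.symm

theorem prodC.isPullback (Y Y' : Scheme.{0}) [Y.Over SpecC] [Y'.Over SpecC] :
    IsPullback (prodC.fst Y Y') (prodC.snd Y Y') (Y ↘ SpecC) (Y' ↘ SpecC) :=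
  IsPullback.of_hasPullback _ _

section
variable (Y Y' : Scheme.{0}) [Y.Over SpecC] [Y'.Over SpecC] [IsVariety Y] [IsVariety Y']

/-- The pull-back of rational functions from the first factor. -/
abbrev pullFst : Y.functionField →ₐ[ℂ] (prodC Y Y').functionField :=
  functionFieldAlgHom (prodC.fst Y Y') rfl

/-- The pull-back of rational functions from the second factor. -/
abbrev pullSnd : Y'.functionField →ₐ[ℂ] (prodC Y Y').functionField :=
  functionFieldAlgHom (prodC.snd Y Y') (prodC.snd_comp_over Y Y')

/-- The map `ℂ(Y) ⊗ ℂ(Y') → ℂ(Y × Y')`. -/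
abbrev pullProd : Y.functionField ⊗[ℂ] Y'.functionField →ₐ[ℂ] (prodC Y Y').functionField :=
  functionFieldProductMap (prodC.fst Y Y') (prodC.snd Y Y') rfl (prodC.snd_comp_over Y Y')

end

namespace PolyhedralDivisor
variable {Y Y' : Scheme.{0}} [Y.Over SpecC] [Y'.Over SpecC] [IsVariety Y] [IsVariety Y']
  {N N' : Type} [AddCommGroup N] [AddCommGroup N'] (D : PolyhedralDivisor Y N)
  (D' : PolyhedralDivisor Y' N')

theorem component_prod_of_mem {w : MZ (N × N')}
    (h : toMQ (w ∘ₗ LinearMap.inl ℤ N N') ∈ dualCone D.tail)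
    (h' : toMQ (w ∘ₗ LinearMap.inr ℤ N N') ∈ dualCone D'.tail) :
    (D.prod D').component w =
      sections (productDivisors (prodC.fst Y Y') (prodC.snd Y Y') D.divisor D'.divisor)
        (Sum.elim (D.eval (toMQ (w ∘ₗ LinearMap.inl ℤ N N')))
          (D'.eval (toMQ (w ∘ₗ LinearMap.inr ℤ N N'))))
        (prodC.fst Y Y' ⁻¹' D.locus ∩ prodC.snd Y Y' ⁻¹' D'.locus) := by
  have hw : toMQ w ∈ dualCone (prodCone D.tail D'.tail) := by
    rw [mem_dualCone_prodCone, toMQ_comp_inlQ, toMQ_comp_inrQ]; exact ⟨h, h'⟩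
  rw [component, if_pos (show toMQ w ∈ dualCone (D.prod D').tail from hw), eval_prod D D' hw,
    toMQ_comp_inlQ, toMQ_comp_inrQ, locus_prod]
  rfl

/-- The Künneth formula for the graded pieces. -/
theorem exists_pullProd_eq {w : MZ (N × N')} {F : (prodC Y Y').functionField}
    (hF : F ∈ (D.prod D').component w) :
    ∃ t : D.component (w ∘ₗ LinearMap.inl ℤ N N') ⊗[ℂ] D'.component (w ∘ₗ LinearMap.inr ℤ N N'),
      pullProd Y Y' (TensorProduct.map (D.component _).subtype (D'.component _).subtype t) = F := by
  by_cases h : toMQ (w ∘ₗ LinearMap.inl ℤ N N') ∈ dualCone D.tail ∧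
      toMQ (w ∘ₗ LinearMap.inr ℤ N N') ∈ dualCone D'.tail
  · rw [component_prod_of_mem D D' h.1 h.2] at hF
    obtain ⟨t, ht⟩ := exists_functionFieldProductMap_eq (prodC.isPullback Y Y') rfl
      (prodC.snd_comp_over Y Y') D.genericPoint_mem_locus D'.genericPoint_mem_locus hF
    have h1 : D.component (w ∘ₗ LinearMap.inl ℤ N N') = _ := if_pos h.1
    have h2 : D'.component (w ∘ₗ LinearMap.inr ℤ N N') = _ := if_pos h.2
    rw [h1, h2]
    exact ⟨t, ht⟩
  · have hw : toMQ w ∉ dualCone (D.prod D').tail := by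
      change toMQ w ∉ dualCone (prodCone D.tail D'.tail)
      rwa [mem_dualCone_prodCone, toMQ_comp_inlQ, toMQ_comp_inrQ]
    rw [component, if_neg hw, Submodule.mem_bot] at hF
    exact ⟨0, by rw [hF, map_zero, map_zero]⟩

end PolyhedralDivisor

section Normal
variable {X Y Y' : Scheme.{0}} [X.Over SpecC] [Y.Over SpecC] [Y'.Over SpecC] [IsVariety X]
  [IsVariety Y] [IsVariety Y'] {p : X ⟶ Y} {q : X ⟶ Y'} [Surjective p] [Surjective q]
  {ι ι' : Type} [Fintype ι] [Fintype ι'] {Z : ι → EffCartierDivisor Y}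
  {Z' : ι' → EffCartierDivisor Y'} {a : ι → ℚ} {b : ι' → ℚ} {U : Set Y} {U' : Set Y'}

theorem mul_mem_sections_product (hY : ∀ y : Y, IsIntegrallyClosed (Y.presheaf.stalk y))
    (hY' : ∀ y : Y', IsIntegrallyClosed (Y'.presheaf.stalk y))
    (hU : ∀ y y', y' ⤳ y → y ∈ U → y' ∈ U) (hU' : ∀ y y', y' ⤳ y → y ∈ U' → y' ∈ U')
    {f : Y.functionField} {f' : Y'.functionField} (hf : f ∈ sections Z a U)
    (hf' : f' ∈ sections Z' b U') : functionFieldMap p f * functionFieldMap q f' ∈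
      sections (productDivisors p q Z Z') (Sum.elim a b) (p ⁻¹' U ∩ q ⁻¹' U') := by
  rw [mem_sections_sumElim]
  intro h0 x hxU hx
  have hf0 := left_ne_zero_of_mul h0
  have hf0' := right_ne_zero_of_mul h0
  have h1 := functionFieldMap_mem_sections p hY hU hf hf0 x hxU.1 hx
  have h2 := functionFieldMap_mem_sections q hY' hU' hf' hf0' x hxU.2 hx
  rw [Scheme.ord_mul hf0 hf0']
  push_cast
  linarith

end Normal

namespace PolyhedralDivisor
variable {Y Y' : Scheme.{0}} [Y.Over SpecC] [Y'.Over SpecC] [IsNormalProjectiveVariety Y]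
  [IsNormalProjectiveVariety Y'] {N N' : Type} [AddCommGroup N] [AddCommGroup N']
  (D : PolyhedralDivisor Y N) (D' : PolyhedralDivisor Y' N')

theorem mul_mem_component_prod {u : MZ N} {u' : MZ N'} {f : Y.functionField}
    {f' : Y'.functionField} (hf : f ∈ D.component u) (hf' : f' ∈ D'.component u') :
    pullFst Y Y' f * pullSnd Y Y' f' ∈ (D.prod D').component (u.coprod u') := by
  by_cases h : toMQ u ∈ dualCone D.tail ∧ toMQ u' ∈ dualCone D'.tail
  · rw [component, if_pos h.1] at hf
    rw [component, if_pos h.2] at hf'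
    rw [component_prod_of_mem D D' (by rw [LinearMap.coprod_inl]; exact h.1)
      (by rw [LinearMap.coprod_inr]; exact h.2), LinearMap.coprod_inl, LinearMap.coprod_inr]
    exact mul_mem_sections_product IsNormalProjectiveVariety.normal
      IsNormalProjectiveVariety.normal D.mem_locus_of_specializes D'.mem_locus_of_specializes hf hf'
  · have h0 : pullFst Y Y' f * pullSnd Y Y' f' = 0 := by
      rcases not_and_or.mp h with h | h
      · rw [component, if_neg h, Submodule.mem_bot] at hf
        rw [hf, map_zero, zero_mul]
      · rw [component, if_neg h, Submodule.mem_bot] at hf'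
        rw [hf', map_zero, mul_zero]
    rw [h0]
    exact Submodule.zero_mem _

end PolyhedralDivisor

/-! ### The graded ring of a product -/

/-- The map of group algebras `∑ fᵤ χ^u ↦ ∑ φ(fᵤ) χ^{g(u)}`. -/
def groupAlgebraMap {F E M M' : Type} [CommRing F] [CommRing E] [Algebra ℂ F] [Algebra ℂ E]
    [AddCommGroup M] [AddCommGroup M'] (φ : F →ₐ[ℂ] E) (g : M →+ M') :
    AddMonoidAlgebra F M →ₐ[ℂ] AddMonoidAlgebra E M' :=
  (AddMonoidAlgebra.mapDomainAlgHom ℂ E g).comp (AddMonoidAlgebra.mapAlgHom M φ)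

theorem groupAlgebraMap_single {F E M M' : Type} [CommRing F] [CommRing E] [Algebra ℂ F]
    [Algebra ℂ E] [AddCommGroup M] [AddCommGroup M'] (φ : F →ₐ[ℂ] E) (g : M →+ M') (u : M) (f : F) :
    groupAlgebraMap φ g (AddMonoidAlgebra.single u f) = AddMonoidAlgebra.single (g u) (φ f) := by
  simp [groupAlgebraMap]

namespace PolyhedralDivisor
section
variable {Y : Scheme.{0}} [Y.Over SpecC] [IsIntegral Y] [IsLocallyNoetherian Y] {N : Type}
  [AddCommGroup N] (D : PolyhedralDivisor Y N)

theorem proj_eq_zero {a : D.globalSections} {u : MZ N} (h : u ∉ a.1.coeff.support) :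
    D.proj u a = 0 :=
  Subtype.ext (Finsupp.notMem_support_iff.mp h)

end

section
variable {Y Y' : Scheme.{0}} [Y.Over SpecC] [Y'.Over SpecC] [IsNormalProjectiveVariety Y]
  [IsNormalProjectiveVariety Y'] {N N' : Type} [AddCommGroup N] [AddCommGroup N']
  (D : PolyhedralDivisor Y N) (D' : PolyhedralDivisor Y' N')

theorem pullFst_mem_component_prod {u : MZ N} {f : Y.functionField} (hf : f ∈ D.component u) :
    pullFst Y Y' f ∈ (D.prod D').component ((LinearMap.fst ℤ N N').dualMap u) := by
  have h := mul_mem_component_prod D D' hf D'.one_mem_component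
  rw [map_one, mul_one] at h
  convert h using 2
  ext <;> simp

theorem pullSnd_mem_component_prod {u : MZ N'} {f : Y'.functionField} (hf : f ∈ D'.component u) :
    pullSnd Y Y' f ∈ (D.prod D').component ((LinearMap.snd ℤ N N').dualMap u) := by
  have h := mul_mem_component_prod D D' D.one_mem_component hf
  rw [map_one, one_mul] at h
  convert h using 2
  ext <;> simp

/-- The map of graded rings given by pull-back from the first factor. -/
def fstHom : D.globalSections →ₐ[ℂ] (D.prod D').globalSections :=
  ((groupAlgebraMap (pullFst Y Y') (LinearMap.fst ℤ N N').dualMap.toAddMonoidHom).comp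
    D.globalSections.val).codRestrict _ fun a => by
      rw [← D.sum_homogeneous a, map_sum]
      refine Subalgebra.sum_mem _ fun u _ => ?_
      have h : ((groupAlgebraMap (pullFst Y Y') (LinearMap.fst ℤ N N').dualMap.toAddMonoidHom).comp
          D.globalSections.val) (D.homogeneous u (D.proj u a)) =
          (D.prod D').homogeneous _ ⟨_, pullFst_mem_component_prod D D' (D.proj u a).2⟩ :=
        groupAlgebraMap_single _ _ _ _
      rw [h]
      exact Subtype.coe_prop _

/-- The map of graded rings given by pull-back from the second factor. -/
def sndHom : D'.globalSections →ₐ[ℂ] (D.prod D').globalSections :=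
  ((groupAlgebraMap (pullSnd Y Y') (LinearMap.snd ℤ N N').dualMap.toAddMonoidHom).comp
    D'.globalSections.val).codRestrict _ fun a => by
      rw [← D'.sum_homogeneous a, map_sum]
      refine Subalgebra.sum_mem _ fun u _ => ?_
      have h : ((groupAlgebraMap (pullSnd Y Y') (LinearMap.snd ℤ N N').dualMap.toAddMonoidHom).comp
          D'.globalSections.val) (D'.homogeneous u (D'.proj u a)) =
          (D.prod D').homogeneous _ ⟨_, pullSnd_mem_component_prod D D' (D'.proj u a).2⟩ :=
        groupAlgebraMap_single _ _ _ _
      rw [h]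
      exact Subtype.coe_prop _

theorem fstHom_homogeneous (u : MZ N) (f : D.component u) :
    fstHom D D' (D.homogeneous u f) =
      (D.prod D').homogeneous ((LinearMap.fst ℤ N N').dualMap u)
        ⟨pullFst Y Y' f, pullFst_mem_component_prod D D' f.2⟩ :=
  Subtype.ext (groupAlgebraMap_single _ _ _ _)

theorem sndHom_homogeneous (u : MZ N') (f : D'.component u) :
    sndHom D D' (D'.homogeneous u f) =
      (D.prod D').homogeneous ((LinearMap.snd ℤ N N').dualMap u)
        ⟨pullSnd Y Y' f, pullSnd_mem_component_prod D D' f.2⟩ :=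
  Subtype.ext (groupAlgebraMap_single _ _ _ _)

/-- The map `f χ^u ⊗ f' χ^u' ↦ f f' χ^(u, u')` from the tensor product of the graded rings of two
polyhedral divisors to the graded ring of their product. -/
def tensorHom : D.globalSections ⊗[ℂ] D'.globalSections →ₐ[ℂ] (D.prod D').globalSections :=
  Algebra.TensorProduct.productMap (fstHom D D') (sndHom D D')

theorem tensorHom_map_homogeneous (u : MZ N) (u' : MZ N')
    (t : D.component u ⊗[ℂ] D'.component u') :
    (tensorHom D D' (TensorProduct.map (D.homogeneous u) (D'.homogeneous u') t)).1 =
      AddMonoidAlgebra.single (u.coprod u') (pullProd Y Y'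
        (TensorProduct.map (D.component u).subtype (D'.component u').subtype t)) := by
  induction t with
  | zero => simp
  | add s t hs ht =>
    simp only [map_add, AddMonoidAlgebra.single_add, ← hs, ← ht]
    rfl
  | tmul f f' =>
    rw [TensorProduct.map_tmul, tensorHom, Algebra.TensorProduct.productMap_apply_tmul,
      fstHom_homogeneous, sndHom_homogeneous, TensorProduct.map_tmul]
    refine (AddMonoidAlgebra.single_mul_single _ _ _ _).trans (Eq.trans ?_
      (congrArg (AddMonoidAlgebra.single (u.coprod u'))
        (functionFieldProductMap_tmul _ _ _ _).symm))
    congr 1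

theorem tensorHom_surjective : Function.Surjective (tensorHom D D') := by
  intro a
  rw [← AlgHom.mem_range, ← (D.prod D').sum_homogeneous a]
  refine Subalgebra.sum_mem _ fun w _ => ?_
  obtain ⟨t, ht⟩ := exists_pullProd_eq D D' ((D.prod D').proj w a).2
  refine ⟨TensorProduct.map (D.homogeneous _) (D'.homogeneous _) t, Subtype.ext ?_⟩
  refine (tensorHom_map_homogeneous D D' _ _ t).trans ?_
  rw [ht, LinearMap.coprod_comp_inl_inr]
  rfl

/-- A tensor is the sum of its bihomogeneous parts. -/
theorem exists_sum_homogeneous_eq (x : D.globalSections ⊗[ℂ] D'.globalSections) :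
    ∃ S : Finset (MZ N × MZ N'), ∀ T, S ⊆ T →
      ∑ v ∈ T, TensorProduct.map (D.homogeneous v.1) (D'.homogeneous v.2)
        (TensorProduct.map (D.proj v.1) (D'.proj v.2) x) = x := by
  classical
  induction x with
  | zero => exact ⟨∅, fun T _ => by simp⟩
  | add x y hx hy =>
    obtain ⟨S, hS⟩ := hx
    obtain ⟨S', hS'⟩ := hy
    refine ⟨S ∪ S', fun T hT => ?_⟩
    simp only [map_add, Finset.sum_add_distrib]
    rw [hS T (Finset.union_subset_left hT), hS' T (Finset.union_subset_right hT)]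
  | tmul a b =>
    refine ⟨a.1.coeff.support ×ˢ b.1.coeff.support, fun T hT => ?_⟩
    rw [← Finset.sum_subset hT]
    · simp only [TensorProduct.map_tmul]
      rw [Finset.sum_product]
      conv_rhs => rw [← D.sum_homogeneous a, ← D'.sum_homogeneous b, TensorProduct.sum_tmul]
      simp only [TensorProduct.tmul_sum]
    · intro v _ hv
      rw [TensorProduct.map_tmul]
      rw [Finset.mem_product, not_and_or] at hv
      rcases hv with hv | hv
      · rw [D.proj_eq_zero hv, TensorProduct.zero_tmul, map_zero]
      · rw [D'.proj_eq_zero hv, TensorProduct.tmul_zero, map_zero]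

theorem tensorHom_injective : Function.Injective (tensorHom D D') := by
  classical
  rw [injective_iff_map_eq_zero]
  intro x hx
  obtain ⟨S, hS⟩ := exists_sum_homogeneous_eq D D' x
  have hsum := hS S subset_rfl
  rw [← hsum]
  refine Finset.sum_eq_zero fun v hv => ?_
  have h1 : (tensorHom D D' x).1.coeff (v.1.coprod v.2) = 0 := by rw [hx]; rfl
  rw [← hsum, map_sum, AddSubmonoidClass.coe_finsetSum, AddMonoidAlgebra.coeff_sum,
    Finsupp.finsetSum_apply, Finset.sum_eq_single v] at h1
  · rw [tensorHom_map_homogeneous, AddMonoidAlgebra.coeff_single, Finsupp.single_eq_same] at h1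
    have h2 := (map_eq_zero_iff _ (functionFieldProductMap_injective _ _
      (prodC.isPullback Y Y'))).mp h1
    have h3 : Function.Injective
        (TensorProduct.map (D.component v.1).subtype (D'.component v.2).subtype) :=
      TensorProduct.map_injective_of_flat_flat _ _ (Submodule.subtype_injective _)
        (Submodule.subtype_injective _)
    rw [(map_eq_zero_iff _ h3).mp h2, map_zero]
  · intro v' _ hne
    rw [tensorHom_map_homogeneous, AddMonoidAlgebra.coeff_single, Finsupp.single_apply,
      if_neg fun h => hne (Prod.ext ?_ ?_)]
    · rw [← LinearMap.coprod_inl v'.1 v'.2, h, LinearMap.coprod_inl]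
    · rw [← LinearMap.coprod_inr v'.1 v'.2, h, LinearMap.coprod_inr]
  · exact fun h => absurd hv h

/-- The graded ring of a product is the tensor product of the graded rings. -/
def tensorEquiv : D.globalSections ⊗[ℂ] D'.globalSections ≃ₐ[ℂ] (D.prod D').globalSections :=
  AlgEquiv.ofBijective (tensorHom D D') ⟨tensorHom_injective D D', tensorHom_surjective D D'⟩

theorem coaction_fstHom (a : D.globalSections) : (D.prod D').coaction (fstHom D D' a) =
    Algebra.TensorProduct.map (AddMonoidAlgebra.mapDomainAlgHom ℂ ℂ
      (LinearMap.fst ℤ N N').dualMap.toAddMonoidHom) (fstHom D D') (D.coaction a) := by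
  rw [← D.sum_homogeneous a]
  simp only [map_sum]
  refine Finset.sum_congr rfl fun u _ => ?_
  rw [fstHom_homogeneous]
  refine ((D.prod D').coactionLinear_homogeneous _ _).trans ?_
  refine Eq.trans ?_ (congrArg _ (D.coactionLinear_homogeneous _ _).symm)
  rw [Algebra.TensorProduct.map_tmul, fstHom_homogeneous]
  congr 1
  simp

theorem coaction_sndHom (a : D'.globalSections) : (D.prod D').coaction (sndHom D D' a) =
    Algebra.TensorProduct.map (AddMonoidAlgebra.mapDomainAlgHom ℂ ℂ
      (LinearMap.snd ℤ N N').dualMap.toAddMonoidHom) (sndHom D D') (D'.coaction a) := by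
  rw [← D'.sum_homogeneous a]
  simp only [map_sum]
  refine Finset.sum_congr rfl fun u _ => ?_
  rw [sndHom_homogeneous]
  refine ((D.prod D').coactionLinear_homogeneous _ _).trans ?_
  refine Eq.trans ?_ (congrArg _ (D'.coactionLinear_homogeneous _ _).symm)
  rw [Algebra.TensorProduct.map_tmul, sndHom_homogeneous]
  congr 1
  simp

end
end PolyhedralDivisor

/-! ### The equivariant isomorphism -/

/-- The fibre product of morphisms of affine schemes is given by the tensor product of the maps of
rings. -/
theorem pullback_map_pullbackSpecIso_hom {A B A' B' : Type} [CommRing A] [CommRing B] [CommRing A']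
    [CommRing B'] [Algebra ℂ A] [Algebra ℂ B] [Algebra ℂ A'] [Algebra ℂ B'] (f : A →ₐ[ℂ] A')
    (g : B →ₐ[ℂ] B')
    (hf : Spec.map (CommRingCat.ofHom (algebraMap ℂ A')) ≫ 𝟙 SpecC =
      Spec.map (CommRingCat.ofHom f.toRingHom) ≫ Spec.map (CommRingCat.ofHom (algebraMap ℂ A)))
    (hg : Spec.map (CommRingCat.ofHom (algebraMap ℂ B')) ≫ 𝟙 SpecC =
      Spec.map (CommRingCat.ofHom g.toRingHom) ≫ Spec.map (CommRingCat.ofHom (algebraMap ℂ B))) :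
    pullback.map _ _ _ _ (Spec.map (CommRingCat.ofHom f.toRingHom))
      (Spec.map (CommRingCat.ofHom g.toRingHom)) (𝟙 SpecC) hf hg ≫ (pullbackSpecIso ℂ A B).hom =
    (pullbackSpecIso ℂ A' B').hom ≫
      Spec.map (CommRingCat.ofHom (Algebra.TensorProduct.map f g).toRingHom) := by
  rw [← Iso.eq_comp_inv]
  apply pullback.hom_ext
  · rw [pullback.lift_fst, Category.assoc, Category.assoc, pullbackSpecIso_inv_fst,
      ← Spec.map_comp, ← pullbackSpecIso_hom_fst, Category.assoc, ← Spec.map_comp]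
    congr 2
    ext a
    simp
  · rw [pullback.lift_snd, Category.assoc, Category.assoc, pullbackSpecIso_inv_snd,
      ← Spec.map_comp, ← pullbackSpecIso_hom_snd, Category.assoc, ← Spec.map_comp]
    congr 2
    ext a
    simp

namespace PolyhedralDivisor
variable {Y Y' : Scheme.{0}} [Y.Over SpecC] [Y'.Over SpecC] [IsNormalProjectiveVariety Y]
  [IsNormalProjectiveVariety Y'] {N N' : Type} [AddCommGroup N] [AddCommGroup N']
  (D : PolyhedralDivisor Y N) (D' : PolyhedralDivisor Y' N')

/-- The isomorphism `TV(D × D') ≅ TV(D) × TV(D')`. -/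
def tvProdIso : (D.prod D').TV ≅ D.prodTV D' :=
  Scheme.Spec.mapIso (tensorEquiv D D').toRingEquiv.toCommRingCatIso.op ≪≫
    (pullbackSpecIso ℂ D.globalSections D'.globalSections).symm

theorem tvProdIso_hom_fst : (tvProdIso D D').hom ≫ pullback.fst _ _ =
    Spec.map (CommRingCat.ofHom (fstHom D D').toRingHom) := by
  change (Spec.map (CommRingCat.ofHom (tensorHom D D').toRingHom) ≫ (pullbackSpecIso ℂ _ _).inv) ≫
    pullback.fst _ _ = _
  rw [Category.assoc, pullbackSpecIso_inv_fst, ← Spec.map_comp]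
  congr 1
  ext a
  simp [tensorHom]

theorem tvProdIso_hom_snd : (tvProdIso D D').hom ≫ pullback.snd _ _ =
    Spec.map (CommRingCat.ofHom (sndHom D D').toRingHom) := by
  change (Spec.map (CommRingCat.ofHom (tensorHom D D').toRingHom) ≫ (pullbackSpecIso ℂ _ _).inv) ≫
    pullback.snd _ _ = _
  rw [Category.assoc, pullbackSpecIso_inv_snd, ← Spec.map_comp]
  congr 1
  ext a
  simp [tensorHom]

theorem tvProdIso_hom_toSpecC :
    (tvProdIso D D').hom ≫ D.prodTVToSpecC D' = (D.prod D').tvToSpecC := by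
  rw [← Category.assoc, tvProdIso_hom_fst, ← Spec.map_comp, ← CommRingCat.ofHom_comp]
  congr 2
  exact (fstHom D D').comp_algebraMap

/-- The projections of `TV(D × D')` to the factors are equivariant. -/
theorem act_fstHom (h) (h') :
    (D.prod D').act ≫ Spec.map (CommRingCat.ofHom (fstHom D D').toRingHom) = pullback.map _ _ _ _ (torusMap (LinearMap.fst ℤ N N'))
      (Spec.map (CommRingCat.ofHom (fstHom D D').toRingHom)) (𝟙 SpecC) h h' ≫ D.act := by
  rw [act, act, Category.assoc, ← Spec.map_comp, ← Category.assoc]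
  refine Eq.trans ?_ (congrArg (· ≫ _) (pullback_map_pullbackSpecIso_hom
    (AddMonoidAlgebra.mapDomainAlgHom ℂ ℂ (LinearMap.fst ℤ N N').dualMap.toAddMonoidHom)
    (fstHom D D') h h').symm)
  rw [Category.assoc, ← Spec.map_comp]
  congr 2
  ext a
  exact coaction_fstHom D D' a

theorem act_sndHom (h) (h') :
    (D.prod D').act ≫ Spec.map (CommRingCat.ofHom (sndHom D D').toRingHom) = pullback.map _ _ _ _ (torusMap (LinearMap.snd ℤ N N'))
      (Spec.map (CommRingCat.ofHom (sndHom D D').toRingHom)) (𝟙 SpecC) h h' ≫ D'.act := by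
  rw [act, act, Category.assoc, ← Spec.map_comp, ← Category.assoc]
  refine Eq.trans ?_ (congrArg (· ≫ _) (pullback_map_pullbackSpecIso_hom
    (AddMonoidAlgebra.mapDomainAlgHom ℂ ℂ (LinearMap.snd ℤ N N').dualMap.toAddMonoidHom)
    (sndHom D D') h h').symm)
  rw [Category.assoc, ← Spec.map_comp]
  congr 2
  ext a
  exact coaction_sndHom D D' a

/-- The isomorphism is equivariant, since its components are. -/
theorem act_tvProdIso_hom (h) (h') : (D.prod D').act ≫ (tvProdIso D D').hom =
    pullback.map _ _ _ _ (𝟙 (torus (N × N'))) (tvProdIso D D').hom (𝟙 SpecC) h h' ≫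
      D.prodAct D' := by
  apply pullback.hom_ext
  · rw [Category.assoc, Category.assoc, tvProdIso_hom_fst, prodAct, pullback.lift_fst,
      ← Category.assoc, pullback.map_comp, act_fstHom]
    · congr 2
      rw [tvProdIso_hom_fst]
    · exact (Category.comp_id _).trans (torusMap_toSpecC _).symm
    · exact h'.trans (by rw [← tvProdIso_hom_fst, Category.assoc])
  · rw [Category.assoc, Category.assoc, tvProdIso_hom_snd, prodAct, pullback.lift_snd,
      ← Category.assoc, pullback.map_comp, act_sndHom]
    · congr 2
      rw [tvProdIso_hom_snd]
    · exact (Category.comp_id _).trans (torusMap_toSpecC _).symm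
    · exact h'.trans (by rw [← tvProdIso_hom_snd, Category.assoc, ← pullback.condition])

end PolyhedralDivisor

/-! ### Semiampleness and bigness of a product -/

section Nonvanishing
variable {Y : Scheme.{0}} [Y.Over SpecC] [IsIntegral Y] [IsLocallyNoetherian Y] {ι : Type}
  [Fintype ι] {Z : ι → EffCartierDivisor Y} {U : Set Y} {f : Y.functionField}

theorem pow_mem_sections {q : ι → ℚ} (hf : f ∈ sections Z q U) {n : ℕ} (hn : n ≠ 0) :
    f ^ n ∈ sections Z (fun i => n * q i) U := by
  intro hfn y hyU hy
  have hf0 : f ≠ 0 := fun h => hfn (by rw [h, zero_pow hn])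
  have h1 : (0 : ℚ) ≤ n * (Scheme.ord f y + ∑ i, q i * (Z i).mult y) :=
    mul_nonneg n.cast_nonneg (hf hf0 y hyU hy)
  rw [ord_pow hf0]
  push_cast
  simpa only [mul_add, Finset.mul_sum, mul_assoc] using h1

omit [Y.Over SpecC] [IsLocallyNoetherian Y] in
theorem exists_unit_mul_prod {y : Y} (z z' : ι → Y.presheaf.stalk y)
    (h : ∀ i, Ideal.span {z i} = Ideal.span {z' i}) (m : ι → ℤ) :
    ∃ w : (Y.presheaf.stalk y)ˣ, ∏ i, algebraMap _ Y.functionField (z' i) ^ m i =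
      algebraMap _ Y.functionField (w : Y.presheaf.stalk y) *
        ∏ i, algebraMap _ Y.functionField (z i) ^ m i := by
  choose v hv using fun i => Ideal.span_singleton_eq_span_singleton.mp (h i)
  refine ⟨∏ i, v i ^ m i, ?_⟩
  have h1 : algebraMap _ Y.functionField ((∏ i, v i ^ m i : (Y.presheaf.stalk y)ˣ) :
      Y.presheaf.stalk y) = ∏ i, algebraMap _ Y.functionField (v i : Y.presheaf.stalk y) ^ m i := by
    change ((Units.map (algebraMap (Y.presheaf.stalk y) Y.functionField).toMonoidHom
      (∏ i, v i ^ m i) : Y.functionFieldˣ) : Y.functionField) = _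
    simp
  rw [h1, ← Finset.prod_mul_distrib]
  refine Finset.prod_congr rfl fun i _ => ?_
  rw [← hv i, map_mul, mul_zpow, mul_comm]

omit [Y.Over SpecC] [IsLocallyNoetherian Y] in
/-- Non-vanishing of a section at a point does not depend on the choice of local equations. -/
theorem mem_nonvanishing_iff {m : ι → ℤ} {y : Y} {z : ι → Y.presheaf.stalk y}
    (hz : ∀ i, Ideal.span {z i} = (Z i).ideal y) {r : Y.presheaf.stalk y}
    (hr : algebraMap _ Y.functionField r =
      f * ∏ i, algebraMap _ Y.functionField (z i) ^ m i) :
    y ∈ nonvanishing Z m U f ↔ y ∈ U ∧ IsUnit r := by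
  refine and_congr_right fun _ => ⟨?_, fun h => ⟨z, hz, h.unit, hr.symm⟩⟩
  rintro ⟨z', hz', w, hw⟩
  obtain ⟨v, hv⟩ := exists_unit_mul_prod z z' (fun i => (hz i).trans (hz' i).symm) m
  have h1 : (v : Y.presheaf.stalk y) * r = w := by
    apply IsFractionRing.injective (Y.presheaf.stalk y) Y.functionField
    rw [map_mul, hr, ← hw, hv]
    ring
  exact isUnit_of_mul_isUnit_right (h1 ▸ w.isUnit)

end Nonvanishing

section Product
variable {X Y Y' : Scheme.{0}} [X.Over SpecC] [Y.Over SpecC] [Y'.Over SpecC] [IsVariety X]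
  [IsVariety Y] [IsVariety Y'] {p : X ⟶ Y} {q : X ⟶ Y'} [Surjective p] [Surjective q]
  {ι ι' : Type} [Fintype ι] [Fintype ι'] {Z : ι → EffCartierDivisor Y}
  {Z' : ι' → EffCartierDivisor Y'} {m : ι → ℤ} {m' : ι' → ℤ} {U : Set Y} {U' : Set Y'}
  (hY : ∀ y : Y, IsIntegrallyClosed (Y.presheaf.stalk y))
  (hY' : ∀ y : Y', IsIntegrallyClosed (Y'.presheaf.stalk y))
  (hU : ∀ y y', y' ⤳ y → y ∈ U → y' ∈ U) (hU' : ∀ y y', y' ⤳ y → y ∈ U' → y' ∈ U')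
  {f : Y.functionField} {f' : Y'.functionField} {n n' : ℕ}

include hY hY' hU hU' in
/-- The section `f ^ n' f' ^ n` on the product vanishes where `f` or `f'` does: both are regular
sections of invertible sheaves by normality, and maps of stalks are local. -/
theorem nonvanishing_product (hn : n ≠ 0) (hn' : n' ≠ 0)
    (hf : f ∈ sections Z (fun i => (m i : ℚ)) U) (hf' : f' ∈ sections Z' (fun i => (m' i : ℚ)) U') :
    nonvanishing (productDivisors p q Z Z')
      (Sum.elim (fun i => n' * m i) (fun j => n * m' j)) (p ⁻¹' U ∩ q ⁻¹' U')
      (functionFieldMap p (f ^ n') * functionFieldMap q (f' ^ n)) =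
    p ⁻¹' nonvanishing Z m U f ∩ q ⁻¹' nonvanishing Z' m' U' f' := by
  ext x
  by_cases hx : x ∈ p ⁻¹' U ∩ q ⁻¹' U'
  swap
  · exact iff_of_false (fun h => hx h.1) fun h => hx ⟨h.1.1, h.2.1⟩
  choose z _ hz using fun i => (Z i).exists_span_eq (p x)
  choose z' _ hz' using fun i => (Z' i).exists_span_eq (q x)
  have := hY (p x)
  have := hY' (q x)
  obtain ⟨r, hr⟩ := pow_mul_prod_mem_range (n := 1) (m := m) hf one_ne_zero (by simp)
    (fun y' hs => hU _ y' hs hx.1) hz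
  obtain ⟨r', hr'⟩ := pow_mul_prod_mem_range (n := 1) (m := m') hf' one_ne_zero (by simp)
    (fun y' hs => hU' _ y' hs hx.2) hz'
  rw [pow_one] at hr hr'
  -- in terms of the local functions `r` and `r'`, the section of the product is `r ^ n' * r' ^ n`
  have key := mem_nonvanishing_iff (Z := productDivisors p q Z Z')
    (m := Sum.elim (fun i => n' * m i) (fun j => n * m' j)) (U := p ⁻¹' U ∩ q ⁻¹' U')
    (f := functionFieldMap p (f ^ n') * functionFieldMap q (f' ^ n))
    (z := Sum.elim (fun i => p.stalkMap x (z i)) (fun j => q.stalkMap x (z' j)))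
    (r := p.stalkMap x r ^ n' * q.stalkMap x r' ^ n)
    (by rintro (i | j)
        · exact (Z i).span_preimage p (hz i)
        · exact (Z' j).span_preimage q (hz' j))
    (by
      have h1 := map_pow_mul_prod p z f 1 m
      have h2 := map_pow_mul_prod q z' f' 1 m'
      rw [pow_one, pow_one, ← hr, functionFieldMap_algebraMap] at h1
      rw [pow_one, pow_one, ← hr', functionFieldMap_algebraMap] at h2
      rw [map_mul, map_pow, map_pow, h1, h2, Fintype.prod_sum_type]
      simp only [Sum.elim_inl, Sum.elim_inr, map_pow, mul_pow, ← Finset.prod_pow, mul_comm (n : ℤ),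
        mul_comm (n' : ℤ), zpow_mul, zpow_natCast]
      ring)
  rw [key]
  change _ ↔ p x ∈ nonvanishing Z m U f ∧ q x ∈ nonvanishing Z' m' U' f'
  rw [mem_nonvanishing_iff hz hr, mem_nonvanishing_iff hz' hr', IsUnit.mul_iff, isUnit_pow_iff hn, isUnit_pow_iff hn']
  have h1 : IsUnit (p.stalkMap x r) ↔ IsUnit r := isUnit_map_iff (p.stalkMap x).hom r
  have h2 : IsUnit (q.stalkMap x r') ↔ IsUnit r' := isUnit_map_iff (q.stalkMap x).hom r'
  rw [h1, h2]
  have hx1 : p x ∈ U := hx.1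
  have hx2 : q x ∈ U' := hx.2
  tauto

include hY hY' hU hU' in
theorem mul_pow_mem_sections_product (hn : n ≠ 0) (hn' : n' ≠ 0)
    (hf : f ∈ sections Z (fun i => (m i : ℚ)) U) (hf' : f' ∈ sections Z' (fun i => (m' i : ℚ)) U') :
    functionFieldMap p (f ^ n') * functionFieldMap q (f' ^ n) ∈
      sections (productDivisors p q Z Z')
        (fun i => ((Sum.elim (fun i => n' * m i) (fun j => n * m' j) i : ℤ) : ℚ))
        (p ⁻¹' U ∩ q ⁻¹' U') := by
  have h : (fun i => ((Sum.elim (fun i => n' * m i) (fun j => n * m' j) i : ℤ) : ℚ)) =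
      Sum.elim (fun i => (n' : ℚ) * m i) (fun j => (n : ℚ) * m' j) := by
    funext i
    rcases i with i | j <;> simp
  rw [h]
  exact mul_mem_sections_product hY hY' hU hU' (pow_mem_sections hf hn') (pow_mem_sections hf' hn)

variable {a : ι → ℚ} {b : ι' → ℚ}

include hY hY' hU hU' in
theorem IsSemiample.product (h : IsSemiample Z a U) (h' : IsSemiample Z' b U') :
    IsSemiample (productDivisors p q Z Z') (Sum.elim a b) (p ⁻¹' U ∩ q ⁻¹' U') := by
  obtain ⟨n, m, hn, hm, hf⟩ := h
  obtain ⟨n', m', hn', hm', hf'⟩ := h'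
  refine ⟨n * n', Sum.elim (fun i => n' * m i) (fun j => n * m' j), Nat.mul_pos hn hn', ?_,
    fun x hx => ?_⟩
  · rintro (i | j)
    · simp [hm]; ring
    · simp [hm']; ring
  · obtain ⟨f, hf, hfx⟩ := hf (p x) hx.1
    obtain ⟨f', hf', hfx'⟩ := hf' (q x) hx.2
    refine ⟨_, mul_pow_mem_sections_product hY hY' hU hU' hn.ne' hn'.ne' hf hf', ?_⟩
    rw [nonvanishing_product hY hY' hU hU' hn.ne' hn'.ne' hf hf']
    exact ⟨hfx, hfx'⟩

include hY hY' hU hU' in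
theorem IsBig.product (H : IsPullback p q (Y ↘ SpecC) (Y' ↘ SpecC)) (h : IsBig Z a U)
    (h' : IsBig Z' b U') :
    IsBig (productDivisors p q Z Z') (Sum.elim a b) (p ⁻¹' U ∩ q ⁻¹' U') := by
  obtain ⟨n, m, hn, hm, f, hf, V, hV, hVf, y, hy⟩ := h
  obtain ⟨n', m', hn', hm', f', hf', V', hV', hVf', y', hy'⟩ := h'
  refine ⟨n * n', Sum.elim (fun i => n' * m i) (fun j => n * m' j), Nat.mul_pos hn hn', ?_,
    _, mul_pow_mem_sections_product hY hY' hU hU' hn.ne' hn'.ne' hf hf', p ⁻¹ᵁ V ⊓ q ⁻¹ᵁ V',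
    isAffineOpen_of_isPullback H rfl hV hV', ?_, genericPoint X, ?_, ?_⟩
  · rintro (i | j)
    · simp [hm]; ring
    · simp [hm']; ring
  · rw [nonvanishing_product hY hY' hU hU' hn.ne' hn'.ne' hf hf', ← hVf, ← hVf']
    rfl
  · exact (show p _ ∈ V from (map_genericPoint p).symm ▸
      ((genericPoint_spec Y).mem_open_set_iff V.isOpen).mpr ⟨y, trivial, hy⟩)
  · exact (show q _ ∈ V' from (map_genericPoint q).symm ▸
      ((genericPoint_spec Y').mem_open_set_iff V'.isOpen).mpr ⟨y', trivial, hy'⟩)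

end Product

theorem PolyhedralDivisor.IsPDivisor.prod {Y Y' : Scheme.{0}} [Y.Over SpecC] [Y'.Over SpecC]
    [IsNormalProjectiveVariety Y] [IsNormalProjectiveVariety Y'] {N N' : Type} [AddCommGroup N]
    [AddCommGroup N'] {D : PolyhedralDivisor Y N} {D' : PolyhedralDivisor Y' N'}
    (hD : D.IsPDivisor) (hD' : D'.IsPDivisor) : (D.prod D').IsPDivisor := by
  refine ⟨fun w hw => ?_, fun w hw => ?_⟩
  · have h := mem_dualCone_prodCone.mp hw
    rw [eval_prod D D' hw, locus_prod]
    exact IsSemiample.product IsNormalProjectiveVariety.normal IsNormalProjectiveVariety.normal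
      D.mem_locus_of_specializes D'.mem_locus_of_specializes (hD.1 _ h.1) (hD'.1 _ h.2)
  · rw [eval_prod D D' (core_subset _ hw), locus_prod]
    exact IsBig.product IsNormalProjectiveVariety.normal IsNormalProjectiveVariety.normal
      D.mem_locus_of_specializes D'.mem_locus_of_specializes (prodC.isPullback Y Y')
      (hD.2 _ (comp_inlQ_mem_core hw)) (hD'.2 _ (comp_inrQ_mem_core hw))

end TVar

end

theorem mainTheorem1 (Y Y' : Scheme.{0}) [Y.Over TVar.SpecC] [Y'.Over TVar.SpecC]
    [TVar.IsNormalProjectiveVariety Y] [TVar.IsNormalProjectiveVariety Y']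
    (N N' : Type) [AddCommGroup N] [Module.Free ℤ N] [Module.Finite ℤ N]
    [AddCommGroup N'] [Module.Free ℤ N'] [Module.Finite ℤ N']
    (D : TVar.PolyhedralDivisor Y N) (D' : TVar.PolyhedralDivisor Y' N')
    (hD : D.IsPDivisor) (hD' : D'.IsPDivisor) :
    (D.prod D').IsPDivisor ∧
    ∃ (e : (D.prod D').TV ≅ D.prodTV D')
      (he : e.hom ≫ D.prodTVToSpecC D' = (D.prod D').tvToSpecC),
      (D.prod D').act ≫ e.hom =
        pullback.map _ _ _ _ (𝟙 (TVar.torus (N × N'))) e.hom (𝟙 TVar.SpecC)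
          (by simp) (by simp [he]) ≫ D.prodAct D' :=
  ⟨hD.prod hD', D.tvProdIso D', D.tvProdIso_hom_toSpecC D', D.act_tvProdIso_hom D' _ _⟩
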